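/- \textbf{Initial data.} Let $Z$ be a finite-dimensional Euclidean space, $v^\vee=2v/|v|^2$ for $0\neq v\in Z$. Let $D=(R_0,\Delta_0,\bullet,\Lambda,\Lambda^d)$, where $R_0\subset Z$ is a finite, irreducible, reduced crystallographic root system in its real span, $\Delta_0=(\alpha_1,\dots,\alpha_n)$ an ordered basis of $R_0$, $\bullet\in\{u,t\}$, and $\Lambda,\Lambda^d$ are full lattices in $Z$ with $\mathbb{Z}R_0\subseteq\Lambda$, $(\Lambda,\mathbb{Z}R_0^\vee)\subseteq\mathbb{Z}$, $\mathbb{Z}R_0^d\subseteq\Lambda^d$, $(\Lambda^d,\mathbb{Z}R_0^{d\vee})\subseteq\mathbb{Z}$. Here $R_0^d=\{\alpha^d:=\mu_\alpha\alpha^\vee\}_{\alpha\in R_0}$ with $\mu_\alpha=1$ if $\bullet=u$ and $\mu_\alpha=|\alpha|^2/2$ if $\bullet=t$. The dual data are $D^d=(R_0^d,\Delta_0^d,\bullet,\Lambda^d,\Lambda)$, $\Delta_0^d=(\alpha_1^d,\dots,\alpha_n^d)$; objects attached to $D^d$ carry a superscript $d$. \textbf{Affine roots.} On $Z\oplus\mathbb{R}c$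 ($c$ the constant function $1$) put $(\lambda+rc,\lambda'+r'c)=(\lambda,\lambda')$, and for $a=\alpha+rc$ with $\alpha\neq0$ put $a^\vee=2a/|\alpha|^2$, $s_a(b)=b-(a^\vee,b)a$; for $v\in Z$ let $\tau(v)(\lambda+rc)=\lambda+(r-(\lambda,v))c$. Let $R^\bullet=\{m\mu_\alpha c+\alpha: m\in\mathbb{Z},\alpha\in R_0\}$, with basis $a_i=\alpha_i$ ($1\le i\le n$) and $a_0=c-\varphi$ ($\varphi$ the highest root) if $\bullet=u$, $a_0=\tfrac{|\theta|^2}{2}c-\theta$ ($\theta$ the highest short root) if $\bullet=t$; if there is only one root length, all roots are short. Let $W^\bullet$ be the group generated by the $s_a$ ($a\in R^\bullet$), $s_i=s_{a_i}$, $W=W_0\ltimes\tau(\Lambda^d)$ with $W_0$ the Weyl group of $R_0$, $l(w)=\#(R^{\bullet+}\cap w^{-1}R^{\bullet-})$ for $w\in W$, and $\Omega=\{w\in W: l(w)=0\}$. Let $S=\{i\in\{0,\dots,n\}:(\Lambda,a_i^\vee)=2\mathbb{Z}\}$ and $R=R^\bullet\cup\bigcup_{i\in S}W^\bullet(2a_i)$.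 \textbf{Braid groups.} The extended affine braid group $\mathcal{B}$ is generated by $T_w$ ($w\in W$) with relations $T_vT_w=T_{vw}$ whenever $l(vw)=l(v)+l(w)$; put $T_i=T_{s_i}$, and write $\omega$ for $T_\omega$ ($\omega\in\Omega$). Let $\xi\mapsto Y^\xi$ be the unique homomorphism $\Lambda^d\to\mathcal{B}$ with $Y^\xi=T_{\tau(\xi)}$ for dominant $\xi$ (i.e. $(\xi,\alpha^{d\vee})\ge0$ for all positive roots $\alpha\in R_0$). The double affine braid group $\mathbb{B}(D)$ is generated by the groups $\mathcal{B}$ and $\widehat\Lambda=\Lambda+\mathbb{R}c$ (the latter written $X^{\hat\lambda}$), with the relations, for $\hat\lambda\in\widehat\Lambda$ and $0\le i\le n$: $T_iX^{\hat\lambda}=X^{\hat\lambda}T_i$ if $(\hat\lambda,a_i^\vee)=0$; $T_iX^{\hat\lambda}T_i=X^{s_i\hat\lambda}$ if $(\hat\lambda,a_i^\vee)=1$; $\omega X^{\hat\lambda}=X^{\omega\hat\lambda}\omega$ for $\omega\in\Omega$. \textbf{Hecke algebras.} A multiplicity function is a $W$-invariant $\kappa:R\to\mathbb{C}^*$; put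 $\kappa_{2a}:=\kappa_a$ if $a\in R$, $2a\notin R$. For real $q>0$, $q\ne1$, the double affine Hecke algebra $\mathbb{H}(D;\kappa,q)$ is the quotient of $\mathbb{C}[\mathbb{B}(D)]$ by the two-sided ideal generated by $X^{rc}-q^r$ ($r\in\mathbb{R}$), $(T_j-\kappa_{a_j})(T_j+\kappa_{a_j}^{-1})$ ($0\le j\le n$) and $(V_i-\kappa_{2a_i})(V_i+\kappa_{2a_i}^{-1})$ ($i\in S$), with $V_i=X^{-a_i}T_i^{-1}$. \textbf{Theorem.} (1) There exists a unique antiisomorphism $\delta:\mathbb{B}(D)\to\mathbb{B}(D^d)$ with $\delta(X^{rc})=X^{rc}$ ($r\in\mathbb{R}$), $\delta(Y^\xi)={}^dX^{-\xi}$ ($\xi\in\Lambda^d$), $\delta(T_i)=T_i$ ($1\le i\le n$) and $\delta(X^\lambda)={}^dY^{-\lambda}$ ($\lambda\in\Lambda$). (2) Let $q>0$, $q\neq1$, and let $\kappa$ be a multiplicity function for $D$. There is a unique multiplicity function $\kappa^d$ for $D^d$ (the dual multiplicity function) with $\kappa^d_{a_0^d}=\kappa_{2\alpha_j}$ for every short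 simple root $\alpha_j$ of $R_0$; $\kappa^d_{\alpha_i^d}=\kappa_{\alpha_i}$ for $1\le i\le n$; $\kappa^d_{2a_0^d}=\kappa_{2a_0}$ if $0\in S^d$; and $\kappa^d_{2\alpha_j^d}=\kappa_{a_0}$ for every short simple root $\alpha_j^d$ of $R_0^d$ with $j\in S^d$. The map $\delta$ descends to an antiisomorphism of complex algebras $\mathbb{H}(D;\kappa,q)\to\mathbb{H}(D^d;\kappa^d,q)$, i.e. there is such an antiisomorphism sending the class of $g$ to the class of $\delta(g)$ for all $g\in\mathbb{B}(D)$. -/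

import Mathlib

noncomputable section

namespace DAHA

open scoped RealInnerProductSpace

/-! ## Finite root systems in a Euclidean space -/

section RootSystems

variable {Z : Type*} [NormedAddCommGroup Z] [InnerProductSpace ℝ Z]

/-- The covector `v^∨ = 2 v / |v|^2`. -/
def coroot (v : Z) : Z := (2 / ‖v‖ ^ 2) • v

/-- `R₀` is a finite, irreducible, reduced, crystallographic root system in its real span. -/
structure IsIrredRootSystem (R₀ : Set Z) : Prop where
  finite : R₀.Finite
  nonempty : R₀.Nonempty
  ne_zero : ∀ a ∈ R₀, a ≠ 0
  refl_mem : ∀ a ∈ R₀, ∀ b ∈ R₀, b - ⟪b, coroot a⟫ • a ∈ R₀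
  integral : ∀ a ∈ R₀, ∀ b ∈ R₀, ∃ k : ℤ, ⟪b, coroot a⟫ = k
  reduced : ∀ a ∈ R₀, ∀ t : ℝ, t • a ∈ R₀ → t = 1 ∨ t = -1
  irreducible : ∀ A B : Set Z, A ∪ B = R₀ → (∀ a ∈ A, ∀ b ∈ B, ⟪a, b⟫ = 0) → A = ∅ ∨ B = ∅

/-- `α = (α₁, …, αₙ)` is an ordered basis (simple system) of `R₀`: the `αᵢ` are linearly
independent roots, and every root is a linear combination of them with all coefficients
nonnegative or all coefficients nonpositive. -/
structure IsRootBasis (R₀ : Set Z) {n : ℕ} (α : Fin n → Z) : Prop where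
  mem : ∀ i, α i ∈ R₀
  linearIndependent : LinearIndependent ℝ α
  sign : ∀ b ∈ R₀, ∃ c : Fin n → ℝ, b = ∑ i, c i • α i ∧ ((∀ i, 0 ≤ c i) ∨ (∀ i, c i ≤ 0))

/-- The two values of the parameter `•`: untwisted `u` and twisted `t`. -/
inductive Kind
  | u
  | t

/-- `μ^u_α = 1` and `μ^t_α = |α|^2 / 2`. -/
def mu (k : Kind) (a : Z) : ℝ :=
  match k with
  | .u => 1
  | .t => ‖a‖ ^ 2 / 2

/-- `α^d = μ_α^• α^∨`. -/
def dualRoot (k : Kind) (a : Z) : Z := mu k a • coroot a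

theorem norm_sq_ne {a : Z} (ha : a ≠ 0) : ‖a‖ ^ 2 ≠ 0 := by
  simpa using ha

theorem inner_coroot_self {a : Z} (ha : a ≠ 0) : ⟪a, coroot a⟫ = 2 := by
  have := norm_sq_ne ha
  rw [coroot, inner_smul_right, real_inner_self_eq_norm_sq]
  field_simp

theorem coroot_ne_zero {a : Z} (ha : a ≠ 0) : coroot a ≠ 0 := by
  have := norm_sq_ne ha
  simp [coroot, ha]

theorem coroot_smul (t : ℝ) (a : Z) : coroot (t • a) = t⁻¹ • coroot a := by
  rcases eq_or_ne t 0 with rfl | ht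
  · simp [coroot]
  · rw [coroot, coroot, norm_smul, smul_smul, smul_smul]
    congr 1
    rw [mul_pow, Real.norm_eq_abs, sq_abs]
    field_simp

theorem coroot_coroot {a : Z} (ha : a ≠ 0) : coroot (coroot a) = a := by
  have h := norm_sq_ne ha
  conv_lhs => rw [show coroot a = (2 / ‖a‖ ^ 2) • a from rfl]
  rw [coroot_smul, coroot, smul_smul, inv_mul_cancel₀ (by positivity), one_smul]

theorem coroot_of_norm_eq {a b : Z} (h : ‖a‖ = ‖b‖) : coroot a = (2 / ‖b‖ ^ 2) • a := by
  rw [coroot, h]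

theorem norm_refl (a b : Z) : ‖b - ⟪b, coroot a⟫ • a‖ = ‖b‖ := by
  rcases eq_or_ne a 0 with rfl | ha
  · simp
  have h := norm_sq_ne ha
  have : ‖b - ⟪b, coroot a⟫ • a‖ ^ 2 = ‖b‖ ^ 2 := by
    rw [norm_sub_sq_real, norm_smul, mul_pow, Real.norm_eq_abs, sq_abs, inner_smul_right,
      coroot, inner_smul_right]
    field_simp
    ring
  exact (sq_eq_sq₀ (norm_nonneg _) (norm_nonneg _)).1 this

theorem dualRoot_t {a : Z} (ha : a ≠ 0) : dualRoot .t a = a := by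
  have h := norm_sq_ne ha
  rw [dualRoot, mu, coroot, smul_smul]
  rw [show ‖a‖ ^ 2 / 2 * (2 / ‖a‖ ^ 2) = 1 by field_simp, one_smul]

theorem dualRoot_u (a : Z) : dualRoot .u a = coroot a := by
  simp [dualRoot, mu]

theorem dualRoot_dualRoot (k : Kind) {a : Z} (ha : a ≠ 0) : dualRoot k (dualRoot k a) = a := by
  cases k
  · rw [dualRoot_u, dualRoot_u, coroot_coroot ha]
  · rw [dualRoot_t ha, dualRoot_t ha]

theorem IsIrredRootSystem.coroots {R₀ : Set Z} (h : IsIrredRootSystem R₀) :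
    IsIrredRootSystem (coroot '' R₀) where
  finite := h.finite.image _
  nonempty := h.nonempty.image _
  ne_zero := by
    rintro _ ⟨a, ha, rfl⟩
    exact coroot_ne_zero (h.ne_zero a ha)
  refl_mem := by
    rintro _ ⟨a, ha, rfl⟩ _ ⟨b, hb, rfl⟩
    refine ⟨_, h.refl_mem a ha b hb, ?_⟩
    rw [coroot_of_norm_eq (norm_refl a b), coroot_coroot (h.ne_zero a ha), smul_sub]
    simp only [coroot, smul_smul, inner_smul_left, inner_smul_right, map_div₀, map_pow,
      RCLike.conj_to_real, map_ofNat]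
    congr 2
    ring
  integral := by
    rintro _ ⟨a, ha, rfl⟩ _ ⟨b, hb, rfl⟩
    obtain ⟨k, hk⟩ := h.integral b hb a ha
    exact ⟨k, by rw [coroot_coroot (h.ne_zero a ha), real_inner_comm, hk]⟩
  reduced := by
    rintro _ ⟨a, ha, rfl⟩ t ⟨b, hb, hbt⟩
    have hb' : b = t⁻¹ • a := by
      rw [← coroot_coroot (h.ne_zero b hb), hbt, coroot_smul, coroot_coroot (h.ne_zero a ha)]
    rcases h.reduced a ha t⁻¹ (hb' ▸ hb) with h1 | h1
    · exact Or.inl (inv_eq_one.1 h1)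
    · exact Or.inr (by rw [← inv_inv t, h1]; norm_num)
  irreducible := by
    intro A B hAB hort
    have key : ∀ C : Set Z, C ⊆ coroot '' R₀ → coroot '' C ⊆ R₀ := by
      rintro C hC _ ⟨x, hx, rfl⟩
      obtain ⟨a, ha, rfl⟩ := hC hx
      rwa [coroot_coroot (h.ne_zero a ha)]
    have := h.irreducible (coroot '' A) (coroot '' B) ?_ ?_
    · simpa using this
    · rw [← Set.image_union, hAB]
      ext x
      constructor
      · exact fun hx => key _ subset_rfl hx
      · exact fun hx => ⟨coroot x, ⟨x, hx, rfl⟩, coroot_coroot (h.ne_zero x hx)⟩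
    · rintro _ ⟨a, ha, rfl⟩ _ ⟨b, hb, rfl⟩
      simp [coroot, inner_smul_left, inner_smul_right, hort a ha b hb]

theorem IsIrredRootSystem.image_t {R₀ : Set Z} (h : IsIrredRootSystem R₀) :
    dualRoot .t '' R₀ = R₀ := by
  ext x
  constructor
  · rintro ⟨a, ha, rfl⟩
    rwa [dualRoot_t (h.ne_zero a ha)]
  · exact fun hx => ⟨x, hx, dualRoot_t (h.ne_zero x hx)⟩

theorem IsIrredRootSystem.dual {R₀ : Set Z} (h : IsIrredRootSystem R₀) (k : Kind) :
    IsIrredRootSystem (dualRoot k '' R₀) := by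
  cases k
  · have : (dualRoot .u : Z → Z) = coroot := funext dualRoot_u
    rw [this]
    exact h.coroots
  · rw [h.image_t]
    exact h

theorem IsRootBasis.dual {R₀ : Set Z} {n : ℕ} {α : Fin n → Z} (hα : IsRootBasis R₀ α)
    (h : IsIrredRootSystem R₀) (k : Kind) :
    IsRootBasis (dualRoot k '' R₀) (fun i => dualRoot k (α i)) := by
  have hpos : ∀ a ∈ R₀, ∃ c : ℝ, 0 < c ∧ dualRoot k a = c • a := by
    intro a ha
    have h0 := norm_sq_ne (h.ne_zero a ha)
    have h1 : 0 < ‖a‖ ^ 2 := lt_of_le_of_ne (by positivity) h0.symm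
    cases k
    · exact ⟨2 / ‖a‖ ^ 2, by positivity, dualRoot_u a⟩
    · exact ⟨1, one_pos, by rw [dualRoot_t (h.ne_zero a ha), one_smul]⟩
  choose! d hd0 hd using hpos
  refine ⟨fun i => ⟨_, hα.mem i, rfl⟩, ?_, ?_⟩
  · have := hα.linearIndependent.units_smul
      (fun i => Units.mk0 (d (α i)) (hd0 _ (hα.mem i)).ne')
    convert this using 1
    funext i
    simp [hd _ (hα.mem i), Units.smul_def]
  · rintro _ ⟨b, hb, rfl⟩
    obtain ⟨c, hc, hs⟩ := hα.sign b hb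
    have hp : ∀ i, 0 < d b * (d (α i))⁻¹ := fun i =>
      mul_pos (hd0 _ hb) (inv_pos.2 (hd0 _ (hα.mem i)))
    refine ⟨fun i => c i * (d b * (d (α i))⁻¹), ?_, ?_⟩
    · rw [hd b hb]
      have hs' : d b • b = d b • ∑ i, c i • α i := congrArg (d b • ·) hc
      rw [hs', Finset.smul_sum]
      refine Finset.sum_congr rfl fun i _ => ?_
      rw [hd _ (hα.mem i), smul_smul, smul_smul]
      congr 1
      have := (hd0 _ (hα.mem i)).ne'
      field_simp
    · rcases hs with hs | hs
      · exact Or.inl fun i => mul_nonneg (hs i) (hp i).le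
      · exact Or.inr fun i => mul_nonpos_of_nonpos_of_nonneg (hs i) (hp i).le

/-! ## Affine linear functions

The space of affine linear functions on `Z` is identified with `Z ⊕ ℝ c`: the pair `(z, r)` is the
function `x ↦ (z, x) + r`. The gradient of `a` is `a.1`, and `(a, b) = (a.1, b.1)`. -/

/-- `s_a(b) = b - (a^∨, b) a` as a linear map. -/
def affReflFun (a : Z × ℝ) : (Z × ℝ) →ₗ[ℝ] (Z × ℝ) where
  toFun b := b - ⟪coroot a.1, b.1⟫ • a
  map_add' b b' := by
    simp only [Prod.fst_add, inner_add_right, add_smul]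
    abel
  map_smul' r b := by
    simp only [Prod.smul_fst, inner_smul_right, RingHom.id_apply, smul_sub, mul_smul]

theorem affReflFun_involutive (a : Z × ℝ) : Function.Involutive (affReflFun a) := by
  intro b
  change (b - ⟪coroot a.1, b.1⟫ • a) -
    ⟪coroot a.1, (b - ⟪coroot a.1, b.1⟫ • a).1⟫ • a = b
  rcases eq_or_ne a.1 0 with h | h
  · simp [h, coroot]
  · have h2 : ⟪coroot a.1, a.1⟫ = 2 := by rw [real_inner_comm, inner_coroot_self h]
    simp only [Prod.fst_sub, Prod.smul_fst, inner_sub_right, inner_smul_right, h2]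
    module

/-- The reflection `s_a` of the space of affine linear functions. -/
def affRefl (a : Z × ℝ) : (Z × ℝ) ≃ₗ[ℝ] (Z × ℝ) :=
  LinearEquiv.ofInvolutive (affReflFun a) (affReflFun_involutive a)

theorem affRefl_apply (a b : Z × ℝ) : affRefl a b = b - ⟪coroot a.1, b.1⟫ • a := rfl

/-- The translation `τ(v) a = a - (Da, v) c`. -/
def trans (v : Z) : (Z × ℝ) ≃ₗ[ℝ] (Z × ℝ) where
  toFun b := (b.1, b.2 - ⟪b.1, v⟫)
  invFun b := (b.1, b.2 + ⟪b.1, v⟫)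
  map_add' b b' := by
    ext
    · rfl
    · simp only [Prod.fst_add, Prod.snd_add, inner_add_left]
      ring
  map_smul' r b := by
    ext
    · rfl
    · simp only [Prod.smul_fst, Prod.smul_snd, inner_smul_left, RCLike.conj_to_real,
        RingHom.id_apply, smul_eq_mul]
      ring
  left_inv b := by simp
  right_inv b := by simp

theorem trans_apply (v : Z) (b : Z × ℝ) : trans v b = (b.1, b.2 - ⟪b.1, v⟫) := rfl

theorem affRefl_eq_trans_mul (k : Kind) (b : Z) (hb : b ≠ 0) :
    affRefl (-b, mu k b) = trans (dualRoot k b) * affRefl (b, 0) := by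
  ext x : 1
  have h2 := inner_coroot_self hb
  have hc : coroot (-b) = -coroot b := by simp [coroot]
  rw [LinearEquiv.mul_apply, trans_apply, affRefl_apply, affRefl_apply]
  simp only [hc]
  ext
  · simp [inner_neg_left]
  · simp only [Prod.snd_sub, Prod.smul_snd, Prod.fst_sub, Prod.smul_fst, smul_eq_mul, mul_zero,
      dualRoot, inner_smul_right, inner_sub_left, inner_smul_left, h2, RCLike.conj_to_real,
      inner_neg_left, real_inner_comm x.1 (coroot b)]
    ring

end RootSystems

/-! ## Initial data -/

/-- Initial data `D = (R₀, Δ₀, •, Λ, Λ^d)` of rank `n` in the Euclidean space `Z`. -/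
structure InitialData (Z : Type*) [NormedAddCommGroup Z] [InnerProductSpace ℝ Z] (n : ℕ) where
  R₀ : Set Z
  isRootSystem : IsIrredRootSystem R₀
  α : Fin n → Z
  isBasis : IsRootBasis R₀ α
  kind : Kind
  Lam : Submodule ℤ Z
  LamD : Submodule ℤ Z
  discrete_Lam : DiscreteTopology Lam
  isLattice_Lam : IsZLattice ℝ Lam
  discrete_LamD : DiscreteTopology LamD
  isLattice_LamD : IsZLattice ℝ LamD
  root_mem : ∀ a ∈ R₀, a ∈ Lam
  inner_coroot_int : ∀ l ∈ Lam, ∀ a ∈ R₀, ∃ k : ℤ, ⟪l, coroot a⟫ = k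
  dualRoot_mem : ∀ a ∈ R₀, dualRoot kind a ∈ LamD
  inner_coroot_dualRoot_int :
    ∀ l ∈ LamD, ∀ a ∈ R₀, ∃ k : ℤ, ⟪l, coroot (dualRoot kind a)⟫ = k

namespace InitialData

variable {Z : Type*} [NormedAddCommGroup Z] [InnerProductSpace ℝ Z] {n : ℕ}

/-- The dual initial data `D^d = (R₀^d, Δ₀^d, •, Λ^d, Λ)`. -/
def dual (D : InitialData Z n) : InitialData Z n where
  R₀ := dualRoot D.kind '' D.R₀
  isRootSystem := D.isRootSystem.dual D.kind
  α := fun i => dualRoot D.kind (D.α i)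
  isBasis := D.isBasis.dual D.isRootSystem D.kind
  kind := D.kind
  Lam := D.LamD
  LamD := D.Lam
  discrete_Lam := D.discrete_LamD
  isLattice_Lam := D.isLattice_LamD
  discrete_LamD := D.discrete_Lam
  isLattice_LamD := D.isLattice_Lam
  root_mem := by
    rintro _ ⟨a, ha, rfl⟩
    exact D.dualRoot_mem a ha
  inner_coroot_int := by
    rintro l hl _ ⟨a, ha, rfl⟩
    exact D.inner_coroot_dualRoot_int l hl a ha
  dualRoot_mem := by
    rintro _ ⟨a, ha, rfl⟩
    rw [dualRoot_dualRoot _ (D.isRootSystem.ne_zero a ha)]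
    exact D.root_mem a ha
  inner_coroot_dualRoot_int := by
    rintro l hl _ ⟨a, ha, rfl⟩
    rw [dualRoot_dualRoot _ (D.isRootSystem.ne_zero a ha)]
    exact D.inner_coroot_int l hl a ha

variable (D : InitialData Z n)

/-- `b` is a short root, i.e. a root of minimal length (so all roots are short if there is only
one root length). -/
def IsShort (b : Z) : Prop := b ∈ D.R₀ ∧ ∀ a ∈ D.R₀, ‖b‖ ≤ ‖a‖

/-- The dominance order: `b ≤ a` if `a - b` is a sum of simple roots. -/
def DomLE (b a : Z) : Prop := ∃ c : Fin n → ℕ, a - b = ∑ i, c i • D.α i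

instance : Nonempty D.R₀ := D.isRootSystem.nonempty.to_subtype

/-- The highest root `φ`: the unique root `φ` with `b ≤ φ` for all roots `b`. -/
def phi : D.R₀ :=
  Classical.epsilon fun a : D.R₀ => ∀ b ∈ D.R₀, D.DomLE b a

/-- The highest short root `θ`: the unique short root `θ` with `b ≤ θ` for all short roots `b`. -/
def theta : D.R₀ :=
  Classical.epsilon fun a : D.R₀ => D.IsShort a ∧ ∀ b, D.IsShort b → D.DomLE b a

/-- `-Da₀`, that is, `φ` in the untwisted case and `θ` in the twisted case. -/
def beta : D.R₀ :=
  match D.kind with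
  | .u => D.phi
  | .t => D.theta

/-- The simple affine roots: `a₀ = c - φ` if `• = u`, `a₀ = (|θ|^2 / 2) c - θ` if `• = t`, and
`aᵢ = αᵢ` for `1 ≤ i ≤ n`. -/
def a : Fin (n + 1) → Z × ℝ :=
  Fin.cons (-(D.beta : Z), mu D.kind (D.beta : Z)) fun i => (D.α i, 0)

/-- `R^• = {m μ_α c + α}`. -/
def Rb : Set (Z × ℝ) := {x | ∃ b ∈ D.R₀, ∃ m : ℤ, x = (b, m * mu D.kind b)}

/-- The affine Weyl group `W^•` of `R^•`. -/
def Wb : Subgroup ((Z × ℝ) ≃ₗ[ℝ] (Z × ℝ)) :=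
  Subgroup.closure {g | ∃ x ∈ D.Rb, g = affRefl x}

/-- `S = {i | (Λ, aᵢ^∨) = 2ℤ}`. -/
def S : Set (Fin (n + 1)) :=
  {i | {r : ℝ | ∃ l ∈ D.Lam, r = ⟪l, coroot (D.a i).1⟫} = {r : ℝ | ∃ k : ℤ, r = 2 * k}}

/-- The affine root system `R = R^• ∪ ⋃_{i ∈ S} W^•(2 aᵢ)`. -/
def R : Set (Z × ℝ) :=
  D.Rb ∪ {x | ∃ i ∈ D.S, ∃ w ∈ D.Wb, x = w ((2 : ℝ) • D.a i)}

/-- The extended affine Weyl group `W = W₀ ⋉ Λ^d`, as group of linear automorphisms of the space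
of affine linear functions. -/
def W : Subgroup ((Z × ℝ) ≃ₗ[ℝ] (Z × ℝ)) :=
  Subgroup.closure ({g | ∃ b ∈ D.R₀, g = affRefl (b, 0)} ∪ {g | ∃ v ∈ D.LamD, g = trans v})

theorem neg_mem {b : Z} (hb : b ∈ D.R₀) : -b ∈ D.R₀ := by
  have h := D.isRootSystem.refl_mem b hb b hb
  rw [inner_coroot_self (D.isRootSystem.ne_zero b hb), two_smul] at h
  simpa using h

theorem a_zero : D.a 0 = (-(D.beta : Z), mu D.kind (D.beta : Z)) := rfl

theorem a_succ (i : Fin n) : D.a i.succ = (D.α i, 0) := rfl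

theorem a_fst_mem (i : Fin (n + 1)) : (D.a i).1 ∈ D.R₀ := by
  refine Fin.cases ?_ (fun j => ?_) i
  · exact D.neg_mem D.beta.2
  · exact D.isBasis.mem j

theorem a_mem_Rb (i : Fin (n + 1)) : D.a i ∈ D.Rb := by
  refine ⟨_, D.a_fst_mem i, ?_⟩
  refine Fin.cases ⟨1, ?_⟩ (fun j => ⟨0, ?_⟩) i
  · rw [a_zero]
    cases h : D.kind <;> simp [mu]
  · rw [a_succ]
    simp

theorem a_mem_R (i : Fin (n + 1)) : D.a i ∈ D.R := Or.inl (D.a_mem_Rb i)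

/-- The simple reflections `sᵢ = s_{aᵢ}` belong to `W`. -/
theorem affRefl_a_mem_W (i : Fin (n + 1)) : affRefl (D.a i) ∈ D.W := by
  refine Fin.cases ?_ (fun j => ?_) i
  · rw [a_zero, affRefl_eq_trans_mul _ _ (D.isRootSystem.ne_zero _ D.beta.2)]
    exact mul_mem (Subgroup.subset_closure (Or.inr ⟨_, D.dualRoot_mem _ D.beta.2, rfl⟩))
      (Subgroup.subset_closure (Or.inl ⟨_, D.beta.2, rfl⟩))
  · exact Subgroup.subset_closure (Or.inl ⟨_, D.isBasis.mem j, rfl⟩)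

/-- The simple reflection `sᵢ ∈ W`, `0 ≤ i ≤ n`. -/
def s (i : Fin (n + 1)) : D.W := ⟨affRefl (D.a i), D.affRefl_a_mem_W i⟩

/-- The translation `τ(ξ) ∈ W` for `ξ ∈ Λ^d`. -/
def tau (v : D.LamD) : D.W :=
  ⟨trans (v : Z), Subgroup.subset_closure (Or.inr ⟨_, v.2, rfl⟩)⟩

/-- Nonnegative integral combinations of the simple affine roots; `x` and `-x` run through the
positive and negative affine roots. -/
def IsPos (x : Z × ℝ) : Prop := ∃ c : Fin (n + 1) → ℕ, x = ∑ i, c i • D.a i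

/-- The length `l(w) = #(R^{•+} ∩ w⁻¹ R^{•-})`. -/
def length (w : D.W) : ℕ :=
  Set.ncard {x | x ∈ D.Rb ∧ D.IsPos x ∧ D.IsPos (-((w : (Z × ℝ) ≃ₗ[ℝ] (Z × ℝ)) x))}

/-! ## The extended affine braid group -/

/-- The relations `T_v T_w = T_{vw}` if `l(vw) = l(v) + l(w)`. -/
def braidRels : Set (FreeGroup D.W) :=
  {r | ∃ v w : D.W, D.length (v * w) = D.length v + D.length w ∧
    r = FreeGroup.of v * FreeGroup.of w * (FreeGroup.of (v * w))⁻¹}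

/-- The extended affine braid group `𝓑(D)`. -/
abbrev Braid : Type _ := PresentedGroup D.braidRels

/-- The generators `T_w`, `w ∈ W`, of `𝓑(D)`. -/
def Tw (w : D.W) : D.Braid := PresentedGroup.of w

/-- The dominant cone `Λ^{d+} = {ξ ∈ Λ^d | (ξ, α^{d∨}) ≥ 0 for all positive roots α}`. -/
def IsDominant (v : D.LamD) : Prop :=
  ∀ b ∈ D.R₀, D.DomLE 0 b → 0 ≤ ⟪(v : Z), coroot (dualRoot D.kind b)⟫

/-- `ξ ↦ Y^ξ`: the unique group homomorphism `Λ^d → 𝓑` with `Y^ξ = T_{τ(ξ)}` for all dominant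
`ξ`. -/
def Yhom : Multiplicative D.LamD →* D.Braid :=
  Classical.epsilon fun f : Multiplicative D.LamD →* D.Braid =>
    ∀ v : D.LamD, D.IsDominant v → f (Multiplicative.ofAdd v) = D.Tw (D.tau v)

/-! ## The double affine braid group -/

/-- `Λ̂ = Λ + ℝ c`. -/
def LamHat : AddSubgroup (Z × ℝ) := D.Lam.toAddSubgroup.prod ⊤

theorem mem_LamHat {x : Z × ℝ} : x ∈ D.LamHat ↔ x.1 ∈ D.Lam := by
  simp [LamHat, AddSubgroup.mem_prod]

theorem W_apply_mem {w : (Z × ℝ) ≃ₗ[ℝ] (Z × ℝ)} (hw : w ∈ D.W) :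
    ∀ x, w x ∈ D.LamHat ↔ x ∈ D.LamHat := by
  induction hw using Subgroup.closure_induction with
  | mem g hg =>
    rcases hg with ⟨b, hb, rfl⟩ | ⟨v, _, rfl⟩
    · have key : ∀ x ∈ D.LamHat, affRefl (b, 0) x ∈ D.LamHat := by
        intro x hx
        rw [mem_LamHat] at hx ⊢
        obtain ⟨k, hk⟩ := D.inner_coroot_int _ hx b hb
        rw [affRefl_apply, Prod.fst_sub, Prod.smul_fst, real_inner_comm, hk,
          Int.cast_smul_eq_zsmul]
        exact sub_mem hx (D.Lam.smul_mem k (D.root_mem b hb))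
      intro x
      refine ⟨fun h => ?_, key x⟩
      have := key _ h
      rwa [show affRefl (b, (0 : ℝ)) (affRefl (b, 0) x) = x from
        affReflFun_involutive (b, (0 : ℝ)) x] at this
    · intro x
      rw [mem_LamHat, mem_LamHat, trans_apply]
  | one => intro x; rfl
  | mul g h _ _ hg hh =>
    intro x
    rw [LinearEquiv.mul_apply, hg, hh]
  | inv g _ hg =>
    intro x
    rw [← hg, ← LinearEquiv.mul_apply, mul_inv_cancel]
    rfl

/-- The action of `W` on `Λ̂`. -/
def act (w : D.W) (x : D.LamHat) : D.LamHat :=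
  ⟨(w : (Z × ℝ) ≃ₗ[ℝ] (Z × ℝ)) x, (D.W_apply_mem w.2 x).2 x.2⟩

/-- The simple affine root `aᵢ` as element of `Λ̂`. -/
def aHat (i : Fin (n + 1)) : D.LamHat :=
  ⟨D.a i, D.mem_LamHat.2 (D.root_mem _ (D.a_fst_mem i))⟩

/-- The free product of `𝓑` and `Λ̂`. -/
abbrev FreeProd : Type _ := Monoid.Coprod D.Braid (Multiplicative D.LamHat)

/-- `T_w` in the free product. -/
def fT (w : D.W) : D.FreeProd := Monoid.Coprod.inl (D.Tw w)

/-- `X^x`, `x ∈ Λ̂`, in the free product. -/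
def fX (x : D.LamHat) : D.FreeProd := Monoid.Coprod.inr (Multiplicative.ofAdd x)

/-- The relators of the double affine braid group. -/
inductive DARel : D.FreeProd → Prop
  | comm (i : Fin (n + 1)) (x : D.LamHat) (h : ⟪(x : Z × ℝ).1, coroot (D.a i).1⟫ = 0) :
      DARel (D.fT (D.s i) * D.fX x * (D.fX x * D.fT (D.s i))⁻¹)
  | cross (i : Fin (n + 1)) (x : D.LamHat) (h : ⟪(x : Z × ℝ).1, coroot (D.a i).1⟫ = 1) :
      DARel (D.fT (D.s i) * D.fX x * D.fT (D.s i) * (D.fX (D.act (D.s i) x))⁻¹)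
  | omega (w : D.W) (hw : D.length w = 0) (x : D.LamHat) :
      DARel (D.fT w * D.fX x * (D.fX (D.act w x) * D.fT w)⁻¹)

/-- The double affine braid group `𝔹(D)`. -/
abbrev DABraid : Type _ := D.FreeProd ⧸ Subgroup.normalClosure {r | D.DARel r}

/-- `T_i ∈ 𝔹(D)`, `0 ≤ i ≤ n`. -/
def T (i : Fin (n + 1)) : D.DABraid := QuotientGroup.mk (D.fT (D.s i))

/-- `X^x ∈ 𝔹(D)` for `x ∈ Λ̂`. -/
def Xhat (x : D.LamHat) : D.DABraid := QuotientGroup.mk (D.fX x)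

/-- `X^λ ∈ 𝔹(D)` for `λ ∈ Λ`. -/
def X (l : D.Lam) : D.DABraid := D.Xhat ⟨((l : Z), 0), D.mem_LamHat.2 l.2⟩

/-- `X^{rc} ∈ 𝔹(D)` for `r ∈ ℝ`. -/
def Xc (r : ℝ) : D.DABraid := D.Xhat ⟨(0, r), D.mem_LamHat.2 D.Lam.zero_mem⟩

/-- `Y^ξ ∈ 𝔹(D)` for `ξ ∈ Λ^d`. -/
def Y (v : D.LamD) : D.DABraid :=
  QuotientGroup.mk (Monoid.Coprod.inl (D.Yhom (Multiplicative.ofAdd v)) : D.FreeProd)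

/-- `V_i = X^{-a_i} T_i⁻¹`. -/
def V (i : Fin (n + 1)) : D.DABraid := D.Xhat (-D.aHat i) * (D.T i)⁻¹

/-! ## Multiplicity functions -/

/-- A multiplicity function: a `W`-invariant function `κ : R → ℂ^*`. -/
@[ext]
structure Mult where
  toFun : D.R → ℂˣ
  invariant : ∀ w ∈ D.W, ∀ x y : D.R, (y : Z × ℝ) = w x → toFun y = toFun x

variable {D}

/-- The value `κ_{aᵢ}`. -/
def Mult.val (κ : D.Mult) (i : Fin (n + 1)) : ℂˣ := κ.toFun ⟨D.a i, D.a_mem_R i⟩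

open Classical in
/-- The value `κ_{2aᵢ}`, where `κ_{2aᵢ} := κ_{aᵢ}` if `2aᵢ ∉ R`. -/
def Mult.val2 (κ : D.Mult) (i : Fin (n + 1)) : ℂˣ :=
  if h : (2 : ℝ) • D.a i ∈ D.R then κ.toFun ⟨(2 : ℝ) • D.a i, h⟩ else κ.val i

/-- `κ' ∈ 𝓜(D^d)` is the multiplicity function `κ^d` dual to `κ ∈ 𝓜(D)`. -/
structure Mult.IsDual (κ : D.Mult) (κ' : D.dual.Mult) : Prop where
  zero : ∀ j : Fin n, D.IsShort (D.α j) → κ'.val 0 = κ.val2 j.succ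
  succ : ∀ i : Fin n, κ'.val i.succ = κ.val i.succ
  two_zero : (0 : Fin (n + 1)) ∈ D.dual.S → κ'.val2 0 = κ.val2 0
  two_succ : ∀ j : Fin n, D.dual.IsShort (D.dual.α j) → j.succ ∈ D.dual.S →
    κ'.val2 j.succ = κ.val 0

/-! ## The double affine Hecke algebra -/

/-- The canonical map from the double affine braid group to its complex group algebra. -/
def gp (g : D.DABraid) : MonoidAlgebra ℂ D.DABraid := MonoidAlgebra.of ℂ D.DABraid g

/-- Scalars in the group algebra. -/
def sc (D : InitialData Z n) (z : ℂ) : MonoidAlgebra ℂ D.DABraid := algebraMap ℂ _ z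

/-- The relations of the double affine Hecke algebra: `X^{rc} = q^r`,
`(T_j - κ_{a_j}) (T_j + κ_{a_j}⁻¹) = 0` for `0 ≤ j ≤ n`, and
`(V_i - κ_{2a_i}) (V_i + κ_{2a_i}⁻¹) = 0` for `i ∈ S`. -/
inductive HeckeRel (κ : D.Mult) (q : ℝ) :
    MonoidAlgebra ℂ D.DABraid → MonoidAlgebra ℂ D.DABraid → Prop
  | central (r : ℝ) : HeckeRel κ q (gp (D.Xc r)) (D.sc ((q ^ r : ℝ) : ℂ))
  | quadT (j : Fin (n + 1)) :
      HeckeRel κ q ((gp (D.T j) - D.sc (κ.val j)) * (gp (D.T j) + D.sc ((κ.val j)⁻¹ : ℂˣ))) 0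
  | quadV (i : Fin (n + 1)) (hi : i ∈ D.S) :
      HeckeRel κ q ((gp (D.V i) - D.sc (κ.val2 i)) * (gp (D.V i) + D.sc ((κ.val2 i)⁻¹ : ℂˣ))) 0

/-- The double affine Hecke algebra `ℍ(D; κ, q)`, the quotient of the group algebra of `𝔹(D)` by
the two-sided ideal generated by the relations `HeckeRel`. -/
abbrev DAHecke (κ : D.Mult) (q : ℝ) : Type _ := RingQuot (HeckeRel κ q)

/-- The canonical map `𝔹(D) → ℍ(D; κ, q)`. -/
def toHecke (κ : D.Mult) (q : ℝ) (g : D.DABraid) : DAHecke κ q :=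
  RingQuot.mkAlgHom ℂ (HeckeRel κ q) (gp g)

/-! ## Duality -/

/-- The defining properties of the duality antiisomorphism `δ : 𝔹(D) → 𝔹(D^d)`; an
antiisomorphism is an isomorphism onto the opposite group. -/
structure IsDuality (δ : D.DABraid ≃* (D.dual.DABraid)ᵐᵒᵖ) : Prop where
  Xc : ∀ r : ℝ, δ (D.Xc r) = MulOpposite.op (D.dual.Xc r)
  Y : ∀ v : D.LamD, δ (D.Y v) = MulOpposite.op (D.dual.X (-v))
  T : ∀ i : Fin n, δ (D.T i.succ) = MulOpposite.op (D.dual.T i.succ)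
  X : ∀ l : D.Lam, δ (D.X l) = MulOpposite.op (D.dual.Y (-l))

end InitialData

end DAHA

end

/-!
The proof rests on a description of the braid group by oriented galleries. Write `w ∈ W` as
`τ(ξ) v` with `ξ = tr w` and `v = lin w`, and put `E(w) = Y^ξ T_{v⁻¹}⁻¹` and
`P_g(w) = E(g)⁻¹ E(g w)`. Geometrically, `P_g(w)` is the product of the `T_i^{±1}` along a gallery
from the fundamental alcove to its image under `w`, with signs given by an orientation of all walls
by one Weyl chamber, that of `lin g`. If this chamber lies on the negative side of all walls that are
crossed, then it is called good for `w`, and all signs are positive, so that `P_g(w) = T_w`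
(`Tw_eq_P`). A good chamber always exists, in the direction of the displacement of an interior point
of the alcove (`exists_good`).

The elements `E(w)` make sense in any group with elements `T_v` (`v` in the finite Weyl group) and
`Y^ξ` satisfying the Bernstein relations: the braid relations of the finite Weyl group, and the
relations between `T_i` and `Y^ξ` for `1 ≤ i ≤ n`. Then `P_u(w)` is the same for all good `u`: any
two good chambers are connected by a gallery of good chambers, and for adjacent ones the assertion
is one of the Bernstein relations (`BernsteinData.P_eq_of_good`). Multiplicativity follows, since a
good chamber for a reduced product is good for the factors. This is the Bernstein presentation of
the extended affine braid group (`BernsteinData.lift`).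

In the opposite of the double affine braid group of the dual data, the elements `T_{v⁻¹}` and
`X^{-ξ}` satisfy the Bernstein relations for `D` (`dualData`): these are defining relations there. So
the duality antihomomorphism exists on the affine braid group, and it takes `T_w` to
`E(v⁻¹) X^{-ξ}` whenever the fundamental chamber is good for `w = τ(ξ) v`, in particular for `w = s₀`
and for `w ∈ Ω`. What remains are the relations of these two kinds of elements with the `Y^λ`. In
general, moving `X^x` through a gallery changes the orientation of the gallery from one chamber to
another one, if the two chambers separate the walls in accordance with the pairing of `x` with the
corresponding coroots, which has to be `0` or `±1` (`P_mul_Xhat`). For `Ω` this condition follows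
from length zero (`compat_length_zero`). For `s₀` it holds because `β^d` is the dominant short root
of `R₀^d` (`dual_isShort_beta`), so that it pairs to `0` or `±1` with all coroots but those of `±β^d`
(`compat_short`); walls parallel to that of `β^d` are avoided by the choice of the gallery
(`Y_comm_EX_short`, `EX_short_cross`). This gives the antihomomorphism `deltaHom`. The `X^λ`, `X^{rc}`,
`Y^ξ` and `T_i` with `i ≠ 0` generate the double affine braid group (`DABraid_hom_ext`), which gives
uniqueness, and shows that the antihomomorphisms for `D` and for its dual are inverse to each other.

For the Hecke algebras one has to compare quadratic relations, which are invariant under conjugation.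
If `α_j^d` is short, then `T₀` is conjugate to `Y^{α_j^d} T_j⁻¹` (`isConj_T_zero`), and duality takes
this to a conjugate of `V_j`. Hence duality exchanges `T₀` and the `V_j` belonging to short simple
roots up to conjugacy, it fixes `T_j` for `j ≠ 0`, and it fixes `V₀` if `0 ∈ S`
(`isConj_deltaHom_T_zero`, `isConj_deltaHom_V_succ`, `deltaHom_V_zero`). For `i ∉ S` the relation for
`V_i` holds as well, because `V_i` is then conjugate to `T_i` (`isConj_T_V`). The dual multiplicity
function exists and is unique because the `W`-orbits on `R` are represented by the simple affine
roots `a_i` and the `2 a_i` with `i ∈ S` (`exists_conj_a`, `exists_mult`, `exists_isDual`).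
-/

noncomputable section

set_option linter.unusedSectionVars false

namespace DAHA

open scoped RealInnerProductSpace

/-! ### Reflections and the finite Weyl group -/

section Reflections

variable {Z : Type*} [NormedAddCommGroup Z] [InnerProductSpace ℝ Z]

theorem isom_mul_apply (v w : Z ≃ₗᵢ[ℝ] Z) (x : Z) : (v * w) x = v (w x) := rfl

/-- The orthogonal reflection of `Z` in the hyperplane `b^⊥`, as a linear isometry. -/
def sref (b : Z) : Z ≃ₗᵢ[ℝ] Z := (ℝ ∙ b)ᗮ.reflection

theorem sref_apply (b x : Z) : sref b x = x - ⟪x, coroot b⟫ • b := by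
  rw [sref, Submodule.reflection_orthogonal_apply, Submodule.reflection_singleton_apply, coroot,
    inner_smul_right, real_inner_comm, two_smul, ← add_smul, neg_sub]
  congr 2
  simp only [RCLike.ofReal_real_eq_id, id_eq]
  ring

theorem sref_sref (b x : Z) : sref b (sref b x) = x :=
  Submodule.reflection_reflection _ x

theorem sref_mul_self (b : Z) : sref b * sref b = 1 := by
  ext x
  exact sref_sref b x

theorem sref_inv (b : Z) : (sref b)⁻¹ = sref b :=
  inv_eq_of_mul_eq_one_right (sref_mul_self b)

theorem sref_self {b : Z} (hb : b ≠ 0) : sref b b = -b := by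
  rw [sref_apply, inner_coroot_self hb]
  module

theorem coroot_map (v : Z ≃ₗᵢ[ℝ] Z) (b : Z) : coroot (v b) = v (coroot b) := by
  simp [coroot]

theorem sref_map (v : Z ≃ₗᵢ[ℝ] Z) (b : Z) : sref (v b) = v * sref b * v⁻¹ := by
  ext x
  have h : ⟪v⁻¹ x, coroot b⟫ = ⟪x, v (coroot b)⟫ := by
    rw [← v.inner_map_map, ← isom_mul_apply, mul_inv_cancel]
    rfl
  rw [isom_mul_apply, isom_mul_apply, sref_apply, sref_apply, map_sub,
    map_smul, h, coroot_map, ← isom_mul_apply v v⁻¹, mul_inv_cancel]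
  rfl

theorem sref_smul {t : ℝ} (ht : t ≠ 0) (b : Z) : sref (t • b) = sref b := by
  ext x
  rw [sref_apply, sref_apply, coroot_smul, inner_smul_right, smul_smul]
  congr 2
  field_simp

theorem sref_neg (b : Z) : sref (-b) = sref b := by
  rw [← sref_smul (t := -1) (by norm_num) b, neg_one_smul]

theorem inner_coroot_pos {x b : Z} (hb : b ≠ 0) : 0 < ⟪x, coroot b⟫ ↔ 0 < ⟪x, b⟫ := by
  have : 0 < ‖b‖ := norm_pos_iff.2 hb
  rw [coroot, inner_smul_right]
  exact mul_pos_iff_of_pos_left (by positivity)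

theorem inner_coroot_neg {x b : Z} (hb : b ≠ 0) : ⟪x, coroot b⟫ < 0 ↔ ⟪x, b⟫ < 0 := by
  have := inner_coroot_pos (x := -x) hb
  simpa [inner_neg_left] using this

theorem inner_coroot_nonneg {x b : Z} (hb : b ≠ 0) : 0 ≤ ⟪x, coroot b⟫ ↔ 0 ≤ ⟪x, b⟫ := by
  rw [← not_lt, inner_coroot_neg hb, not_lt]

theorem inner_coroot_eq_zero {x b : Z} (hb : b ≠ 0) : ⟪x, coroot b⟫ = 0 ↔ ⟪x, b⟫ = 0 := by
  have h1 := inner_coroot_pos (x := x) hb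
  have h2 := inner_coroot_neg (x := x) hb
  constructor <;> intro h <;> by_contra h3 <;> rcases lt_or_gt_of_ne h3 with h4 | h4 <;>
    simp_all

theorem sref_mem {R₀ : Set Z} (h : IsIrredRootSystem R₀) {a b : Z} (ha : a ∈ R₀) (hb : b ∈ R₀) :
    sref a b ∈ R₀ := by
  rw [sref_apply]
  exact h.refl_mem a ha b hb

/-- The Weyl group of `R₀`, as a group of linear isometries of `Z`. -/
def weyl (R₀ : Set Z) : Subgroup (Z ≃ₗᵢ[ℝ] Z) := Subgroup.closure {g | ∃ b ∈ R₀, g = sref b}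

theorem sref_mem_weyl {R₀ : Set Z} {b : Z} (hb : b ∈ R₀) : sref b ∈ weyl R₀ :=
  Subgroup.subset_closure ⟨b, hb, rfl⟩

theorem IsIrredRootSystem.weyl_mem {R₀ : Set Z} (h : IsIrredRootSystem R₀) {v : Z ≃ₗᵢ[ℝ] Z}
    (hv : v ∈ weyl R₀) {b : Z} (hb : b ∈ R₀) : v b ∈ R₀ := by
  induction hv using Subgroup.closure_induction_left generalizing b with
  | one => exact hb
  | mul_left x hx y _ ih =>
    obtain ⟨a, ha, rfl⟩ := hx
    exact sref_mem h ha (ih hb)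
  | inv_mul_cancel x hx y _ ih =>
    obtain ⟨a, ha, rfl⟩ := hx
    rw [sref_inv]
    exact sref_mem h ha (ih hb)

theorem IsIrredRootSystem.neg_mem {R₀ : Set Z} (h : IsIrredRootSystem R₀) {b : Z} (hb : b ∈ R₀) :
    -b ∈ R₀ := by
  rw [← sref_self (h.ne_zero b hb)]
  exact sref_mem h hb hb

/-- Strict Cauchy–Schwarz for two non-proportional roots. -/
theorem IsIrredRootSystem.inner_coroot_mul_lt {R₀ : Set Z} (h : IsIrredRootSystem R₀) {a b : Z}
    (ha : a ∈ R₀) (hb : b ∈ R₀) (h1 : a ≠ b) (h2 : a ≠ -b) :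
    ⟪a, coroot b⟫ * ⟪b, coroot a⟫ < 4 := by
  have ha0 : 0 < ‖a‖ := norm_pos_iff.2 (h.ne_zero a ha)
  have hb0 : 0 < ‖b‖ := norm_pos_iff.2 (h.ne_zero b hb)
  have hne : ¬ |⟪b, a⟫ / (‖b‖ * ‖a‖)| = 1 := by
    rw [abs_real_inner_div_norm_mul_norm_eq_one_iff]
    rintro ⟨_, r, _, hr⟩
    rcases h.reduced b hb r (hr ▸ ha) with rfl | rfl
    · exact h1 (by simpa using hr)
    · exact h2 (by simpa using hr)
  have hlt : |⟪b, a⟫| < ‖b‖ * ‖a‖ := by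
    refine lt_of_le_of_ne (abs_real_inner_le_norm b a) fun he => hne ?_
    rw [abs_div, he, abs_of_pos (by positivity)]
    exact div_self (by positivity)
  have hsq : ⟪b, a⟫ ^ 2 < (‖b‖ * ‖a‖) ^ 2 := by
    rw [← sq_abs]
    exact pow_lt_pow_left₀ hlt (abs_nonneg _) two_ne_zero
  rw [coroot, coroot, inner_smul_right, inner_smul_right, real_inner_comm b a]
  have : 2 / ‖b‖ ^ 2 * ⟪b, a⟫ * (2 / ‖a‖ ^ 2 * ⟪b, a⟫)
      = 4 * (⟪b, a⟫ ^ 2 / (‖b‖ * ‖a‖) ^ 2) := by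
    field_simp
    ring
  rw [this]
  have : ⟪b, a⟫ ^ 2 / (‖b‖ * ‖a‖) ^ 2 < 1 := (div_lt_one (by positivity)).2 hsq
  linarith

/-- The pairing of a root with the coroot of a longer non-proportional root is `-1`, `0` or `1`. -/
theorem IsIrredRootSystem.inner_coroot_short {R₀ : Set Z} (h : IsIrredRootSystem R₀) {a b : Z}
    (ha : a ∈ R₀) (hb : b ∈ R₀) (h1 : a ≠ b) (h2 : a ≠ -b) (hn : ‖a‖ ≤ ‖b‖) :
    ⟪a, coroot b⟫ = 0 ∨ ⟪a, coroot b⟫ = 1 ∨ ⟪a, coroot b⟫ = -1 := by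
  have ha0 : 0 < ‖a‖ := norm_pos_iff.2 (h.ne_zero a ha)
  have hb0 : 0 < ‖b‖ := norm_pos_iff.2 (h.ne_zero b hb)
  obtain ⟨k, hk⟩ := h.integral b hb a ha
  have hlt := h.inner_coroot_mul_lt ha hb h1 h2
  -- `|(a, b^∨)| ≤ |(b, a^∨)|` because `a` is not longer than `b`
  have hle : ⟪a, coroot b⟫ ^ 2 ≤ ⟪a, coroot b⟫ * ⟪b, coroot a⟫ := by
    rw [coroot, coroot, inner_smul_right, inner_smul_right, real_inner_comm b a]
    have : 2 / ‖b‖ ^ 2 ≤ 2 / ‖a‖ ^ 2 := by gcongr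
    have h0 : 0 ≤ 2 / ‖b‖ ^ 2 * ⟪b, a⟫ ^ 2 := by positivity
    nlinarith [mul_le_mul_of_nonneg_left this h0]
  rw [hk] at hle hlt ⊢
  have : (k : ℝ) ^ 2 < 4 := hle.trans_lt hlt
  have h4 : k ^ 2 < 4 := by exact_mod_cast this
  have h5 : -2 < k := by nlinarith
  have h6 : k < 2 := by nlinarith
  have : k = 0 ∨ k = 1 ∨ k = -1 := by omega
  rcases this with rfl | rfl | rfl <;> simp

/-- If two distinct roots have positive inner product, then their difference is a root. -/
theorem IsIrredRootSystem.sub_mem {R₀ : Set Z} (h : IsIrredRootSystem R₀) {a b : Z}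
    (ha : a ∈ R₀) (hb : b ∈ R₀) (h1 : a ≠ b) (hpos : 0 < ⟪a, b⟫) : a - b ∈ R₀ := by
  have h2 : a ≠ -b := by
    rintro rfl
    rw [inner_neg_left, real_inner_self_eq_norm_sq] at hpos
    nlinarith [sq_nonneg ‖b‖]
  rcases le_total ‖a‖ ‖b‖ with hn | hn
  · have hp := (inner_coroot_pos (h.ne_zero b hb)).2 hpos
    have : ⟪a, coroot b⟫ = 1 := by
      rcases h.inner_coroot_short ha hb h1 h2 hn with h | h | h <;> linarith
    have := h.refl_mem b hb a ha
    simpa [*] using this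
  · have hp := (inner_coroot_pos (x := b) (h.ne_zero a ha)).2 (by rwa [real_inner_comm])
    have : ⟪b, coroot a⟫ = 1 := by
      rcases h.inner_coroot_short hb ha h1.symm (fun e => h2 (by rw [e, neg_neg])) hn with
        h | h | h <;> linarith
    have := h.neg_mem (h.refl_mem a ha b hb)
    simpa [*] using this

end Reflections

/-! ### Positive roots -/

/-- A root system with a basis, and a vector `p` pairing to `1` with all simple roots: a root is
positive or negative according to the sign of its inner product with `p`. -/
structure BasedRootSystem {Z : Type*} [NormedAddCommGroup Z] [InnerProductSpace ℝ Z] (R₀ : Set Z)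
    {n : ℕ} (α : Fin n → Z) (p : Z) : Prop where
  irr : IsIrredRootSystem R₀
  basis : IsRootBasis R₀ α
  ht : ∀ i, ⟪p, α i⟫ = 1

namespace BasedRootSystem

variable {Z : Type*} [NormedAddCommGroup Z] [InnerProductSpace ℝ Z] {R₀ : Set Z} {n : ℕ}
  {α : Fin n → Z} {p : Z} (H : BasedRootSystem R₀ α p)

include H

theorem simple_ne_zero (i : Fin n) : α i ≠ 0 := H.irr.ne_zero _ (H.basis.mem i)

theorem ht_sum (c : Fin n → ℝ) : ⟪p, ∑ i, c i • α i⟫ = ∑ i, c i := by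
  simp [inner_sum, inner_smul_right, H.ht]

theorem coef_inj {c d : Fin n → ℝ} (h : ∑ i, c i • α i = ∑ i, d i • α i) : c = d := by
  have h0 : ∑ i, (c i - d i) • α i = 0 := by
    simp only [sub_smul, Finset.sum_sub_distrib, h, sub_self]
  funext i
  exact sub_eq_zero.1 (Fintype.linearIndependent_iff.1 H.basis.linearIndependent _ h0 i)

theorem exists_coef {b : Z} (hb : b ∈ R₀) (hp : 0 < ⟪p, b⟫) :
    ∃ c : Fin n → ℝ, b = ∑ i, c i • α i ∧ ∀ i, 0 ≤ c i := by
  obtain ⟨c, hc, h | h⟩ := H.basis.sign b hb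
  · exact ⟨c, hc, h⟩
  · rw [hc, H.ht_sum] at hp
    exact absurd (Finset.sum_nonpos fun i _ => h i) (not_le.2 hp)

theorem ht_ne_zero {b : Z} (hb : b ∈ R₀) : ⟪p, b⟫ ≠ 0 := by
  obtain ⟨c, hc, h⟩ := H.basis.sign b hb
  intro h0
  rw [hc, H.ht_sum] at h0
  have : ∀ i, c i = 0 := by
    intro i
    rcases h with h | h
    · exact (Finset.sum_eq_zero_iff_of_nonneg fun i _ => h i).1 h0 i (Finset.mem_univ i)
    · exact (Finset.sum_eq_zero_iff_of_nonpos fun i _ => h i).1 h0 i (Finset.mem_univ i)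
  exact H.irr.ne_zero b hb (by simp [hc, this])

/-- A simple reflection permutes the positive roots other than its own simple root. -/
theorem sref_pos {b : Z} (hb : b ∈ R₀) (hp : 0 < ⟪p, b⟫) {i : Fin n} (hi : b ≠ α i) :
    0 < ⟪p, sref (α i) b⟫ := by
  obtain ⟨c, hc, h⟩ := H.exists_coef hb hp
  obtain ⟨j, hji, hj⟩ : ∃ j, j ≠ i ∧ 0 < c j := by
    by_contra hcon
    push Not at hcon
    have h0 : ∀ j, j ≠ i → c j = 0 := fun j hj => le_antisymm (hcon j hj) (h j)
    have hbi : b = c i • α i := by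
      rw [hc]
      exact Finset.sum_eq_single i (fun j _ hj => by rw [h0 j hj, zero_smul]) (by simp)
    rcases H.irr.reduced _ (H.basis.mem i) (c i) (hbi ▸ hb) with h1 | h1
    · exact hi (by rw [hbi, h1, one_smul])
    · linarith [h i]
  have hmem := sref_mem H.irr (H.basis.mem i) hb
  obtain ⟨d, hd, hs⟩ := H.basis.sign _ hmem
  set k := ⟪b, coroot (α i)⟫ with hk
  have hcd : d = fun j => c j - if j = i then k else 0 := by
    apply H.coef_inj
    rw [← hd, sref_apply, ← hk]
    simp only [sub_smul, Finset.sum_sub_distrib, ← hc, ite_smul, zero_smul,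
      Finset.sum_ite_eq', Finset.mem_univ, if_true]
  have hdj : d j = c j := by simp [hcd, hji]
  have hd0 : ∀ i, 0 ≤ d i := by
    rcases hs with hs | hs
    · exact hs
    · exact absurd (hs j) (by rw [hdj]; exact not_le.2 hj)
  rw [hd, H.ht_sum]
  exact Finset.sum_pos' (fun i _ => hd0 i) ⟨j, Finset.mem_univ j, by rwa [hdj]⟩

/-- Distinct simple roots form an obtuse angle: otherwise `s_j αᵢ` would have coefficients of both
signs. -/
theorem inner_simple_nonpos {i j : Fin n} (hij : i ≠ j) : ⟪α i, α j⟫ ≤ 0 := by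
  by_contra hcon
  push Not at hcon
  have h1 := (inner_coroot_pos (H.simple_ne_zero j)).2 hcon
  obtain ⟨d, hd, hs⟩ := H.basis.sign _ (sref_mem H.irr (H.basis.mem j) (H.basis.mem i))
  have hcd : d = fun l => (if l = i then 1 else 0) - if l = j then ⟪α i, coroot (α j)⟫ else 0 := by
    apply H.coef_inj
    rw [← hd, sref_apply]
    simp [sub_smul, Finset.sum_sub_distrib]
  have hi : d i = 1 := by simp [hcd, hij]
  have hj : d j = -⟪α i, coroot (α j)⟫ := by simp [hcd, hij.symm]
  rcases hs with hs | hs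
  · have := hs j; linarith
  · have := hs i; linarith

/-- A positive root `b` has positive inner product with some simple root, since `(b, b) > 0`. -/
theorem exists_inner_simple_pos {b : Z} (hb : b ∈ R₀) (hp : 0 < ⟪p, b⟫) :
    ∃ i, 0 < ⟪b, α i⟫ := by
  obtain ⟨c, hc, h⟩ := H.exists_coef hb hp
  by_contra hcon
  push Not at hcon
  have h1 : ⟪b, b⟫ ≤ 0 := by
    conv_lhs => arg 3; rw [hc]
    rw [inner_sum]
    refine Finset.sum_nonpos fun i _ => ?_
    rw [inner_smul_right]
    exact mul_nonpos_of_nonneg_of_nonpos (h i) (hcon i)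
  exact H.irr.ne_zero b hb (real_inner_self_nonpos.1 h1)

/-- Induction on positive roots: every positive root is reached from a simple root by simple
reflections that raise the height. -/
theorem pos_induction {P : Z → Prop} (simple : ∀ i, P (α i))
    (step : ∀ b ∈ R₀, 0 < ⟪p, b⟫ → ∀ i, ⟪b, α i⟫ < 0 → P b → P (sref (α i) b))
    {b : Z} (hb : b ∈ R₀) (hp : 0 < ⟪p, b⟫) : P b := by
  by_contra hP
  obtain ⟨b, ⟨hb, hp, hP⟩, hmin⟩ := Set.exists_min_image {b | b ∈ R₀ ∧ 0 < ⟪p, b⟫ ∧ ¬ P b}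
    (fun b => ⟪p, b⟫) (H.irr.finite.subset fun b hb => hb.1) ⟨b, hb, hp, hP⟩
  obtain ⟨i, hi⟩ := H.exists_inner_simple_pos hb hp
  have hne : b ≠ α i := fun h => hP (h ▸ simple i)
  have hpos := H.sref_pos hb hp hne
  have hmem := sref_mem H.irr (H.basis.mem i) hb
  have hneg : ⟪sref (α i) b, α i⟫ < 0 := by
    have h1 := (sref (α i)).inner_map_map b (α i)
    rw [sref_self (H.simple_ne_zero i), inner_neg_right] at h1
    linarith
  have hlt : ⟪p, sref (α i) b⟫ < ⟪p, b⟫ := by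
    rw [sref_apply, inner_sub_right, inner_smul_right, H.ht]
    have := (inner_coroot_pos (H.simple_ne_zero i)).2 hi
    linarith
  have hPs : P (sref (α i) b) := by
    by_contra hcon
    exact absurd (hmin _ ⟨hmem, hpos, hcon⟩) (not_le.2 hlt)
  exact hP (sref_sref (α i) b ▸ step _ hmem hpos i hneg hPs)

/-- The coefficients of a positive root in the basis of simple roots are natural numbers. -/
theorem exists_nat_coef {b : Z} (hb : b ∈ R₀) (hp : 0 < ⟪p, b⟫) :
    ∃ c : Fin n → ℕ, b = ∑ i, c i • α i := by
  refine H.pos_induction (P := fun b => ∃ c : Fin n → ℕ, b = ∑ i, c i • α i) ?_ ?_ hb hp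
  · intro i
    exact ⟨fun j => if j = i then 1 else 0, by simp⟩
  · rintro b hb _ i hi ⟨c, hc⟩
    obtain ⟨k, hk⟩ := H.irr.integral _ (H.basis.mem i) b hb
    have h0 := (inner_coroot_neg (H.simple_ne_zero i)).2 hi
    rw [hk] at h0
    have h0' : k < 0 := by exact_mod_cast h0
    obtain ⟨m, hm⟩ := Int.eq_ofNat_of_zero_le (neg_nonneg.2 h0'.le)
    refine ⟨fun j => c j + if j = i then m else 0, ?_⟩
    have hkm : (k : ℝ) = -(m : ℝ) := by
      have : ((-k : ℤ) : ℝ) = m := by rw [hm]; simp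
      push_cast at this
      linarith
    rw [sref_apply, hk, hkm]
    simp only [add_smul, Finset.sum_add_distrib, ← hc, ite_smul, zero_smul, Finset.sum_ite_eq',
      Finset.mem_univ, if_true, neg_smul, sub_neg_eq_add, Nat.cast_smul_eq_nsmul]

theorem ht_natsum_nonneg (c : Fin n → ℕ) : 0 ≤ ⟪p, ∑ i, c i • α i⟫ := by
  have := H.ht_sum fun i => (c i : ℝ)
  simp only [Nat.cast_smul_eq_nsmul] at this
  rw [this]
  positivity

theorem ht_neg {b : Z} (hb : b ∈ R₀) (h : ¬ 0 < ⟪p, b⟫) : ⟪p, b⟫ < 0 :=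
  lt_of_le_of_ne (not_lt.1 h) (H.ht_ne_zero hb)

theorem weyl_ht_ne_zero {v : Z ≃ₗᵢ[ℝ] Z} (hv : v ∈ weyl R₀) {b : Z} (hb : b ∈ R₀) :
    ⟪p, v b⟫ ≠ 0 :=
  H.ht_ne_zero (H.irr.weyl_mem hv hb)

theorem sref_mem_closure_simple {b : Z} (hb : b ∈ R₀) :
    sref b ∈ Subgroup.closure (Set.range fun i => sref (α i)) := by
  have key : ∀ b ∈ R₀, 0 < ⟪p, b⟫ →
      sref b ∈ Subgroup.closure (Set.range fun i => sref (α i)) := by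
    intro b hb hp
    refine H.pos_induction (P := fun b => sref b ∈ Subgroup.closure
      (Set.range fun i => sref (α i))) ?_ ?_ hb hp
    · exact fun i => Subgroup.subset_closure ⟨i, rfl⟩
    · intro b _ _ i _ ih
      have hi : sref (α i) ∈ Subgroup.closure (Set.range fun i => sref (α i)) :=
        Subgroup.subset_closure ⟨i, rfl⟩
      rw [sref_map]
      exact mul_mem (mul_mem hi ih) (inv_mem hi)
  by_cases hp : 0 < ⟪p, b⟫
  · exact key b hb hp
  · have := key (-b) (H.irr.neg_mem hb) (by have := H.ht_neg hb hp; simpa [inner_neg_right] using this)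
    rwa [sref_neg] at this

theorem weyl_eq_closure : weyl R₀ = Subgroup.closure (Set.range fun i => sref (α i)) := by
  apply le_antisymm
  · rw [weyl, Subgroup.closure_le]
    rintro _ ⟨b, hb, rfl⟩
    exact H.sref_mem_closure_simple hb
  · rw [Subgroup.closure_le]
    rintro _ ⟨i, rfl⟩
    exact sref_mem_weyl (H.basis.mem i)

theorem simple_mem_weyl (i : Fin n) : sref (α i) ∈ weyl R₀ := sref_mem_weyl (H.basis.mem i)

/-- Every element of the Weyl group is a product of simple reflections. -/
theorem exists_word {v : Z ≃ₗᵢ[ℝ] Z} (hv : v ∈ weyl R₀) :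
    ∃ L : List (Fin n), v = (L.map fun i => sref (α i)).prod := by
  rw [H.weyl_eq_closure] at hv
  induction hv using Subgroup.closure_induction_left with
  | one => exact ⟨[], rfl⟩
  | mul_left x hx y _ ih =>
    obtain ⟨i, rfl⟩ := hx
    obtain ⟨L, rfl⟩ := ih
    exact ⟨i :: L, by simp⟩
  | inv_mul_cancel x hx y _ ih =>
    obtain ⟨i, rfl⟩ := hx
    obtain ⟨L, rfl⟩ := ih
    exact ⟨i :: L, by simp [sref_inv]⟩

theorem word_mem (L : List (Fin n)) : (L.map fun i => sref (α i)).prod ∈ weyl R₀ := by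
  refine list_prod_mem fun x hx => ?_
  obtain ⟨i, _, rfl⟩ := List.mem_map.1 hx
  exact H.simple_mem_weyl i

/-- The exchange property: if `v = s_{i₁} ⋯ s_{iₖ}` makes `αⱼ` negative, then `v sⱼ` is the product
of a word of length `k - 1`. -/
theorem exchange (L : List (Fin n)) (j : Fin n)
    (h : ⟪p, (L.map fun i => sref (α i)).prod (α j)⟫ < 0) :
    ∃ L' : List (Fin n), L'.length + 1 = L.length ∧
      (L.map fun i => sref (α i)).prod * sref (α j) = (L'.map fun i => sref (α i)).prod := by
  induction L with
  | nil =>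
    have := H.ht j
    simp only [List.map_nil, List.prod_nil, LinearIsometryEquiv.coe_one, id_eq] at h
    linarith
  | cons i L ih =>
    set u := (L.map fun i => sref (α i)).prod with hu
    have hmem : u (α j) ∈ R₀ := H.irr.weyl_mem (H.word_mem L) (H.basis.mem j)
    by_cases hp : 0 < ⟪p, u (α j)⟫
    · have he : u (α j) = α i := by
        by_contra hne
        have := H.sref_pos hmem hp hne
        simp only [List.map_cons, List.prod_cons, isom_mul_apply] at h
        exact absurd this (not_lt.2 h.le)
      refine ⟨L, by simp, ?_⟩
      have h1 := sref_map u (α j)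
      rw [he] at h1
      rw [List.map_cons, List.prod_cons, ← hu, h1]
      have := sref_mul_self (α j)
      rw [mul_assoc, mul_assoc, mul_assoc, inv_mul_cancel_left, this, mul_one]
    · obtain ⟨L', hL', he⟩ := ih (H.ht_neg hmem hp)
      refine ⟨i :: L', by simp [← hL'], ?_⟩
      rw [List.map_cons, List.prod_cons, List.map_cons, List.prod_cons, mul_assoc, ← he]

/-- An element of the Weyl group making no simple root negative is trivial. -/
theorem eq_one_of_simple_pos {v : Z ≃ₗᵢ[ℝ] Z} (hv : v ∈ weyl R₀)
    (h : ∀ i, 0 < ⟪p, v (α i)⟫) : v = 1 := by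
  classical
  have hex : ∃ k, ∃ L : List (Fin n), L.length = k ∧ v = (L.map fun i => sref (α i)).prod := by
    obtain ⟨L, hL⟩ := H.exists_word hv
    exact ⟨_, L, rfl, hL⟩
  obtain ⟨L, hL, hvL⟩ := Nat.find_spec hex
  have hmin : ∀ L' : List (Fin n), v = (L'.map fun i => sref (α i)).prod →
      Nat.find hex ≤ L'.length := fun L' h' => Nat.find_min' hex ⟨L', rfl, h'⟩
  rcases List.eq_nil_or_concat L with rfl | ⟨L₁, j, rfl⟩
  · simpa using hvL
  · rw [List.concat_eq_append, List.map_append, List.prod_append] at hvL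
    simp only [List.map_cons, List.map_nil, List.prod_cons, List.prod_nil, mul_one] at hvL
    have hneg : ⟪p, (L₁.map fun i => sref (α i)).prod (α j)⟫ < 0 := by
      have := h j
      rw [hvL, isom_mul_apply, sref_self (H.simple_ne_zero j), map_neg,
        inner_neg_right] at this
      linarith
    obtain ⟨L', hL', he⟩ := H.exchange L₁ j hneg
    have := hmin L' (by rw [hvL, he])
    simp at hL
    omega

theorem exists_simple_neg {v : Z ≃ₗᵢ[ℝ] Z} (hv : v ∈ weyl R₀) (h1 : v ≠ 1) :
    ∃ i, ⟪p, v (α i)⟫ < 0 := by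
  by_contra hcon
  push Not at hcon
  exact h1 (H.eq_one_of_simple_pos hv fun i =>
    lt_of_le_of_ne (hcon i) (H.weyl_ht_ne_zero hv (H.basis.mem i)).symm)

/-- The Weyl group is finite, since it acts faithfully on the roots. -/
theorem finite_weyl : Finite (weyl R₀) := by
  have : Finite R₀ := H.irr.finite.to_subtype
  refine Finite.of_injective (fun v : weyl R₀ => fun b : R₀ =>
    (⟨(v : Z ≃ₗᵢ[ℝ] Z) b, H.irr.weyl_mem v.2 b.2⟩ : R₀)) fun v w hvw => ?_
  have h1 : (w : Z ≃ₗᵢ[ℝ] Z)⁻¹ * v = 1 := by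
    refine H.eq_one_of_simple_pos (mul_mem (inv_mem w.2) v.2) fun i => ?_
    have h2 : (v : Z ≃ₗᵢ[ℝ] Z) (α i) = (w : Z ≃ₗᵢ[ℝ] Z) (α i) :=
      congrArg Subtype.val (congrFun hvw ⟨_, H.basis.mem i⟩)
    rw [isom_mul_apply, h2, ← isom_mul_apply, inv_mul_cancel]
    simp [H.ht]
  exact Subtype.ext (inv_mul_eq_one.1 h1).symm

/-- Every vector is moved into the dominant chamber by the Weyl group. -/
theorem exists_weyl_dominant (q : Z) : ∃ u ∈ weyl R₀, ∀ i, 0 ≤ ⟪u q, α i⟫ := by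
  have := H.finite_weyl
  obtain ⟨u, hu⟩ := Finite.exists_max fun u : weyl R₀ => ⟪p, (u : Z ≃ₗᵢ[ℝ] Z) q⟫
  refine ⟨u, u.2, fun i => ?_⟩
  by_contra hcon
  push Not at hcon
  have h1 := hu ⟨sref (α i) * u, mul_mem (H.simple_mem_weyl i) u.2⟩
  rw [isom_mul_apply, sref_apply, inner_sub_right, inner_smul_right, H.ht] at h1
  have := (inner_coroot_neg (H.simple_ne_zero i)).2 hcon
  linarith

/-- If `v αᵢ` is negative, then `v sᵢ` makes fewer positive roots negative than `v` does. -/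
theorem ncard_inv_lt {v : Z ≃ₗᵢ[ℝ] Z} {i : Fin n} (hi : ⟪p, v (α i)⟫ < 0) :
    {b | b ∈ R₀ ∧ 0 < ⟪p, b⟫ ∧ ⟪p, (v * sref (α i)) b⟫ < 0}.ncard <
      {b | b ∈ R₀ ∧ 0 < ⟪p, b⟫ ∧ ⟪p, v b⟫ < 0}.ncard := by
  rw [← Set.ncard_image_of_injective _ (sref (α i)).injective]
  refine Set.ncard_lt_ncard ⟨?_, fun hsub => ?_⟩ (H.irr.finite.subset fun b hb => hb.1)
  · rintro _ ⟨b, ⟨hb, hp, hn⟩, rfl⟩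
    refine ⟨sref_mem H.irr (H.basis.mem i) hb, H.sref_pos hb hp ?_, hn⟩
    rintro rfl
    rw [isom_mul_apply, sref_self (H.simple_ne_zero i), map_neg,
      inner_neg_right] at hn
    linarith
  · obtain ⟨b, ⟨hb, hp, _⟩, he⟩ := hsub ⟨H.basis.mem i, by rw [H.ht]; norm_num, hi⟩
    rw [← sref_sref (α i) b, he, sref_self (H.simple_ne_zero i), inner_neg_right, H.ht] at hp
    linarith

/-- Induction on the length in the Weyl group. -/
theorem weyl_induction {P : (Z ≃ₗᵢ[ℝ] Z) → Prop} (one : P 1)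
    (step : ∀ v ∈ weyl R₀, ∀ i, ⟪p, v (α i)⟫ < 0 → P (v * sref (α i)) → P v)
    {v : Z ≃ₗᵢ[ℝ] Z} (hv : v ∈ weyl R₀) : P v := by
  induction hk : {b | b ∈ R₀ ∧ 0 < ⟪p, b⟫ ∧ ⟪p, v b⟫ < 0}.ncard using Nat.strong_induction_on
    generalizing v with
  | _ k ih =>
    by_cases h1 : v = 1
    · exact h1 ▸ one
    · obtain ⟨i, hi⟩ := H.exists_simple_neg hv h1
      exact step v hv i hi (ih _ (hk ▸ H.ncard_inv_lt hi) (mul_mem hv (H.simple_mem_weyl i)) rfl)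

end BasedRootSystem

/-! ### Dominant roots -/

section

variable {Z : Type*} [NormedAddCommGroup Z] [InnerProductSpace ℝ Z] {R₀ : Set Z} {n : ℕ}
  {α : Fin n → Z} {p : Z}

/-- `b` lies in the closed dominant chamber. -/
def IsDom (α : Fin n → Z) (b : Z) : Prop := ∀ i, 0 ≤ ⟪b, α i⟫

/-- The dominance order: `a - b` is a sum of simple roots. -/
def RootLE (α : Fin n → Z) (b a : Z) : Prop := ∃ c : Fin n → ℕ, a - b = ∑ i, c i • α i

theorem RootLE.refl (α : Fin n → Z) (b : Z) : RootLE α b b := ⟨0, by simp⟩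

theorem RootLE.trans {a b c : Z} (h1 : RootLE α a b) (h2 : RootLE α b c) : RootLE α a c := by
  obtain ⟨x, hx⟩ := h1
  obtain ⟨y, hy⟩ := h2
  refine ⟨x + y, ?_⟩
  simp only [Pi.add_apply, add_smul, Finset.sum_add_distrib, ← hx, ← hy]
  abel

namespace BasedRootSystem

theorem rootLE_antisymm (H : BasedRootSystem R₀ α p) {a b : Z} (h1 : RootLE α a b)
    (h2 : RootLE α b a) : a = b := by
  obtain ⟨x, hx⟩ := h1
  obtain ⟨y, hy⟩ := h2
  have h0 : ∑ i, ((x i : ℝ) + y i) • α i = ∑ i : Fin n, (0 : ℝ) • α i := by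
    simp only [add_smul, Finset.sum_add_distrib, Nat.cast_smul_eq_nsmul, ← hx, ← hy]
    simp
  have h3 := H.coef_inj h0
  have h4 : ∀ i, x i = 0 := by
    intro i
    have h5 : (x i : ℝ) + y i = 0 := congrFun h3 i
    have h6 : x i + y i = 0 := by exact_mod_cast h5
    omega
  simp only [h4, zero_smul, Finset.sum_const_zero] at hx
  exact (sub_eq_zero.1 hx).symm

theorem dom_inner_nonneg (H : BasedRootSystem R₀ α p) {b c : Z} (hb : IsDom α b) (hc : c ∈ R₀)
    (hp : 0 < ⟪p, c⟫) : 0 ≤ ⟪b, c⟫ := by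
  obtain ⟨d, rfl, hd⟩ := H.exists_coef hc hp
  rw [inner_sum]
  refine Finset.sum_nonneg fun i _ => ?_
  rw [inner_smul_right]
  exact mul_nonneg (hd i) (hb i)

theorem pos_of_dom_inner_pos (H : BasedRootSystem R₀ α p) {b c : Z} (hb : IsDom α b) (hc : c ∈ R₀)
    (h : 0 < ⟪b, c⟫) : 0 < ⟪p, c⟫ := by
  by_contra hp
  have h1 := H.ht_neg hc hp
  have := H.dom_inner_nonneg hb (H.irr.neg_mem hc) (by rw [inner_neg_right]; linarith)
  rw [inner_neg_right] at this
  linarith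

theorem neg_of_dom_inner_neg (H : BasedRootSystem R₀ α p) {b c : Z} (hb : IsDom α b) (hc : c ∈ R₀)
    (h : ⟪b, c⟫ < 0) : ⟪p, c⟫ < 0 := by
  have := H.pos_of_dom_inner_pos hb (H.irr.neg_mem hc) (by rw [inner_neg_right]; linarith)
  rw [inner_neg_right] at this
  linarith

theorem dom_pos (H : BasedRootSystem R₀ α p) {b : Z} (hb : IsDom α b) (hm : b ∈ R₀) :
    0 < ⟪p, b⟫ :=
  H.pos_of_dom_inner_pos hb hm (real_inner_self_pos.2 (H.irr.ne_zero b hm))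

/-- Every root lies below a dominant root of its Weyl group orbit. -/
theorem exists_dom_above (H : BasedRootSystem R₀ α p) {b : Z} (hb : b ∈ R₀) :
    ∃ v ∈ weyl R₀, IsDom α (v b) ∧ RootLE α b (v b) := by
  have := H.finite_weyl
  obtain ⟨u, hu, hmax⟩ := Set.exists_max_image {u : weyl R₀ | RootLE α b ((u : Z ≃ₗᵢ[ℝ] Z) b)}
    (fun u => ⟪p, (u : Z ≃ₗᵢ[ℝ] Z) b⟫) (Set.toFinite _) ⟨1, RootLE.refl α b⟩
  refine ⟨u, u.2, fun i => ?_, hu⟩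
  by_contra hcon
  push Not at hcon
  have h0 := (inner_coroot_neg (H.simple_ne_zero i)).2 hcon
  obtain ⟨k, hk⟩ := H.irr.integral _ (H.basis.mem i) _ (H.irr.weyl_mem u.2 hb)
  have hk0 : k < 0 := by rw [hk] at h0; exact_mod_cast h0
  obtain ⟨m, hm⟩ := Int.eq_ofNat_of_zero_le (neg_nonneg.2 hk0.le)
  have hkm : (k : ℝ) = -(m : ℝ) := by
    have : ((-k : ℤ) : ℝ) = m := by rw [hm]; simp
    push_cast at this
    linarith
  have hs : sref (α i) ((u : Z ≃ₗᵢ[ℝ] Z) b) = (u : Z ≃ₗᵢ[ℝ] Z) b + m • α i := by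
    rw [sref_apply, hk, hkm, neg_smul, sub_neg_eq_add, Nat.cast_smul_eq_nsmul]
  have hle : RootLE α b (sref (α i) ((u : Z ≃ₗᵢ[ℝ] Z) b)) := by
    refine RootLE.trans hu ⟨fun j => if j = i then m else 0, ?_⟩
    rw [hs]
    simp
  have h1 := hmax ⟨sref (α i) * u, mul_mem (H.simple_mem_weyl i) u.2⟩ hle
  rw [isom_mul_apply, sref_apply, inner_sub_right, inner_smul_right, H.ht] at h1
  linarith

/-- A dominant root is a combination of the simple roots with positive coefficients only; this is
where irreducibility enters. -/
theorem dom_coef_pos (H : BasedRootSystem R₀ α p) {b : Z} (hb : IsDom α b) (hm : b ∈ R₀) :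
    ∃ c : Fin n → ℝ, b = ∑ i, c i • α i ∧ ∀ i, 0 < c i := by
  obtain ⟨c, hc, hc0⟩ := H.exists_coef hm (H.dom_pos hb hm)
  refine ⟨c, hc, fun j₀ => lt_of_le_of_ne (hc0 j₀) fun hj₀ => ?_⟩
  -- simple roots outside the support of `b` are orthogonal to those in the support
  have hort : ∀ i j, c i ≠ 0 → c j = 0 → ⟪α i, α j⟫ = 0 := by
    intro i j hi hj
    have hle : ∀ l ∈ Finset.univ, c l * ⟪α l, α j⟫ ≤ 0 := by
      intro l _
      rcases eq_or_ne l j with rfl | hl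
      · rw [hj, zero_mul]
      · exact mul_nonpos_of_nonneg_of_nonpos (hc0 l) (H.inner_simple_nonpos hl)
    have hsum : 0 ≤ ∑ l, c l * ⟪α l, α j⟫ := by
      have := hb j
      rw [hc, sum_inner] at this
      simpa [inner_smul_left] using this
    have h0 := (Finset.sum_eq_zero_iff_of_nonpos hle).1
      (le_antisymm (Finset.sum_nonpos hle) hsum) i (Finset.mem_univ i)
    exact (mul_eq_zero.1 h0).resolve_left hi
  let A : Set Z := {a | a ∈ R₀ ∧ ∃ d : Fin n → ℝ, a = ∑ i, d i • α i ∧ ∀ i, c i ≠ 0 → d i = 0}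
  let B : Set Z := {a | a ∈ R₀ ∧ ∃ d : Fin n → ℝ, a = ∑ i, d i • α i ∧ ∀ i, c i = 0 → d i = 0}
  have hAs : ∀ i, c i ≠ 0 → ∀ a ∈ A, ⟪a, α i⟫ = 0 := by
    rintro i hi a ⟨_, d, rfl, hd⟩
    rw [sum_inner]
    refine Finset.sum_eq_zero fun l _ => ?_
    by_cases hl : c l = 0
    · rw [inner_smul_left, real_inner_comm, hort i l hi hl, mul_zero]
    · rw [hd l hl, zero_smul, inner_zero_left]
  have hBs : ∀ i, c i = 0 → ∀ a ∈ B, ⟪a, α i⟫ = 0 := by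
    rintro i hi a ⟨_, d, rfl, hd⟩
    rw [sum_inner]
    refine Finset.sum_eq_zero fun l _ => ?_
    by_cases hl : c l = 0
    · rw [hd l hl, zero_smul, inner_zero_left]
    · rw [inner_smul_left, hort l i hl hi, mul_zero]
  have hpos : ∀ a ∈ R₀, 0 < ⟪p, a⟫ → a ∈ A ∪ B := by
    intro a ha hpa
    refine H.pos_induction (P := fun a => a ∈ A ∪ B) (fun i => ?_) ?_ ha hpa
    · by_cases hi : c i = 0
      · refine Or.inl ⟨H.basis.mem i, fun j => if j = i then 1 else 0, by simp, fun j hj => ?_⟩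
        exact if_neg (by rintro rfl; exact hj hi)
      · refine Or.inr ⟨H.basis.mem i, fun j => if j = i then 1 else 0, by simp, fun j hj => ?_⟩
        exact if_neg (by rintro rfl; exact hi hj)
    · have hsum : ∀ (d : Fin n → ℝ) (i : Fin n) (k : ℝ), (∑ l, d l • α l) - k • α i =
          ∑ l, (d l - if l = i then k else 0) • α l := by
        intro d i k
        simp [sub_smul, Finset.sum_sub_distrib]
      rintro a ha _ i hi (hA | hB)
      · have hci : c i = 0 := by
          by_contra hci
          have := hAs i hci a hA
          linarith
        obtain ⟨_, d, hd, hd0⟩ := hA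
        refine Or.inl ⟨sref_mem H.irr (H.basis.mem i) ha, _,
          by rw [sref_apply]; conv_lhs => { arg 1; rw [hd] }
             exact hsum d i _, fun l hl => ?_⟩
        rw [hd0 l hl, if_neg (by rintro rfl; exact hl hci), sub_zero]
      · have hci : c i ≠ 0 := by
          intro hci
          have := hBs i hci a hB
          linarith
        obtain ⟨_, d, hd, hd0⟩ := hB
        refine Or.inr ⟨sref_mem H.irr (H.basis.mem i) ha, _,
          by rw [sref_apply]; conv_lhs => { arg 1; rw [hd] }
             exact hsum d i _, fun l hl => ?_⟩
        rw [hd0 l hl, if_neg (by rintro rfl; exact hci hl), sub_zero]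
  have hneg : ∀ a, a ∈ A ∪ B → -a ∈ A ∪ B := by
    rintro a (⟨ha, d, hd, hd0⟩ | ⟨ha, d, hd, hd0⟩)
    · exact Or.inl ⟨H.irr.neg_mem ha, -d, by simp [hd], fun i hi => by simp [hd0 i hi]⟩
    · exact Or.inr ⟨H.irr.neg_mem ha, -d, by simp [hd], fun i hi => by simp [hd0 i hi]⟩
  have hAB : A ∪ B = R₀ := by
    apply Set.Subset.antisymm
    · rintro a (ha | ha) <;> exact ha.1
    · intro a ha
      by_cases hpa : 0 < ⟪p, a⟫
      · exact hpos a ha hpa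
      · rw [← neg_neg a]
        refine hneg _ (hpos _ (H.irr.neg_mem ha) ?_)
        rw [inner_neg_right]
        linarith [H.ht_neg ha hpa]
  have hABort : ∀ a ∈ A, ∀ b ∈ B, ⟪a, b⟫ = 0 := by
    rintro a ha b ⟨_, d, rfl, hd⟩
    rw [inner_sum]
    refine Finset.sum_eq_zero fun l _ => ?_
    by_cases hl : c l = 0
    · rw [hd l hl, zero_smul, inner_zero_right]
    · rw [inner_smul_right, hAs l hl a ha, mul_zero]
  rcases H.irr.irreducible A B hAB hABort with h | h
  · have : α j₀ ∈ A := by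
      refine ⟨H.basis.mem j₀, fun j => if j = j₀ then 1 else 0, by simp, fun j hj => ?_⟩
      exact if_neg (by rintro rfl; exact hj hj₀.symm)
    rw [h] at this
    exact this
  · have : b ∈ B := ⟨hm, c, hc, fun i hi => hi⟩
    rw [h] at this
    exact this

theorem dom_inner_pos (H : BasedRootSystem R₀ α p) {b b' : Z} (hb : IsDom α b) (hm : b ∈ R₀)
    (hb' : IsDom α b') (hm' : b' ∈ R₀) : 0 < ⟪b, b'⟫ := by
  obtain ⟨c, hc, hc0⟩ := H.dom_coef_pos hb hm
  obtain ⟨i, hi⟩ := H.exists_inner_simple_pos hm' (H.dom_pos hb' hm')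
  rw [hc, sum_inner]
  refine Finset.sum_pos' (fun j _ => ?_) ⟨i, Finset.mem_univ i, ?_⟩
  · rw [inner_smul_left, real_inner_comm]
    exact mul_nonneg (hc0 j).le (hb' j)
  · rw [inner_smul_left, real_inner_comm]
    exact mul_pos (hc0 i) hi

/-- There is at most one dominant root of each length. -/
theorem dom_unique (H : BasedRootSystem R₀ α p) {b b' : Z} (hb : IsDom α b) (hm : b ∈ R₀)
    (hb' : IsDom α b') (hm' : b' ∈ R₀) (hn : ‖b‖ = ‖b'‖) : b = b' := by
  -- otherwise `γ = b - b'` is a root with `(b, γ) > 0` and `(b', γ) < 0`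
  by_contra hne
  have hmem := H.irr.sub_mem hm hm' hne (H.dom_inner_pos hb hm hb' hm')
  have h1 : 0 < ‖b - b'‖ ^ 2 := by
    have := norm_pos_iff.2 (sub_ne_zero.2 hne)
    positivity
  rw [norm_sub_sq_real] at h1
  have h2 : 0 < ⟪b, b - b'⟫ := by
    rw [inner_sub_right, real_inner_self_eq_norm_sq]
    nlinarith [congrArg (· ^ 2) hn]
  have h3 : ⟪b', b - b'⟫ < 0 := by
    rw [inner_sub_right, real_inner_self_eq_norm_sq, real_inner_comm]
    nlinarith [congrArg (· ^ 2) hn]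
  have h4 := H.pos_of_dom_inner_pos hb hmem h2
  have h5 := H.neg_of_dom_inner_neg hb' hmem h3
  linarith

/-- The highest root: it is dominant, of maximal length, and lies above all roots. -/
theorem exists_highest (H : BasedRootSystem R₀ α p) :
    ∃ f ∈ R₀, IsDom α f ∧ (∀ b ∈ R₀, ‖b‖ ≤ ‖f‖) ∧ ∀ b ∈ R₀, RootLE α b f := by
  obtain ⟨f, hf, hmax⟩ := Set.exists_max_image R₀ (fun b => ⟪p, b⟫) H.irr.finite H.irr.nonempty
  have hdom : ∀ b ∈ R₀, ⟪p, b⟫ = ⟪p, f⟫ → IsDom α b := by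
    intro b hb hbf i
    by_contra hcon
    push Not at hcon
    have h0 := (inner_coroot_neg (H.simple_ne_zero i)).2 hcon
    have h1 := hmax _ (sref_mem H.irr (H.basis.mem i) hb)
    rw [sref_apply, inner_sub_right, inner_smul_right, H.ht] at h1
    linarith
  have hle : ∀ b ∈ R₀, RootLE α b f := by
    intro b hb
    obtain ⟨v, hv, hvd, hle⟩ := H.exists_dom_above hb
    refine hle.trans ?_
    have hvb := H.irr.weyl_mem hv hb
    rcases eq_or_ne f (v b) with he | hne
    · rw [← he]
      exact RootLE.refl α f
    · have hmem := H.irr.sub_mem hf hvb hne (H.dom_inner_pos (hdom f hf rfl) hf hvd hvb)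
      have h1 := hmax _ hvb
      have h2 : 0 < ⟪p, f - v b⟫ := by
        refine lt_of_le_of_ne ?_ (H.ht_ne_zero hmem).symm
        rw [inner_sub_right]
        linarith
      exact H.exists_nat_coef hmem h2
  refine ⟨f, hf, hdom f hf rfl, fun b hb => ?_, hle⟩
  obtain ⟨v, hv, hvd, -⟩ := H.exists_dom_above hb
  have hvb := H.irr.weyl_mem hv hb
  have hnn : ∀ g, IsDom α g → ⟪g, v b⟫ ≤ ⟪g, f⟫ := by
    intro g hg
    obtain ⟨c, hc⟩ := hle _ hvb
    have : 0 ≤ ⟪g, f - v b⟫ := by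
      rw [hc, inner_sum]
      refine Finset.sum_nonneg fun i _ => ?_
      rw [← Nat.cast_smul_eq_nsmul ℝ, inner_smul_right]
      exact mul_nonneg (Nat.cast_nonneg _) (hg i)
    rw [inner_sub_right] at this
    linarith
  have h1 := hnn _ hvd
  have h2 := hnn _ (hdom f hf rfl)
  rw [real_inner_self_eq_norm_sq, LinearIsometryEquiv.norm_map] at h1
  rw [real_inner_self_eq_norm_sq, real_inner_comm] at h2
  exact (sq_le_sq₀ (norm_nonneg _) (norm_nonneg _)).1 (h1.trans h2)

/-- The highest short root: it is dominant, of minimal length, and lies above all short roots. -/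
theorem exists_highest_short (H : BasedRootSystem R₀ α p) :
    ∃ f ∈ R₀, IsDom α f ∧ (∀ b ∈ R₀, ‖f‖ ≤ ‖b‖) ∧
      ∀ b ∈ R₀, (∀ a ∈ R₀, ‖b‖ ≤ ‖a‖) → RootLE α b f := by
  obtain ⟨g, hg, hmin⟩ := Set.exists_min_image R₀ (fun b => ‖b‖) H.irr.finite H.irr.nonempty
  obtain ⟨v, hv, hvd, -⟩ := H.exists_dom_above hg
  have hvg := H.irr.weyl_mem hv hg
  have hvmin : ∀ b ∈ R₀, ‖v g‖ ≤ ‖b‖ := by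
    intro b hb
    rw [LinearIsometryEquiv.norm_map]
    exact hmin b hb
  refine ⟨v g, hvg, hvd, hvmin, fun b hb hbs => ?_⟩
  obtain ⟨u, hu, hud, hle⟩ := H.exists_dom_above hb
  have hub := H.irr.weyl_mem hu hb
  have : u b = v g := by
    refine H.dom_unique hud hub hvd hvg (le_antisymm ?_ (hvmin _ hub))
    rw [LinearIsometryEquiv.norm_map]
    exact hbs _ hvg
  rwa [← this]

/-- Two roots of the same length are conjugate under the Weyl group. -/
theorem exists_weyl_conj (H : BasedRootSystem R₀ α p) {a b : Z} (ha : a ∈ R₀) (hb : b ∈ R₀)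
    (hn : ‖a‖ = ‖b‖) : ∃ v ∈ weyl R₀, v a = b := by
  obtain ⟨u, hu, hud, -⟩ := H.exists_dom_above ha
  obtain ⟨v, hv, hvd, -⟩ := H.exists_dom_above hb
  have : u a = v b := H.dom_unique hud (H.irr.weyl_mem hu ha) hvd (H.irr.weyl_mem hv hb) (by
    rw [LinearIsometryEquiv.norm_map, LinearIsometryEquiv.norm_map, hn])
  refine ⟨v⁻¹ * u, mul_mem (inv_mem hv) hu, ?_⟩
  rw [isom_mul_apply, this, ← isom_mul_apply, inv_mul_cancel]
  rfl

/-- Every root is conjugate to a simple root under the Weyl group. -/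
theorem exists_conj_simple (H : BasedRootSystem R₀ α p) {b : Z} (hb : b ∈ R₀) :
    ∃ i, ∃ v ∈ weyl R₀, v (α i) = b := by
  have key : ∀ b ∈ R₀, 0 < ⟪p, b⟫ → ∃ i, ∃ v ∈ weyl R₀, v (α i) = b := by
    intro b hb hp
    refine H.pos_induction (P := fun b => ∃ i, ∃ v ∈ weyl R₀, v (α i) = b)
      (fun i => ⟨i, 1, one_mem _, rfl⟩) ?_ hb hp
    rintro b _ _ i _ ⟨j, v, hv, rfl⟩
    exact ⟨j, sref (α i) * v, mul_mem (H.simple_mem_weyl i) hv, rfl⟩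
  by_cases hp : 0 < ⟪p, b⟫
  · exact key b hb hp
  · obtain ⟨i, v, hv, he⟩ := key (-b) (H.irr.neg_mem hb) (by
      rw [inner_neg_right]; linarith [H.ht_neg hb hp])
    refine ⟨i, v * sref (α i), mul_mem hv (H.simple_mem_weyl i), ?_⟩
    rw [isom_mul_apply, sref_self (H.simple_ne_zero i), map_neg, he, neg_neg]

/-- A root whose coroot pairs evenly with all roots is short. -/
theorem short_of_even (H : BasedRootSystem R₀ α p) {a : Z} (ha : a ∈ R₀)
    (h : ∀ b ∈ R₀, ∃ k : ℤ, ⟪b, coroot a⟫ = 2 * k) : ∀ b ∈ R₀, ‖a‖ ≤ ‖b‖ := by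
  intro b hb
  by_contra hlt
  push Not at hlt
  obtain ⟨u, hu, hud, -⟩ := H.exists_dom_above ha
  obtain ⟨v, hv, hvd, -⟩ := H.exists_dom_above hb
  have hpos := H.dom_inner_pos hvd (H.irr.weyl_mem hv hb) hud (H.irr.weyl_mem hu ha)
  set c : Z := (u⁻¹ * v) b with hc
  have hcm : c ∈ R₀ := H.irr.weyl_mem (mul_mem (inv_mem hu) hv) hb
  have hcn : ‖c‖ = ‖b‖ := LinearIsometryEquiv.norm_map _ _
  have huc : u c = v b := by
    rw [hc, ← isom_mul_apply, mul_inv_cancel_left]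
  rw [← huc, LinearIsometryEquiv.inner_map_map] at hpos
  have hpos' := (inner_coroot_pos (H.irr.ne_zero a ha)).2 hpos
  obtain ⟨k, hk⟩ := h c hcm
  have hne : c ≠ a := fun e => by rw [← e, hcn] at hlt; exact lt_irrefl _ hlt
  have hne' : c ≠ -a := fun e => by rw [← norm_neg a, ← e, hcn] at hlt; exact lt_irrefl _ hlt
  rcases H.irr.inner_coroot_short hcm ha hne hne' (by rw [hcn]; exact hlt.le) with h1 | h1 | h1
  · linarith
  · rw [hk] at h1
    have : 2 * k = 1 := by exact_mod_cast h1
    omega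
  · linarith

end BasedRootSystem

end

/-! ### Dual roots -/

section

variable {Z : Type*} [NormedAddCommGroup Z] [InnerProductSpace ℝ Z]

theorem exists_inner_eq_one [FiniteDimensional ℝ Z] {n : ℕ} {α : Fin n → Z}
    (h : LinearIndependent ℝ α) : ∃ p : Z, ∀ i, ⟪p, α i⟫ = 1 := by
  let b := Module.Basis.span h
  obtain ⟨g, hg⟩ := LinearMap.exists_extend (b.constr ℝ (fun _ => (1 : ℝ)))
  refine ⟨(InnerProductSpace.toDual ℝ Z).symm (LinearMap.toContinuousLinearMap g), fun i => ?_⟩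
  rw [InnerProductSpace.toDual_symm_apply]
  have h1 := LinearMap.congr_fun hg (b i)
  rw [Module.Basis.constr_basis] at h1
  have h2 : ((b i : Submodule.span ℝ (Set.range α)) : Z) = α i := by
    exact congrArg Subtype.val (Module.Basis.span_apply h i)
  simpa [h2] using h1

theorem mu_pos (k : Kind) {b : Z} (hb : b ≠ 0) : 0 < mu k b := by
  have : 0 < ‖b‖ := norm_pos_iff.2 hb
  cases k
  · exact one_pos
  · simp only [mu]
    positivity

theorem mu_of_norm_eq (k : Kind) {b c : Z} (h : ‖b‖ = ‖c‖) : mu k b = mu k c := by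
  cases k <;> simp [mu, h]

theorem mu_map (k : Kind) (v : Z ≃ₗᵢ[ℝ] Z) (b : Z) : mu k (v b) = mu k b :=
  mu_of_norm_eq k (v.norm_map b)

theorem mu_neg (k : Kind) (b : Z) : mu k (-b) = mu k b :=
  mu_of_norm_eq k (norm_neg b)

theorem dualRoot_map (k : Kind) (v : Z ≃ₗᵢ[ℝ] Z) (b : Z) :
    dualRoot k (v b) = v (dualRoot k b) := by
  rw [dualRoot, dualRoot, mu_map, coroot_map, map_smul]

theorem dualRoot_neg (k : Kind) (b : Z) : dualRoot k (-b) = -dualRoot k b := by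
  rw [dualRoot, dualRoot, mu_neg]
  simp [coroot]

theorem mu_dualRoot (k : Kind) {b : Z} (hb : b ≠ 0) : mu k (dualRoot k b) = mu k b := by
  cases k
  · rfl
  · rw [dualRoot_t hb]

theorem dualRoot_ne_zero (k : Kind) {b : Z} (hb : b ≠ 0) : dualRoot k b ≠ 0 :=
  smul_ne_zero (mu_pos k hb).ne' (coroot_ne_zero hb)

/-- `b = μ_b (b^d)^∨`. -/
theorem mu_smul_coroot_dualRoot (k : Kind) {b : Z} (hb : b ≠ 0) :
    mu k b • coroot (dualRoot k b) = b := by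
  have := dualRoot_dualRoot k hb
  rw [dualRoot, mu_dualRoot k hb] at this
  exact this

/-- `(x, b) = μ_b (x, (b^d)^∨)`. -/
theorem inner_eq_mu_mul (k : Kind) {b : Z} (hb : b ≠ 0) (x : Z) :
    ⟪x, b⟫ = mu k b * ⟪x, coroot (dualRoot k b)⟫ := by
  rw [← inner_smul_right, mu_smul_coroot_dualRoot k hb]

theorem sref_dualRoot (k : Kind) {b : Z} (hb : b ≠ 0) : sref (dualRoot k b) = sref b := by
  have h := norm_pos_iff.2 hb
  rw [dualRoot, sref_smul (mu_pos k hb).ne', coroot, sref_smul (by positivity)]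

theorem inner_dualRoot_pos (k : Kind) {b x : Z} (hb : b ≠ 0) :
    0 < ⟪x, dualRoot k b⟫ ↔ 0 < ⟪x, b⟫ := by
  rw [dualRoot, inner_smul_right, mul_pos_iff_of_pos_left (mu_pos k hb), inner_coroot_pos hb]

theorem inner_dualRoot_pos' (k : Kind) {b x : Z} (hb : b ≠ 0) :
    0 < ⟪dualRoot k b, x⟫ ↔ 0 < ⟪b, x⟫ := by
  rw [real_inner_comm, inner_dualRoot_pos k hb, real_inner_comm]

theorem inner_dualRoot_nonneg (k : Kind) {b x : Z} (hb : b ≠ 0) :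
    0 ≤ ⟪x, dualRoot k b⟫ ↔ 0 ≤ ⟪x, b⟫ := by
  rw [dualRoot, inner_smul_right, mul_nonneg_iff_of_pos_left (mu_pos k hb), inner_coroot_nonneg hb]

theorem norm_coroot {b : Z} (hb : b ≠ 0) : ‖coroot b‖ = 2 / ‖b‖ := by
  have : 0 < ‖b‖ := norm_pos_iff.2 hb
  rw [coroot, norm_smul, Real.norm_of_nonneg (by positivity)]
  field_simp

theorem norm_coroot_le {b c : Z} (hb : b ≠ 0) (hc : c ≠ 0) :
    ‖coroot b‖ ≤ ‖coroot c‖ ↔ ‖c‖ ≤ ‖b‖ := by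
  have h1 : 0 < ‖b‖ := norm_pos_iff.2 hb
  have h2 : 0 < ‖c‖ := norm_pos_iff.2 hc
  rw [norm_coroot hb, norm_coroot hc, div_le_div_iff_of_pos_left two_pos h1 h2]

end

namespace InitialData

variable {Z : Type*} [NormedAddCommGroup Z] [InnerProductSpace ℝ Z] [FiniteDimensional ℝ Z] {n : ℕ}
  (D : InitialData Z n)

/-- A vector with `(ρ, αᵢ) = 1` for all `i`; a root is positive if and only if its inner product
with `ρ` is positive. -/
def rho : Z := (exists_inner_eq_one D.isBasis.linearIndependent).choose

theorem based : BasedRootSystem D.R₀ D.α D.rho :=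
  ⟨D.isRootSystem, D.isBasis, (exists_inner_eq_one D.isBasis.linearIndependent).choose_spec⟩

theorem coroot_based : ∃ p, BasedRootSystem (coroot '' D.R₀) (fun i => coroot (D.α i)) p := by
  have h : IsRootBasis (coroot '' D.R₀) (fun i => coroot (D.α i)) := by
    have := D.isBasis.dual D.isRootSystem .u
    have he : (dualRoot .u : Z → Z) = coroot := funext dualRoot_u
    rwa [he] at this
  obtain ⟨p, hp⟩ := exists_inner_eq_one h.linearIndependent
  exact ⟨p, D.isRootSystem.coroots, h, hp⟩

variable {D}

theorem ne_zero {b : Z} (hb : b ∈ D.R₀) : b ≠ 0 := D.isRootSystem.ne_zero b hb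

theorem weyl_mem {v : Z ≃ₗᵢ[ℝ] Z} (hv : v ∈ weyl D.R₀) {b : Z} (hb : b ∈ D.R₀) : v b ∈ D.R₀ :=
  D.isRootSystem.weyl_mem hv hb

variable (D)

theorem weyl_dual : weyl D.dual.R₀ = weyl D.R₀ := by
  have : {g | ∃ b ∈ D.dual.R₀, g = sref b} = {g | ∃ b ∈ D.R₀, g = sref b} := by
    ext g
    constructor
    · rintro ⟨_, ⟨b, hb, rfl⟩, rfl⟩
      exact ⟨b, hb, sref_dualRoot _ (ne_zero hb)⟩
    · rintro ⟨b, hb, rfl⟩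
      exact ⟨_, ⟨b, hb, rfl⟩, (sref_dualRoot _ (ne_zero hb)).symm⟩
  rw [weyl, weyl, this]

/-- Passing to dual roots preserves positivity. -/
theorem dual_rho_pos {b : Z} (hb : b ∈ D.R₀) :
    0 < ⟪D.dual.rho, dualRoot D.kind b⟫ ↔ 0 < ⟪D.rho, b⟫ := by
  have key : ∀ b ∈ D.R₀, 0 < ⟪D.rho, b⟫ → 0 < ⟪D.dual.rho, dualRoot D.kind b⟫ := by
    intro b hb hp
    rw [inner_dualRoot_pos _ (ne_zero hb)]
    obtain ⟨c, hc, hc0⟩ := D.based.exists_coef hb hp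
    have hi : ∀ i, 0 < ⟪D.dual.rho, D.α i⟫ := by
      intro i
      rw [← inner_dualRoot_pos D.kind (D.based.simple_ne_zero i)]
      have := D.dual.based.ht i
      change ⟪D.dual.rho, dualRoot D.kind (D.α i)⟫ = 1 at this
      rw [this]
      exact one_pos
    obtain ⟨i, hi0⟩ : ∃ i, 0 < c i := by
      by_contra hcon
      push Not at hcon
      rw [hc, D.based.ht_sum] at hp
      exact absurd (Finset.sum_nonpos fun i _ => hcon i) (not_le.2 hp)
    rw [hc, inner_sum]
    refine Finset.sum_pos' (fun j _ => ?_) ⟨i, Finset.mem_univ i, ?_⟩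
    · rw [inner_smul_right]
      exact mul_nonneg (hc0 j) (hi j).le
    · rw [inner_smul_right]
      exact mul_pos hi0 (hi i)
  refine ⟨fun h => ?_, key b hb⟩
  by_contra hp
  have h1 := key (-b) (D.neg_mem hb) (by
    rw [inner_neg_right]; linarith [D.based.ht_neg hb hp])
  rw [dualRoot_neg, inner_neg_right] at h1
  linarith

theorem dual_isDom {b : Z} (hb : b ≠ 0) (h : IsDom D.α b) :
    IsDom D.dual.α (dualRoot D.kind b) := by
  intro i
  change 0 ≤ ⟪dualRoot D.kind b, dualRoot D.kind (D.α i)⟫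
  rw [inner_dualRoot_nonneg _ (D.based.simple_ne_zero i), real_inner_comm,
    inner_dualRoot_nonneg _ hb, real_inner_comm]
  exact h i

/-! ### The root `β` -/

theorem phi_spec : ∀ b ∈ D.R₀, D.DomLE b D.phi := by
  obtain ⟨f, hf, -, -, hle⟩ := D.based.exists_highest
  exact Classical.epsilon_spec (p := fun a : D.R₀ => ∀ b ∈ D.R₀, D.DomLE b a) ⟨⟨f, hf⟩, hle⟩

theorem theta_spec : D.IsShort D.theta ∧ ∀ b, D.IsShort b → D.DomLE b D.theta := by
  obtain ⟨f, hf, -, hs, hle⟩ := D.based.exists_highest_short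
  exact Classical.epsilon_spec
    (p := fun a : D.R₀ => D.IsShort a ∧ ∀ b, D.IsShort b → D.DomLE b a)
    ⟨⟨f, hf⟩, ⟨hf, hs⟩, fun b hb => hle b hb.1 hb.2⟩

theorem phi_dom : IsDom D.α (D.phi : Z) ∧ ∀ b ∈ D.R₀, ‖b‖ ≤ ‖(D.phi : Z)‖ := by
  obtain ⟨f, hf, hd, hl, hle⟩ := D.based.exists_highest
  have : (D.phi : Z) = f :=
    D.based.rootLE_antisymm (hle _ D.phi.2) (D.phi_spec f hf)
  rw [this]
  exact ⟨hd, hl⟩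

theorem theta_dom : IsDom D.α (D.theta : Z) := by
  obtain ⟨f, hf, hd, hs, hle⟩ := D.based.exists_highest_short
  have : (D.theta : Z) = f :=
    D.based.rootLE_antisymm (hle _ D.theta.2 D.theta_spec.1.2) (D.theta_spec.2 f ⟨hf, hs⟩)
  rw [this]
  exact hd

theorem beta_dom : IsDom D.α (D.beta : Z) := by
  rw [beta]
  cases D.kind
  · exact D.phi_dom.1
  · exact D.theta_dom

theorem beta_pos : 0 < ⟪D.rho, (D.beta : Z)⟫ := D.based.dom_pos D.beta_dom D.beta.2

theorem beta_u (h : D.kind = .u) : ∀ b ∈ D.R₀, ‖b‖ ≤ ‖(D.beta : Z)‖ := by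
  rw [beta, h]
  exact D.phi_dom.2

theorem beta_t (h : D.kind = .t) : D.IsShort D.beta := by
  rw [beta, h]
  exact D.theta_spec.1

/-- The dual of the root `β` is a short root of the dual root system. -/
theorem dual_isShort_beta : D.dual.IsShort (dualRoot D.kind (D.beta : Z)) := by
  refine ⟨⟨_, D.beta.2, rfl⟩, ?_⟩
  rintro _ ⟨b, hb, rfl⟩
  rcases hk : D.kind
  · rw [dualRoot_u, dualRoot_u, norm_coroot_le (ne_zero D.beta.2) (ne_zero hb)]
    exact D.beta_u hk b hb
  · rw [dualRoot_t (ne_zero D.beta.2), dualRoot_t (ne_zero hb)]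
    exact (D.beta_t hk).2 b hb

theorem dual_beta_dom : IsDom D.dual.α (dualRoot D.kind (D.beta : Z)) :=
  D.dual_isDom (ne_zero D.beta.2) D.beta_dom

/-- Every root lies above `-k β` in the dominance order, where `k = μ_b / μ_β`. -/
theorem exists_beta_mul_le {b : Z} (hb : b ∈ D.R₀) : ∃ k : ℕ, 0 < k ∧
    mu D.kind b = k * mu D.kind (D.beta : Z) ∧ RootLE D.α (-b) (k • (D.beta : Z)) := by
  rcases hk : D.kind
  · refine ⟨1, one_pos, by simp [mu], ?_⟩
    have := D.phi_spec (-b) (D.neg_mem hb)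
    have hβ : D.beta = D.phi := by rw [beta, hk]
    rwa [hβ, one_smul]
  · obtain ⟨v, hv, hvd, hle⟩ := D.based.exists_dom_above (D.neg_mem hb)
    set c := v (-b) with hc
    have hcm : c ∈ D.R₀ := weyl_mem hv (D.neg_mem hb)
    have hcn : ‖c‖ = ‖b‖ := by rw [hc, LinearIsometryEquiv.norm_map, norm_neg]
    set f : Z := (D.beta : Z) with hf
    have hfm : f ∈ D.R₀ := D.beta.2
    have hf0 : 0 < ‖f‖ := norm_pos_iff.2 (ne_zero hfm)
    have hc0 : 0 < ‖c‖ := norm_pos_iff.2 (ne_zero hcm)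
    rw [← mu_of_norm_eq .t hcn]
    by_cases hcf : c = f
    · refine ⟨1, one_pos, by simp [hcf], ?_⟩
      rw [one_smul, ← hcf]
      exact hle
    have hpos := D.based.dom_inner_pos D.beta_dom hfm hvd hcm
    -- `(β, c^∨) = 1` for the dominant conjugate `c` of `-b`, so that `k = (c, β^∨)` is an integer
    have h1 : ⟪f, coroot c⟫ = 1 := by
      have h0 := (inner_coroot_pos (ne_zero hcm)).2 hpos
      have hne : f ≠ -c := by
        intro e
        have := D.beta_pos
        have h2 := D.based.dom_pos hvd hcm
        rw [← hf, e, inner_neg_right] at this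
        linarith
      rcases D.isRootSystem.inner_coroot_short hfm hcm (Ne.symm hcf) hne ((D.beta_t hk).2 c hcm)
        with h | h | h <;> linarith
    obtain ⟨k, hk'⟩ := D.isRootSystem.integral f hfm c hcm
    have hck : ‖c‖ ^ 2 = k * ‖f‖ ^ 2 := by
      rw [← hk']
      rw [coroot, inner_smul_right] at h1 ⊢
      rw [real_inner_comm] at h1
      field_simp at h1 ⊢
      linarith
    have hk0 : 0 < k := by
      have : 0 < (k : ℝ) * ‖f‖ ^ 2 := by rw [← hck]; positivity
      exact_mod_cast pos_of_mul_pos_left this (by positivity)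
    lift k to ℕ using hk0.le
    have hk0' : 0 < k := by exact_mod_cast hk0
    simp only [Int.cast_natCast] at hck
    refine ⟨k, hk0', ?_, hle.trans ?_⟩
    · simp only [mu]
      rw [hck]
      ring
    · -- compare `c` and `k β` through their coroots, where `β^∨` is the highest root
      obtain ⟨p', H'⟩ := D.coroot_based
      obtain ⟨g, hg, hgd, hgl, hgle⟩ := H'.exists_highest
      have hgf : g = coroot f := by
        refine H'.dom_unique hgd hg ?_ ⟨f, hfm, rfl⟩ (le_antisymm ?_ (hgl _ ⟨f, hfm, rfl⟩))
        · intro i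
          rw [inner_coroot_nonneg (D.based.simple_ne_zero i), real_inner_comm,
            inner_coroot_nonneg (ne_zero hfm), real_inner_comm]
          exact D.beta_dom i
        · obtain ⟨a, ha, rfl⟩ := hg
          rw [norm_coroot_le (ne_zero ha) (ne_zero hfm)]
          exact (D.beta_t hk).2 a ha
      obtain ⟨d, hd⟩ := hgle _ ⟨c, hcm, rfl⟩
      rw [hgf] at hd
      obtain ⟨x, hx⟩ := D.based.exists_nat_coef hfm D.beta_pos
      obtain ⟨y, hy⟩ := D.based.exists_nat_coef hcm (D.based.dom_pos hvd hcm)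
      have e1 : k • f - c = ∑ i, ((d i : ℝ) * (‖c‖ ^ 2 / ‖D.α i‖ ^ 2)) • D.α i := by
        have h2 : k • f - c = (‖c‖ ^ 2 / 2) • (coroot f - coroot c) := by
          rw [smul_sub, coroot, coroot, smul_smul, smul_smul, ← Nat.cast_smul_eq_nsmul ℝ]
          congr 1
          · congr 1
            rw [hck]
            field_simp
          · rw [show ‖c‖ ^ 2 / 2 * (2 / ‖c‖ ^ 2) = 1 by field_simp, one_smul]
        rw [h2, hd, Finset.smul_sum]
        refine Finset.sum_congr rfl fun i _ => ?_
        simp only [coroot]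
        rw [← Nat.cast_smul_eq_nsmul ℝ, smul_smul, smul_smul]
        congr 1
        have := norm_pos_iff.2 (D.based.simple_ne_zero i)
        field_simp
      have e2 : k • f - c = ∑ i, ((k : ℝ) * x i - y i) • D.α i := by
        have hx' : f = ∑ i, (x i : ℝ) • D.α i := by simpa only [Nat.cast_smul_eq_nsmul] using hx
        have hy' : c = ∑ i, (y i : ℝ) • D.α i := by simpa only [Nat.cast_smul_eq_nsmul] using hy
        simp only [sub_smul, Finset.sum_sub_distrib, mul_smul, ← Finset.smul_sum]
        rw [← hx', ← hy', Nat.cast_smul_eq_nsmul]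
      have e3 := D.based.coef_inj (e1.symm.trans e2)
      have e4 : ∀ i, y i ≤ k * x i := by
        intro i
        have h3 : (d i : ℝ) * (‖c‖ ^ 2 / ‖D.α i‖ ^ 2) = (k : ℝ) * x i - y i := congrFun e3 i
        have h4 : (0 : ℝ) ≤ (k : ℝ) * x i - y i := by rw [← h3]; positivity
        have : (y i : ℝ) ≤ ((k * x i : ℕ) : ℝ) := by push_cast; linarith
        exact_mod_cast this
      refine ⟨fun i => k * x i - y i, ?_⟩
      rw [e2]
      refine Finset.sum_congr rfl fun i _ => ?_
      rw [← Nat.cast_smul_eq_nsmul ℝ, Nat.cast_sub (e4 i)]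
      push_cast
      rfl

end InitialData

/-! ### The extended affine Weyl group -/

section

variable {Z : Type*} [NormedAddCommGroup Z] [InnerProductSpace ℝ Z]

/-- A linear isometry `v` of `Z`, extended to affine linear functions by fixing the constants. -/
def linExt (v : Z ≃ₗᵢ[ℝ] Z) : (Z × ℝ) ≃ₗ[ℝ] (Z × ℝ) :=
  v.toLinearEquiv.prodCongr (LinearEquiv.refl ℝ ℝ)

theorem linExt_apply (v : Z ≃ₗᵢ[ℝ] Z) (x : Z × ℝ) : linExt v x = (v x.1, x.2) := rfl

theorem linExt_mul (v w : Z ≃ₗᵢ[ℝ] Z) : linExt (v * w) = linExt v * linExt w := rfl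

theorem linExt_one : linExt (1 : Z ≃ₗᵢ[ℝ] Z) = 1 := rfl

theorem linExt_sref (b : Z) : linExt (sref b) = affRefl (b, 0) := by
  ext x : 1
  rw [linExt_apply, affRefl_apply, sref_apply, real_inner_comm]
  ext <;> simp

/-- `g` is the composite `τ(ξ) v`. -/
def IsAff (g : (Z × ℝ) ≃ₗ[ℝ] (Z × ℝ)) (v : Z ≃ₗᵢ[ℝ] Z) (ξ : Z) : Prop :=
  ∀ x, g x = (v x.1, x.2 - ⟪v x.1, ξ⟫)

theorem IsAff.unique {g : (Z × ℝ) ≃ₗ[ℝ] (Z × ℝ)} {v v' : Z ≃ₗᵢ[ℝ] Z} {ξ ξ' : Z}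
    (h : IsAff g v ξ) (h' : IsAff g v' ξ') : v = v' ∧ ξ = ξ' := by
  have hv : v = v' := by
    ext z
    exact congrArg Prod.fst ((h (z, 0)).symm.trans (h' (z, 0)))
  subst hv
  refine ⟨rfl, ext_inner_left ℝ fun z => ?_⟩
  have := congrArg Prod.snd ((h (v⁻¹ z, 0)).symm.trans (h' (v⁻¹ z, 0)))
  have e : v (v⁻¹ z) = z := by rw [← isom_mul_apply, mul_inv_cancel]; rfl
  simp only [e] at this
  linarith

theorem IsAff.mul {g h : (Z × ℝ) ≃ₗ[ℝ] (Z × ℝ)} {v w : Z ≃ₗᵢ[ℝ] Z} {ξ η : Z}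
    (hg : IsAff g v ξ) (hh : IsAff h w η) : IsAff (g * h) (v * w) (ξ + v η) := by
  intro x
  rw [LinearEquiv.mul_apply, hh, hg, isom_mul_apply, inner_add_right,
    LinearIsometryEquiv.inner_map_map]
  ext
  · rfl
  · dsimp only
    ring

end

namespace InitialData

section

variable {Z : Type*} [NormedAddCommGroup Z] [InnerProductSpace ℝ Z] {n : ℕ} {D : InitialData Z n}

theorem weyl_mem_LamD {v : Z ≃ₗᵢ[ℝ] Z} (hv : v ∈ weyl D.R₀) :
    ∀ ξ ∈ D.LamD, v ξ ∈ D.LamD := by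
  have key : ∀ b ∈ D.R₀, ∀ ξ ∈ D.LamD, sref b ξ ∈ D.LamD := by
    intro b hb ξ hξ
    obtain ⟨k, hk⟩ := D.inner_coroot_dualRoot_int ξ hξ b hb
    rw [← sref_dualRoot D.kind (D.isRootSystem.ne_zero b hb), sref_apply, hk,
      Int.cast_smul_eq_zsmul]
    exact sub_mem hξ (D.LamD.smul_mem k (D.dualRoot_mem b hb))
  induction hv using Subgroup.closure_induction_left with
  | one => exact fun ξ hξ => hξ
  | mul_left x hx y _ ih =>
    obtain ⟨b, hb, rfl⟩ := hx
    exact fun ξ hξ => key b hb _ (ih ξ hξ)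
  | inv_mul_cancel x hx y _ ih =>
    obtain ⟨b, hb, rfl⟩ := hx
    rw [sref_inv]
    exact fun ξ hξ => key b hb _ (ih ξ hξ)

theorem linExt_mem_W {v : Z ≃ₗᵢ[ℝ] Z} (hv : v ∈ weyl D.R₀) : linExt v ∈ D.W := by
  have key : ∀ b ∈ D.R₀, linExt (sref b) ∈ D.W := by
    intro b hb
    rw [linExt_sref]
    exact Subgroup.subset_closure (Or.inl ⟨b, hb, rfl⟩)
  induction hv using Subgroup.closure_induction_left with
  | one =>
    rw [linExt_one]
    exact one_mem _
  | mul_left x hx y _ ih =>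
    obtain ⟨b, hb, rfl⟩ := hx
    rw [linExt_mul]
    exact mul_mem (key b hb) ih
  | inv_mul_cancel x hx y _ ih =>
    obtain ⟨b, hb, rfl⟩ := hx
    rw [sref_inv, linExt_mul]
    exact mul_mem (key b hb) ih

variable (D)

/-- Every element of `W` is of the form `τ(ξ) v` with `v` in the finite Weyl group and `ξ ∈ Λ^d`.
-/
theorem exists_lin_tr (w : D.W) : ∃ v : Z ≃ₗᵢ[ℝ] Z, v ∈ weyl D.R₀ ∧ ∃ ξ : D.LamD,
    IsAff (w : (Z × ℝ) ≃ₗ[ℝ] (Z × ℝ)) v ξ := by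
  have hb : ∀ b ∈ D.R₀, IsAff (affRefl (b, (0 : ℝ))) (sref b) 0 := by
    intro b _ x
    rw [← linExt_sref, linExt_apply]
    simp
  have ht : ∀ v : Z, IsAff (trans v) 1 v := by
    intro v x
    rfl
  obtain ⟨w, hw⟩ := w
  induction hw using Subgroup.closure_induction_left with
  | one => exact ⟨1, one_mem _, 0, fun x => by simp⟩
  | mul_left x hx y hy ih =>
    obtain ⟨v, hv, ξ, h⟩ := ih
    rcases hx with ⟨b, hbm, rfl⟩ | ⟨η, hη, rfl⟩
    · refine ⟨_, mul_mem (sref_mem_weyl hbm) hv,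
        ⟨sref b ξ, weyl_mem_LamD (sref_mem_weyl hbm) _ ξ.2⟩, ?_⟩
      simpa using (hb b hbm).mul h
    · exact ⟨_, mul_mem (one_mem _) hv, ⟨η, hη⟩ + ξ, (ht η).mul h⟩
  | inv_mul_cancel x hx y hy ih =>
    obtain ⟨v, hv, ξ, h⟩ := ih
    rcases hx with ⟨b, hbm, rfl⟩ | ⟨η, hη, rfl⟩
    · refine ⟨_, mul_mem (sref_mem_weyl hbm) hv,
        ⟨sref b ξ, weyl_mem_LamD (sref_mem_weyl hbm) _ ξ.2⟩, ?_⟩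
      have e : (affRefl (b, (0 : ℝ)))⁻¹ = affRefl (b, 0) := by
        rw [← linExt_sref, inv_eq_iff_mul_eq_one, ← linExt_mul, sref_mul_self, linExt_one]
      change IsAff ((affRefl (b, (0 : ℝ)))⁻¹ * y) _ _
      rw [e]
      simpa using (hb b hbm).mul h
    · have e : (trans η)⁻¹ = trans (-η) := by
        rw [inv_eq_iff_mul_eq_one]
        ext x : 1
        rw [LinearEquiv.mul_apply, trans_apply, trans_apply]
        simp
      refine ⟨_, mul_mem (one_mem _) hv, -⟨η, hη⟩ + ξ, ?_⟩
      change IsAff ((trans η)⁻¹ * y) _ _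
      rw [e]
      exact (ht (-η)).mul h

/-- The finite part `v` of `w = τ(ξ) v ∈ W`. -/
def lin (w : D.W) : Z ≃ₗᵢ[ℝ] Z := (D.exists_lin_tr w).choose

/-- The translation part `ξ` of `w = τ(ξ) v ∈ W`. -/
def tr (w : D.W) : D.LamD := (D.exists_lin_tr w).choose_spec.2.choose

theorem lin_mem (w : D.W) : D.lin w ∈ weyl D.R₀ := (D.exists_lin_tr w).choose_spec.1

theorem isAff (w : D.W) : IsAff (w : (Z × ℝ) ≃ₗ[ℝ] (Z × ℝ)) (D.lin w) (D.tr w) :=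
  (D.exists_lin_tr w).choose_spec.2.choose_spec

theorem apply_eq (w : D.W) (x : Z × ℝ) :
    w.1 x = (D.lin w x.1, x.2 - ⟪D.lin w x.1, (D.tr w : Z)⟫) := D.isAff w x

open Classical in
/-- The embedding of the finite Weyl group into `W` (with value `1` outside the finite Weyl
group). -/
def emb (v : Z ≃ₗᵢ[ℝ] Z) : D.W :=
  if h : v ∈ weyl D.R₀ then ⟨linExt v, linExt_mem_W h⟩ else 1

variable {D}

theorem coe_emb {v : Z ≃ₗᵢ[ℝ] Z} (h : v ∈ weyl D.R₀) :
    (D.emb v : (Z × ℝ) ≃ₗ[ℝ] (Z × ℝ)) = linExt v := by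
  rw [emb, dif_pos h]

theorem emb_apply {v : Z ≃ₗᵢ[ℝ] Z} (h : v ∈ weyl D.R₀) (x : Z × ℝ) :
    (D.emb v).1 x = (v x.1, x.2) := by
  rw [coe_emb h, linExt_apply]

theorem emb_mul {v w : Z ≃ₗᵢ[ℝ] Z} (hv : v ∈ weyl D.R₀) (hw : w ∈ weyl D.R₀) :
    D.emb (v * w) = D.emb v * D.emb w := by
  apply Subtype.ext
  rw [coe_emb (mul_mem hv hw), Subgroup.coe_mul, coe_emb hv, coe_emb hw, linExt_mul]

theorem emb_one : D.emb 1 = 1 := by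
  apply Subtype.ext
  rw [coe_emb (one_mem _), linExt_one]
  rfl

theorem emb_inv {v : Z ≃ₗᵢ[ℝ] Z} (hv : v ∈ weyl D.R₀) : D.emb v⁻¹ = (D.emb v)⁻¹ := by
  rw [eq_inv_iff_mul_eq_one, ← emb_mul (inv_mem hv) hv, inv_mul_cancel, emb_one]

theorem lin_tr_emb {v : Z ≃ₗᵢ[ℝ] Z} (hv : v ∈ weyl D.R₀) :
    D.lin (D.emb v) = v ∧ D.tr (D.emb v) = 0 := by
  have h : IsAff (D.emb v : (Z × ℝ) ≃ₗ[ℝ] (Z × ℝ)) v 0 := fun x => by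
    rw [emb_apply hv]
    simp
  exact ⟨((D.isAff _).unique h).1, Subtype.ext ((D.isAff _).unique h).2⟩

theorem lin_tr_tau (ξ : D.LamD) : D.lin (D.tau ξ) = 1 ∧ D.tr (D.tau ξ) = ξ := by
  have h : IsAff (D.tau ξ : (Z × ℝ) ≃ₗ[ℝ] (Z × ℝ)) 1 ξ := fun x => rfl
  exact ⟨((D.isAff _).unique h).1, Subtype.ext ((D.isAff _).unique h).2⟩

theorem lin_mul (v w : D.W) : D.lin (v * w) = D.lin v * D.lin w :=
  ((D.isAff (v * w)).unique ((D.isAff v).mul (D.isAff w))).1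

theorem tr_mul (v w : D.W) :
    (D.tr (v * w) : Z) = D.tr v + D.lin v (D.tr w) :=
  ((D.isAff (v * w)).unique ((D.isAff v).mul (D.isAff w))).2

theorem lin_one : D.lin 1 = 1 := by
  rw [← emb_one, (lin_tr_emb (one_mem _)).1]

theorem W_ext {v w : D.W} (h1 : D.lin v = D.lin w) (h2 : (D.tr v : Z) = D.tr w) : v = w := by
  apply Subtype.ext
  ext x : 1
  rw [D.apply_eq v, D.apply_eq w, h1, h2]

theorem tau_mul_emb (w : D.W) : D.tau (D.tr w) * D.emb (D.lin w) = w := by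
  have h1 := lin_tr_emb (D.lin_mem w)
  have h2 := lin_tr_tau (D.tr w)
  apply W_ext
  · rw [lin_mul, h1.1, h2.1, one_mul]
  · rw [tr_mul, h1.2, h2.2]
    simp

theorem tau_add (ξ η : D.LamD) : D.tau (ξ + η) = D.tau ξ * D.tau η := by
  apply W_ext
  · rw [lin_mul, (lin_tr_tau _).1, (lin_tr_tau _).1, (lin_tr_tau _).1, one_mul]
  · rw [tr_mul, (lin_tr_tau _).1, (lin_tr_tau _).2, (lin_tr_tau _).2, (lin_tr_tau _).2]
    rfl

theorem s_succ (i : Fin n) : D.s i.succ = D.emb (sref (D.α i)) := by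
  apply Subtype.ext
  rw [coe_emb (sref_mem_weyl (D.isBasis.mem i)), linExt_sref]
  rfl

theorem s_zero : D.s 0 = D.tau ⟨dualRoot D.kind (D.beta : Z), D.dualRoot_mem _ D.beta.2⟩ *
    D.emb (sref (D.beta : Z)) := by
  apply Subtype.ext
  rw [Subgroup.coe_mul, coe_emb (sref_mem_weyl D.beta.2), linExt_sref]
  exact affRefl_eq_trans_mul _ _ (D.isRootSystem.ne_zero _ D.beta.2)

theorem s_apply (i : Fin (n + 1)) (x : Z × ℝ) :
    (D.s i).1 x = x - ⟪coroot (D.a i).1, x.1⟫ • D.a i := rfl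

theorem s_mul_self (i : Fin (n + 1)) : D.s i * D.s i = 1 := by
  apply Subtype.ext
  ext x : 1
  exact affReflFun_involutive (D.a i) x

theorem s_inv (i : Fin (n + 1)) : (D.s i)⁻¹ = D.s i :=
  inv_eq_of_mul_eq_one_right (s_mul_self i)

theorem s_a (i : Fin (n + 1)) : (D.s i).1 (D.a i) = -D.a i := by
  rw [s_apply, real_inner_comm, inner_coroot_self (D.isRootSystem.ne_zero _ (D.a_fst_mem i))]
  module

theorem lin_s (i : Fin (n + 1)) : D.lin (D.s i) = sref (D.a i).1 := by
  refine Fin.cases ?_ (fun j => ?_) i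
  · rw [s_zero, lin_mul, (lin_tr_tau _).1, (lin_tr_emb (sref_mem_weyl D.beta.2)).1, one_mul, a_zero,
      sref_neg]
  · rw [s_succ, (lin_tr_emb (sref_mem_weyl (D.isBasis.mem j))).1, a_succ]

theorem W_mul_apply (v w : D.W) (x : Z × ℝ) : (v * w).1 x = v.1 (w.1 x) := rfl

theorem W_inv_apply_apply (w : D.W) (x : Z × ℝ) : (w⁻¹).1 (w.1 x) = x := by
  rw [← W_mul_apply, inv_mul_cancel]
  rfl

theorem W_apply_inv_apply (w : D.W) (x : Z × ℝ) : w.1 ((w⁻¹).1 x) = x := by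
  rw [← W_mul_apply, mul_inv_cancel]
  rfl

theorem Rb_fst {x : Z × ℝ} (hx : x ∈ D.Rb) : x.1 ∈ D.R₀ := by
  obtain ⟨b, hb, m, rfl⟩ := hx
  exact hb

theorem Rb_snd {x : Z × ℝ} (hx : x ∈ D.Rb) : ∃ m : ℤ, x.2 = m * mu D.kind x.1 := by
  obtain ⟨b, hb, m, rfl⟩ := hx
  exact ⟨m, rfl⟩

theorem mk_zero_mem_Rb {b : Z} (hb : b ∈ D.R₀) : (b, (0 : ℝ)) ∈ D.Rb :=
  ⟨b, hb, 0, by simp⟩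

theorem mk_mu_mem_Rb {b : Z} (hb : b ∈ D.R₀) : (b, mu D.kind b) ∈ D.Rb :=
  ⟨b, hb, 1, by simp⟩

theorem neg_mem_Rb {x : Z × ℝ} (hx : x ∈ D.Rb) : -x ∈ D.Rb := by
  obtain ⟨b, hb, m, rfl⟩ := hx
  exact ⟨-b, D.neg_mem hb, -m, by rw [mu_neg]; simp⟩

theorem W_mem_Rb (w : D.W) {x : Z × ℝ} (hx : x ∈ D.Rb) : w.1 x ∈ D.Rb := by
  obtain ⟨b, hb, m, rfl⟩ := hx
  have hwb := D.isRootSystem.weyl_mem (D.lin_mem w) hb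
  obtain ⟨k, hk⟩ := D.inner_coroot_dualRoot_int _ (D.tr w).2 _ hwb
  refine ⟨_, hwb, m - k, ?_⟩
  rw [D.apply_eq w, mu_map]
  ext
  · rfl
  · dsimp only
    rw [real_inner_comm, inner_eq_mu_mul D.kind (D.isRootSystem.ne_zero _ hwb), hk, mu_map]
    push_cast
    ring

end

variable {Z : Type*} [NormedAddCommGroup Z] [InnerProductSpace ℝ Z] [FiniteDimensional ℝ Z] {n : ℕ}
  (D : InitialData Z n)

/-- Positivity of affine roots, in terms of the lexicographic order given by the constant term and
the sign of the gradient. On `R^•` this agrees with `IsPos`. -/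
def APos (x : Z × ℝ) : Prop := 0 < x.2 ∨ (x.2 = 0 ∧ 0 < ⟪D.rho, x.1⟫)

variable {D}

theorem apos_neg_iff {x : Z × ℝ} (hx : x ∈ D.Rb) : D.APos (-x) ↔ ¬ D.APos x := by
  have h := D.based.ht_ne_zero (Rb_fst hx)
  simp only [APos, Prod.snd_neg, Prod.fst_neg, inner_neg_right, neg_eq_zero, Left.neg_pos_iff]
  constructor
  · rintro (h1 | ⟨h1, h2⟩) (h3 | ⟨h3, h4⟩) <;> linarith
  · intro h1
    push Not at h1
    rcases lt_or_eq_of_le h1.1 with h2 | h2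
    · exact Or.inl h2
    · exact Or.inr ⟨h2, lt_of_le_of_ne (h1.2 h2) h⟩

theorem a_apos (i : Fin (n + 1)) : D.APos (D.a i) := by
  refine Fin.cases ?_ (fun j => ?_) i
  · exact Or.inl (mu_pos _ (ne_zero D.beta.2))
  · refine Or.inr ⟨rfl, ?_⟩
    rw [a_succ, D.based.ht]
    exact one_pos

/-- On `R^•` the positive roots are those which are positive for the lexicographic order. For the
lexicographically positive roots with positive constant term this uses that every root lies above
a negative multiple of `β`. -/
theorem isPos_iff {x : Z × ℝ} (hx : x ∈ D.Rb) : D.IsPos x ↔ D.APos x := by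
  have hβ0 := mu_pos D.kind (ne_zero D.beta.2)
  constructor
  · rintro ⟨c, hc⟩
    have h2 : x.2 = c 0 * mu D.kind (D.beta : Z) := by
      rw [hc, Fin.sum_univ_succ]
      simp [a_zero, a_succ, Prod.snd_sum]
    have h1 : x.1 = -(c 0 • (D.beta : Z)) + ∑ i : Fin n, c i.succ • D.α i := by
      rw [hc, Fin.sum_univ_succ]
      simp [a_zero, a_succ, Prod.fst_sum]
    rcases Nat.eq_zero_or_pos (c 0) with h0 | h0
    · refine Or.inr ⟨by rw [h2, h0]; simp, ?_⟩
      refine lt_of_le_of_ne ?_ (D.based.ht_ne_zero (Rb_fst hx)).symm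
      rw [h1, h0]
      simpa using D.based.ht_natsum_nonneg fun i => c i.succ
    · left
      rw [h2]
      have : (0 : ℝ) < c 0 := by exact_mod_cast h0
      positivity
  · intro hp
    obtain ⟨b, hb, m, rfl⟩ := hx
    have hb0 := mu_pos D.kind (ne_zero hb)
    have hmk : ∀ (N : ℕ) (d : Fin n → ℕ), (m : ℝ) * mu D.kind b = N * mu D.kind (D.beta : Z) →
        b + N • (D.beta : Z) = ∑ i, d i • D.α i → D.IsPos (b, m * mu D.kind b) := by
      intro N d h1 h2
      refine ⟨Fin.cons N d, ?_⟩
      rw [Fin.sum_univ_succ]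
      ext
      · simp [a_zero, a_succ, Prod.fst_sum, ← h2]
      · simp [a_zero, a_succ, Prod.snd_sum, h1]
    rcases hp with hp | ⟨hp, hp'⟩
    · obtain ⟨k, hk, hmu, d, hd⟩ := D.exists_beta_mul_le hb
      have hm : 0 < m := by
        have := pos_of_mul_pos_left hp hb0.le
        exact_mod_cast this
      lift m to ℕ using hm.le
      have hm' : 0 < m := by exact_mod_cast hm
      obtain ⟨e, he⟩ := D.based.exists_nat_coef D.beta.2 D.beta_pos
      refine hmk (m * k) (fun i => d i + ((m - 1) * k) * e i) ?_ ?_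
      · rw [hmu]
        push_cast
        ring
      · obtain ⟨l, rfl⟩ : ∃ l, m = l + 1 := ⟨m - 1, by omega⟩
        simp only [add_smul, Finset.sum_add_distrib, ← hd, mul_smul, ← Finset.smul_sum, ← he,
          Nat.add_sub_cancel, one_smul]
        module
    · have hm : (m : ℝ) = 0 := (mul_eq_zero.1 hp).resolve_right hb0.ne'
      obtain ⟨d, hd⟩ := D.based.exists_nat_coef hb hp'
      exact hmk 0 d (by rw [hm]; simp) (by simpa using hd)

/-- A simple reflection permutes the positive affine roots other than its own simple root. -/
theorem s_apos {x : Z × ℝ} (hx : x ∈ D.Rb) (hp : D.APos x) {i : Fin (n + 1)} (hi : x ≠ D.a i) :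
    D.APos ((D.s i).1 x) := by
  have hβ0 := mu_pos D.kind (ne_zero D.beta.2)
  by_contra hneg
  have hmem := W_mem_Rb (D.s i) hx
  obtain ⟨c, hc⟩ := (isPos_iff hx).2 hp
  obtain ⟨d, hd⟩ := (isPos_iff (neg_mem_Rb hmem)).2 ((apos_neg_iff hmem).2 hneg)
  set k := ⟪coroot (D.a i).1, x.1⟫ with hk
  -- `x + (-sᵢ x) = k aᵢ` and the simple affine roots are linearly independent
  have hsum : ∑ j, (((c j + d j : ℕ) : ℝ) - if j = i then k else 0) • D.a j = 0 := by
    have h1 : x + -((D.s i).1 x) = k • D.a i := by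
      rw [s_apply, ← hk]
      abel
    simp only [sub_smul, Finset.sum_sub_distrib, ite_smul, zero_smul, Finset.sum_ite_eq',
      Finset.mem_univ, if_true, Nat.cast_smul_eq_nsmul, add_smul, Finset.sum_add_distrib, ← hc,
      ← hd, ← h1, sub_self]
  have hind : ∀ t : Fin (n + 1) → ℝ, ∑ j, t j • D.a j = 0 → t = 0 := by
    intro t ht
    rw [Fin.sum_univ_succ] at ht
    have h2 := congrArg Prod.snd ht
    have h1 := congrArg Prod.fst ht
    simp only [a_zero, a_succ, Prod.snd_add, Prod.smul_snd, Prod.snd_sum, smul_eq_mul, mul_zero,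
      Finset.sum_const_zero, add_zero, Prod.snd_zero, Prod.fst_add, Prod.smul_fst, Prod.fst_sum,
      Prod.fst_zero] at h1 h2
    have h0 : t 0 = 0 := (mul_eq_zero.1 h2).resolve_right hβ0.ne'
    rw [h0, zero_smul, zero_add] at h1
    have h3 := Fintype.linearIndependent_iff.1 D.isBasis.linearIndependent _ h1
    funext j
    exact Fin.cases h0 h3 j
  have h0 := hind _ hsum
  have hcj : ∀ j, j ≠ i → c j = 0 := by
    intro j hj
    have := congrFun h0 j
    simp only [if_neg hj, sub_zero, Pi.zero_apply] at this
    have h2 : c j + d j = 0 := by exact_mod_cast this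
    omega
  have hxi : x = c i • D.a i := by
    rw [hc]
    exact Finset.sum_eq_single i (fun j _ hj => by rw [hcj j hj, zero_smul]) (by simp)
  have hx1 : x.1 = (c i : ℝ) • (D.a i).1 := by
    rw [hxi, Nat.cast_smul_eq_nsmul]
    rfl
  rcases D.isRootSystem.reduced _ (D.a_fst_mem i) (c i) (hx1 ▸ Rb_fst hx) with h1 | h1
  · have : c i = 1 := by exact_mod_cast h1
    exact hi (by rw [hxi, this, one_smul])
  · have : (0 : ℝ) ≤ c i := Nat.cast_nonneg _
    linarith

theorem eq_a_of_s_neg {x : Z × ℝ} (hx : x ∈ D.Rb) (hp : D.APos x) {i : Fin (n + 1)}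
    (h : ¬ D.APos ((D.s i).1 x)) : x = D.a i := by
  by_contra hne
  exact h (s_apos hx hp hne)

/-- The positive affine roots made negative by `w`. -/
def inv (w : D.W) : Set (Z × ℝ) := {x | x ∈ D.Rb ∧ D.APos x ∧ ¬ D.APos (w.1 x)}

theorem length_eq (w : D.W) : D.length w = (inv w).ncard := by
  rw [length]
  congr 1
  ext x
  simp only [Set.mem_ofPred_eq, inv]
  constructor
  · rintro ⟨hx, h1, h2⟩
    have hm := W_mem_Rb w hx
    exact ⟨hx, (isPos_iff hx).1 h1, (apos_neg_iff hm).1 ((isPos_iff (neg_mem_Rb hm)).1 h2)⟩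
  · rintro ⟨hx, h1, h2⟩
    have hm := W_mem_Rb w hx
    exact ⟨hx, (isPos_iff hx).2 h1, (isPos_iff (neg_mem_Rb hm)).2 ((apos_neg_iff hm).2 h2)⟩

theorem finite_inv (w : D.W) : (inv w).Finite := by
  have hfin : ∀ b ∈ D.R₀, {x | x ∈ inv w ∧ x.1 = b}.Finite := by
    intro b hb
    have hb0 := mu_pos D.kind (ne_zero hb)
    obtain ⟨N, hN⟩ := exists_int_gt (⟪D.lin w b, (D.tr w : Z)⟫ / mu D.kind b)
    refine ((Set.finite_Icc (0 : ℤ) N).image fun m : ℤ => (b, (m : ℝ) * mu D.kind b)).subset ?_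
    rintro x ⟨⟨hx, hp, hn⟩, rfl⟩
    obtain ⟨m, hm⟩ := Rb_snd hx
    obtain ⟨b', r⟩ := x
    dsimp only at hm hb0 hN
    subst hm
    refine ⟨m, ⟨?_, ?_⟩, rfl⟩
    · have h0 : 0 ≤ (m : ℝ) * mu D.kind b' := by
        rcases hp with h | h
        · exact h.le
        · exact h.1.ge
      have := nonneg_of_mul_nonneg_left h0 hb0
      exact_mod_cast this
    · rw [D.apply_eq w] at hn
      have h0 : (m : ℝ) * mu D.kind b' ≤ ⟪D.lin w b', (D.tr w : Z)⟫ := by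
        by_contra hcon
        exact hn (Or.inl (by dsimp only; linarith))
      rw [← le_div_iff₀ hb0] at h0
      exact_mod_cast (h0.trans hN.le)
  refine (D.isRootSystem.finite.biUnion hfin).subset fun x hx => ?_
  exact Set.mem_biUnion (Rb_fst hx.1) ⟨hx, rfl⟩

theorem length_eq_zero_iff (w : D.W) :
    D.length w = 0 ↔ ∀ x ∈ D.Rb, D.APos x → D.APos (w.1 x) := by
  rw [length_eq, Set.ncard_eq_zero (finite_inv w), Set.eq_empty_iff_forall_notMem]
  constructor
  · intro h x hx hp
    by_contra hn
    exact h x ⟨hx, hp, hn⟩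
  · rintro h x ⟨hx, hp, hn⟩
    exact hn (h x hx hp)

/-- Lengths add for the product `v w` if and only if `v` keeps negative the positive roots made
negative by `w`. -/
theorem length_mul_iff (v w : D.W) : D.length (v * w) = D.length v + D.length w ↔
    ∀ x ∈ D.Rb, D.APos x → ¬ D.APos (w.1 x) → ¬ D.APos (v.1 (w.1 x)) := by
  set A : Set (Z × ℝ) := {x | x ∈ inv (v * w) ∧ D.APos (w.1 x)} with hA
  set B : Set (Z × ℝ) := {x | x ∈ inv (v * w) ∧ ¬ D.APos (w.1 x)} with hB
  set C : Set (Z × ℝ) := {x | x ∈ inv w ∧ D.APos (v.1 (w.1 x))} with hC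
  have fA : A.Finite := (finite_inv (v * w)).subset fun x hx => hx.1
  have fB : B.Finite := (finite_inv (v * w)).subset fun x hx => hx.1
  have fC : C.Finite := (finite_inv w).subset fun x hx => hx.1
  have e1 : (inv (v * w)).ncard = A.ncard + B.ncard := by
    rw [← Set.ncard_union_eq _ fA fB]
    · congr 1
      ext x
      by_cases h : D.APos (w.1 x) <;> simp [hA, hB, h]
    · exact Set.disjoint_left.2 fun x h1 h2 => h2.2 h1.2
  have e2 : (inv w).ncard = B.ncard + C.ncard := by
    rw [← Set.ncard_union_eq _ fB fC]
    · congr 1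
      ext x
      simp only [hB, hC, Set.mem_union, Set.mem_ofPred_eq, inv, W_mul_apply]
      by_cases h : D.APos (v.1 (w.1 x)) <;> simp only [h] <;> tauto
    · exact Set.disjoint_left.2 fun x h1 h2 => h1.1.2.2 h2.2
  have e3 : (inv v).ncard = A.ncard + C.ncard := by
    have hinj : Function.Injective fun x : Z × ℝ => w.1 x := w.1.injective
    have hinj' : Function.Injective fun x : Z × ℝ => -(w.1 x) :=
      neg_injective.comp w.1.injective
    rw [← Set.ncard_image_of_injective A hinj, ← Set.ncard_image_of_injective C hinj',
      ← Set.ncard_union_eq _ (fA.image _) (fC.image _)]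
    · congr 1
      ext y
      constructor
      · rintro ⟨hy, hp, hn⟩
        have hm := W_mem_Rb w⁻¹ hy
        have hw := W_apply_inv_apply w y
        by_cases hx : D.APos ((w⁻¹).1 y)
        · refine Or.inl ⟨(w⁻¹).1 y, ⟨⟨hm, hx, ?_⟩, ?_⟩, hw⟩
          · rwa [W_mul_apply, hw]
          · rwa [hw]
        · refine Or.inr ⟨-(w⁻¹).1 y, ⟨⟨neg_mem_Rb hm, (apos_neg_iff hm).2 hx, ?_⟩, ?_⟩, ?_⟩
          · rw [map_neg, hw, apos_neg_iff hy]
            exact fun h => h hp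
          · rw [map_neg, hw, map_neg, apos_neg_iff (W_mem_Rb v hy)]
            exact hn
          · dsimp only
            rw [map_neg, hw, neg_neg]
      · rintro (⟨x, ⟨⟨hx, hp, hn⟩, h⟩, rfl⟩ | ⟨x, ⟨⟨hx, hp, hn⟩, h⟩, rfl⟩)
        · exact ⟨W_mem_Rb w hx, h, hn⟩
        · have hm := W_mem_Rb w hx
          refine ⟨neg_mem_Rb hm, (apos_neg_iff hm).2 hn, ?_⟩
          rw [map_neg, apos_neg_iff (W_mem_Rb v hm)]
          exact fun h' => h' h
    · rw [Set.disjoint_left]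
      rintro _ ⟨x, ⟨⟨hx, hp, hn⟩, h⟩, rfl⟩ ⟨y, ⟨⟨hy, hp', hn'⟩, h'⟩, he⟩
      have : y = -x := by
        apply w.1.injective
        rw [map_neg]
        exact neg_eq_iff_eq_neg.1 he
      rw [this, apos_neg_iff hx] at hp'
      exact hp' hp
  have e4 : D.length (v * w) = D.length v + D.length w ↔ C.ncard = 0 := by
    rw [length_eq, length_eq, length_eq, e1, e2, e3]
    omega
  rw [e4, Set.ncard_eq_zero fC, Set.eq_empty_iff_forall_notMem]
  constructor
  · exact fun h x hx hp hn hc => h x ⟨⟨hx, hp, hn⟩, hc⟩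
  · rintro h x ⟨⟨hx, hp, hn⟩, hc⟩
    exact h x hx hp hn hc

theorem length_s_pos (i : Fin (n + 1)) : 0 < D.length (D.s i) := by
  rw [Nat.pos_iff_ne_zero, Ne, length_eq_zero_iff]
  intro h
  have := h _ (D.a_mem_Rb i) (a_apos i)
  rw [s_a, apos_neg_iff (D.a_mem_Rb i)] at this
  exact this (a_apos i)

/-- If `w` is not of length zero, then it makes some simple affine root negative. -/
theorem exists_simple_inv {w : D.W} (h : D.length w ≠ 0) : ∃ i, ¬ D.APos (w.1 (D.a i)) := by
  by_contra hcon
  push Not at hcon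
  refine h ((length_eq_zero_iff w).2 fun x hx hp => ?_)
  obtain ⟨c, rfl⟩ := (isPos_iff hx).2 hp
  have hm := W_mem_Rb w hx
  have h2 : ∀ i, 0 ≤ (w.1 (D.a i)).2 := fun i => by
    rcases hcon i with h | h
    · exact h.le
    · exact h.1.ge
  rw [map_sum] at hm ⊢
  simp only [map_nsmul] at hm ⊢
  have hs2 : (∑ i, c i • w.1 (D.a i)).2 = ∑ i, (c i : ℝ) * (w.1 (D.a i)).2 := by
    simp [Prod.snd_sum]
  have hs1 : (∑ i, c i • w.1 (D.a i)).1 = ∑ i, (c i : ℝ) • (w.1 (D.a i)).1 := by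
    simp [Prod.fst_sum, Nat.cast_smul_eq_nsmul]
  have hnn : ∀ i ∈ Finset.univ, 0 ≤ (c i : ℝ) * (w.1 (D.a i)).2 := fun i _ =>
    mul_nonneg (Nat.cast_nonneg _) (h2 i)
  have h0 := Finset.sum_nonneg hnn
  rcases lt_or_eq_of_le h0 with h3 | h3
  · exact Or.inl (hs2 ▸ h3)
  · refine Or.inr ⟨by rw [hs2, ← h3], lt_of_le_of_ne ?_ (D.based.ht_ne_zero (Rb_fst hm)).symm⟩
    rw [hs1, inner_sum]
    refine Finset.sum_nonneg fun i hi => ?_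
    rw [inner_smul_right]
    have h4 := (Finset.sum_eq_zero_iff_of_nonneg hnn).1 h3.symm i hi
    rcases hcon i with h5 | h5
    · rcases mul_eq_zero.1 h4 with h6 | h6
      · rw [h6, zero_mul]
      · linarith
    · exact mul_nonneg (Nat.cast_nonneg _) h5.2.le

/-- Left multiplication by `sᵢ` adds one to the length of `w` if `w⁻¹ aᵢ` is positive. -/
theorem length_s_mul {w : D.W} {i : Fin (n + 1)} (h : D.APos ((w⁻¹).1 (D.a i))) :
    D.length (D.s i * w) = D.length (D.s i) + D.length w := by
  rw [length_mul_iff]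
  intro x hx hp hn hc
  have hm := W_mem_Rb w hx
  have h1 : -(w.1 x) = D.a i := by
    refine eq_a_of_s_neg (neg_mem_Rb hm) ((apos_neg_iff hm).2 hn) ?_
    rw [map_neg, apos_neg_iff (W_mem_Rb _ hm)]
    exact fun h => h hc
  rw [← h1, map_neg, W_inv_apply_apply, apos_neg_iff hx] at h
  exact h hp

/-- Induction on the length in `W`. -/
theorem W_induction {P : D.W → Prop} (zero : ∀ w, D.length w = 0 → P w)
    (step : ∀ w i, D.APos ((w⁻¹).1 (D.a i)) → P w → P (D.s i * w)) (w : D.W) : P w := by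
  induction hk : D.length w using Nat.strong_induction_on generalizing w with
  | _ k ih =>
    by_cases h0 : D.length w = 0
    · exact zero w h0
    · have h0' : D.length w⁻¹ ≠ 0 := by
        intro h
        refine h0 ((length_eq_zero_iff w).2 fun x hx hp => ?_)
        by_contra hn
        have hm := W_mem_Rb w hx
        have h1 := (length_eq_zero_iff _).1 h _ (neg_mem_Rb hm) ((apos_neg_iff hm).2 hn)
        rw [map_neg, W_inv_apply_apply, apos_neg_iff hx] at h1
        exact h1 hp
      obtain ⟨i, hi⟩ := exists_simple_inv h0'
      have hm := W_mem_Rb w⁻¹ (D.a_mem_Rb i)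
      have h1 : D.APos (((D.s i * w)⁻¹).1 (D.a i)) := by
        rw [mul_inv_rev, W_mul_apply, s_inv, s_a, map_neg, apos_neg_iff hm]
        exact hi
      have h2 := length_s_mul h1
      have h3 := length_s_pos (D := D) i
      rw [← mul_assoc, s_mul_self, one_mul] at h2
      have := step _ i h1 (ih _ (by omega) (D.s i * w) rfl)
      rwa [← mul_assoc, s_mul_self, one_mul] at this

end InitialData

/-! ### The Bernstein presentation -/

namespace InitialData

variable {Z : Type*} [NormedAddCommGroup Z] [InnerProductSpace ℝ Z] [FiniteDimensional ℝ Z] {n : ℕ}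

/-- Lengths add for the product `v w` in the finite Weyl group: `v` keeps negative the positive
roots made negative by `w`. -/
def FinAdd (D : InitialData Z n) (v w : Z ≃ₗᵢ[ℝ] Z) : Prop :=
  ∀ b ∈ D.R₀, 0 < ⟪D.rho, b⟫ → ⟪D.rho, w b⟫ < 0 → ⟪D.rho, v (w b)⟫ < 0

/-- Elements `T_v` (`v` in the finite Weyl group) and `Y^ξ` of a group satisfying the relations of
the Bernstein presentation of the extended affine braid group. -/
structure BernsteinData (D : InitialData Z n) (G : Type*) [Group G] where
  T : (Z ≃ₗᵢ[ℝ] Z) → G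
  Y : D.LamD → G
  T_mul : ∀ v ∈ weyl D.R₀, ∀ w ∈ weyl D.R₀, D.FinAdd v w → T (v * w) = T v * T w
  Y_add : ∀ ξ η, Y (ξ + η) = Y ξ * Y η
  comm : ∀ i (ξ : D.LamD), ⟪(ξ : Z), coroot (dualRoot D.kind (D.α i))⟫ = 0 →
    T (sref (D.α i)) * Y ξ = Y ξ * T (sref (D.α i))
  cross : ∀ i (ξ η : D.LamD), ⟪(ξ : Z), coroot (dualRoot D.kind (D.α i))⟫ = 1 →
    (η : Z) = sref (D.α i) ξ → T (sref (D.α i)) * Y η * T (sref (D.α i)) = Y ξ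

variable {D : InitialData Z n}

theorem inv_apply_eq (g : D.W) (x : Z × ℝ) :
    (g⁻¹).1 x = ((D.lin g)⁻¹ x.1, x.2 + ⟪x.1, (D.tr g : Z)⟫) := by
  have h1 : g.1 ((D.lin g)⁻¹ x.1, x.2 + ⟪x.1, (D.tr g : Z)⟫) = x := by
    have e : D.lin g ((D.lin g)⁻¹ x.1) = x.1 := by rw [← isom_mul_apply, mul_inv_cancel]; rfl
    rw [D.apply_eq g]
    dsimp only
    rw [e]
    ext <;> simp
  conv_lhs => rw [← h1]
  rw [W_inv_apply_apply]

/-- The chamber of `u` is on the negative side of all walls separating the fundamental alcove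
from its image under `w`. -/
def Good (u : Z ≃ₗᵢ[ℝ] Z) (w : D.W) : Prop :=
  ∀ x ∈ D.Rb, D.APos x → ¬ D.APos ((w⁻¹).1 x) → ⟪D.rho, u x.1⟫ < 0

/-- Positive affine roots are positive functions at interior points of the fundamental alcove. -/
theorem exists_alcove_point (D : InitialData Z n) :
    ∃ y : Z, ∀ x ∈ D.Rb, D.APos x → 0 < ⟪x.1, y⟫ + x.2 := by
  obtain ⟨M, hM⟩ := (D.isRootSystem.finite.image
    fun b => |⟪D.rho, b⟫| / mu D.kind b).bddAbove
  have hM0 : (0 : ℝ) < |M| + 1 := by positivity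
  refine ⟨(1 / (|M| + 1)) • D.rho, fun x hx hp => ?_⟩
  have hb := Rb_fst hx
  have hb0 := mu_pos D.kind (ne_zero hb)
  rw [inner_smul_right, real_inner_comm]
  rcases hp with hp | ⟨hp, hp'⟩
  · obtain ⟨m, hm⟩ := Rb_snd hx
    rw [hm] at hp ⊢
    have hm1 : (1 : ℝ) ≤ m := by
      have h0 : (0 : ℝ) < m := pos_of_mul_pos_left hp hb0.le
      have : 0 < m := by exact_mod_cast h0
      exact_mod_cast this
    have h1 : |⟪D.rho, x.1⟫| / mu D.kind x.1 ≤ M := hM ⟨_, hb, rfl⟩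
    have h2 : |⟪D.rho, x.1⟫| ≤ |M| * mu D.kind x.1 :=
      (div_le_iff₀ hb0).1 (h1.trans (le_abs_self M))
    have h3 := neg_abs_le ⟪D.rho, x.1⟫
    have h4 : (|M| + 1) * (1 / (|M| + 1)) = 1 := by field_simp
    have h5 : 0 < 1 / (|M| + 1) := by positivity
    have h6 : -(1 / (|M| + 1) * (|M| * mu D.kind x.1)) ≤ 1 / (|M| + 1) * ⟪D.rho, x.1⟫ := by
      rw [← mul_neg]
      exact mul_le_mul_of_nonneg_left (by linarith) h5.le
    have h7 : 1 / (|M| + 1) * (|M| * mu D.kind x.1) < mu D.kind x.1 := by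
      have : 1 / (|M| + 1) * (|M| * mu D.kind x.1) =
          mu D.kind x.1 - 1 / (|M| + 1) * mu D.kind x.1 := by
        field_simp
        ring
      rw [this]
      have := mul_pos h5 hb0
      linarith
    have h8 := mul_le_mul_of_nonneg_right hm1 hb0.le
    linarith
  · rw [hp, add_zero]
    positivity

/-- Every `w ∈ W` admits a good `u`: take for the chamber one in the direction of the displacement
of an interior point of the fundamental alcove under `w`. -/
theorem exists_good (w : D.W) : ∃ u ∈ weyl D.R₀, Good u w := by
  obtain ⟨y, hy⟩ := D.exists_alcove_point
  obtain ⟨u, hu, hdom⟩ := D.based.exists_weyl_dominant (D.lin w y + D.tr w - y)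
  refine ⟨u, hu, fun x hx hp hn => ?_⟩
  have hm := W_mem_Rb w⁻¹ hx
  have h1 := hy x hx hp
  have h2 := hy _ (neg_mem_Rb hm) ((apos_neg_iff hm).2 hn)
  have e : ⟪(D.lin w)⁻¹ x.1, y⟫ = ⟪x.1, D.lin w y⟫ := by
    rw [← (D.lin w).inner_map_map, ← isom_mul_apply, mul_inv_cancel]
    rfl
  rw [inv_apply_eq] at h2
  simp only [Prod.fst_neg, Prod.snd_neg, inner_neg_left, e] at h2
  refine D.based.neg_of_dom_inner_neg hdom (weyl_mem hu (Rb_fst hx)) ?_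
  rw [u.inner_map_map, inner_sub_left, inner_add_left, real_inner_comm x.1,
    real_inner_comm x.1, real_inner_comm x.1]
  linarith

/-- `l(v sᵢ) = l(v) + 1` if `v αᵢ` is positive. -/
theorem finAdd_simple {v : Z ≃ₗᵢ[ℝ] Z} {i : Fin n} (h : 0 < ⟪D.rho, v (D.α i)⟫) :
    D.FinAdd v (sref (D.α i)) := by
  intro b hb hp hn
  have : b = D.α i := by
    by_contra hne
    linarith [D.based.sref_pos hb hp hne]
  rw [this, sref_self (D.based.simple_ne_zero i), map_neg, inner_neg_right]
  linarith

/-- If the chambers of `u` and `z u` are good for `w` and `l(z sᵢ) < l(z)`, then so is the chamber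
of `sᵢ u`, which is adjacent to that of `u` and closer to that of `z u`. -/
theorem good_simple_mul {u z : Z ≃ₗᵢ[ℝ] Z} {w : D.W} (hu : u ∈ weyl D.R₀) {i : Fin n}
    (hz : ⟪D.rho, z (D.α i)⟫ < 0) (h1 : Good u w) (h2 : Good (z * u) w) :
    Good (sref (D.α i) * u) w := by
  intro x hx hp hn
  have hm := weyl_mem hu (Rb_fst hx)
  have h3 := h1 x hx hp hn
  have h4 := h2 x hx hp hn
  have hne : -(u x.1) ≠ D.α i := by
    intro he
    rw [← he, map_neg, inner_neg_right] at hz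
    rw [isom_mul_apply] at h4
    linarith
  have := D.based.sref_pos (D.neg_mem hm) (by rw [inner_neg_right]; linarith) hne
  rw [map_neg, inner_neg_right] at this
  rw [isom_mul_apply]
  linarith

namespace BernsteinData

variable {G : Type*} [Group G] (B : BernsteinData D G)

theorem T_one : B.T 1 = 1 := by
  have := B.T_mul 1 (one_mem _) 1 (one_mem _) (fun b _ _ h => h)
  rw [mul_one] at this
  exact left_eq_mul.1 this

theorem Y_zero : B.Y 0 = 1 := by
  have := B.Y_add 0 0
  rw [add_zero] at this
  exact left_eq_mul.1 this

theorem T_mul_simple {v : Z ≃ₗᵢ[ℝ] Z} (hv : v ∈ weyl D.R₀) {i : Fin n}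
    (h : 0 < ⟪D.rho, v (D.α i)⟫) : B.T (v * sref (D.α i)) = B.T v * B.T (sref (D.α i)) :=
  B.T_mul v hv _ (D.based.simple_mem_weyl i) (finAdd_simple h)

/-- `E(τ(ξ) v) = Y^ξ T_{v⁻¹}⁻¹`: the value of `T_{τ(ζ)}⁻¹ T_{τ(ζ) w}` for `ζ` deep in the dominant
chamber, that is, the element of the braid group given by a gallery from the fundamental alcove to
its image under `w` whose crossings are oriented by the dominant chamber. -/
def E (w : D.W) : G := B.Y (D.tr w) * (B.T (D.lin w)⁻¹)⁻¹

theorem E_emb {u : Z ≃ₗᵢ[ℝ] Z} (hu : u ∈ weyl D.R₀) : B.E (D.emb u) = (B.T u⁻¹)⁻¹ := by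
  rw [E, (lin_tr_emb hu).1, (lin_tr_emb hu).2, B.Y_zero, one_mul]

theorem E_one : B.E 1 = 1 := by
  rw [← emb_one, B.E_emb (one_mem _), inv_one, B.T_one, inv_one]

theorem E_tau_mul (ξ : D.LamD) (w : D.W) : B.E (D.tau ξ * w) = B.Y ξ * B.E w := by
  have h : D.tr (D.tau ξ * w) = ξ + D.tr w := by
    apply Subtype.ext
    rw [tr_mul, (lin_tr_tau ξ).1, (lin_tr_tau ξ).2]
    rfl
  rw [E, h, lin_mul, (lin_tr_tau ξ).1, one_mul, B.Y_add, mul_assoc]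
  rfl

theorem E_tau (ξ : D.LamD) : B.E (D.tau ξ) = B.Y ξ := by
  rw [← mul_one (D.tau ξ), B.E_tau_mul, B.E_one, mul_one]

/-- `P_g(w) = E(g)⁻¹ E(g w)`: the element given by a gallery from the fundamental alcove to its
image under `w` whose crossings are oriented by the chamber of the finite part of `g`. -/
def P (g w : D.W) : G := (B.E g)⁻¹ * B.E (g * w)

theorem P_mul (g v w : D.W) : B.P g (v * w) = B.P g v * B.P (g * v) w := by
  simp only [P, mul_assoc, mul_inv_cancel_left]

theorem P_tau_mul (ξ : D.LamD) (g w : D.W) : B.P (D.tau ξ * g) w = B.P g w := by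
  simp only [P, mul_assoc, B.E_tau_mul, mul_inv_rev, inv_mul_cancel_left]

/-- `P_g` depends on the finite part of `g` only. -/
theorem P_eq_lin (g w : D.W) : B.P g w = B.P (D.emb (D.lin g)) w := by
  conv_lhs => rw [← tau_mul_emb g, B.P_tau_mul]

/-- Two adjacent good chambers give the same element. No wall parallel to their common wall
separates the fundamental alcove from its image under `w`, so the translation part of `u w` pairs
to `0` or `1` with `(αᵢ^d)^∨`; in these two cases the assertion is the commutation relation and the
cross relation, respectively. -/
theorem P_simple_mul_aux {u : Z ≃ₗᵢ[ℝ] Z} (hu : u ∈ weyl D.R₀) {w : D.W} {i : Fin n}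
    (hpos : 0 < ⟪D.rho, u⁻¹ (D.α i)⟫) (h1 : Good u w) (h2 : Good (sref (D.α i) * u) w) :
    B.P (D.emb u) w = B.P (D.emb (sref (D.α i) * u)) w := by
  have hs := D.based.simple_mem_weyl i
  have hα := D.isBasis.mem i
  set g := D.emb u * w with hg
  set v := D.lin g with hv
  have hvm : v ∈ weyl D.R₀ := D.lin_mem g
  set γ := u⁻¹ (D.α i) with hγ
  have hγm : γ ∈ D.R₀ := weyl_mem (inv_mem hu) hα
  have huγ : u γ = D.α i := by rw [hγ, ← isom_mul_apply, mul_inv_cancel]; rfl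
  have hμ := mu_pos D.kind (ne_zero hα)
  have hμγ : mu D.kind γ = mu D.kind (D.α i) := mu_map _ _ _
  -- no wall orthogonal to `γ` separates the fundamental alcove from its image under `w`
  have ha1 : D.APos ((w⁻¹).1 (γ, (0 : ℝ))) := by
    by_contra hn
    have := h1 _ (mk_zero_mem_Rb hγm) (Or.inr ⟨rfl, hpos⟩) hn
    rw [huγ, D.based.ht] at this
    linarith
  have ha2 : D.APos ((w⁻¹).1 (-γ, mu D.kind (-γ))) := by
    by_contra hn
    have := h2 _ (mk_mu_mem_Rb (D.neg_mem hγm)) (Or.inl (mu_pos _ (ne_zero (D.neg_mem hγm)))) hn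
    rw [isom_mul_apply, map_neg, huγ, map_neg, sref_self (D.based.simple_ne_zero i), neg_neg,
      D.based.ht] at this
    linarith
  have hw : ∀ x, (w⁻¹).1 x = (g⁻¹).1 (u x.1, x.2) := by
    intro x
    rw [hg, mul_inv_rev, W_mul_apply, ← emb_apply hu, W_inv_apply_apply]
  rw [hw, huγ, inv_apply_eq] at ha1
  rw [hw, map_neg, huγ, mu_neg, hμγ, inv_apply_eq] at ha2
  obtain ⟨k, hk⟩ := D.inner_coroot_dualRoot_int _ (D.tr g).2 _ hα
  have hin : ⟪D.α i, (D.tr g : Z)⟫ = k * mu D.kind (D.α i) := by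
    rw [real_inner_comm, inner_eq_mu_mul D.kind (ne_zero hα), hk, mul_comm]
  simp only [APos, map_neg, inner_neg_left, inner_neg_right, hin, zero_add, ← hv] at ha1 ha2
  -- both products in terms of `v` and the translation part of `g`
  have hT : B.T ((sref (D.α i) * u)⁻¹) = B.T u⁻¹ * B.T (sref (D.α i)) := by
    rw [mul_inv_rev, sref_inv]
    exact B.T_mul_simple (inv_mem hu) hpos
  have hg' : D.emb (sref (D.α i) * u) * w = D.emb (sref (D.α i)) * g := by
    rw [emb_mul hs hu, mul_assoc]
  have hlin : D.lin (D.emb (sref (D.α i)) * g) = sref (D.α i) * v := by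
    rw [lin_mul, (lin_tr_emb hs).1]
  have htr : (D.tr (D.emb (sref (D.α i)) * g) : Z) = sref (D.α i) (D.tr g) := by
    rw [tr_mul, (lin_tr_emb hs).1, (lin_tr_emb hs).2]
    simp
  rw [P, P, B.E_emb hu, B.E_emb (mul_mem hs hu), inv_inv, inv_inv, hT, hg', mul_assoc]
  congr 1
  rw [E, E, hlin, ← hv, mul_inv_rev, sref_inv]
  have hk01 : k = 0 ∨ k = 1 := by
    have h0 : 0 ≤ k := by
      by_contra hc
      have : (k : ℝ) < 0 := by exact_mod_cast not_le.1 hc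
      have := mul_neg_of_neg_of_pos this hμ
      rcases ha1 with h | h <;> linarith
    have h1 : k ≤ 1 := by
      by_contra hc
      have : (1 : ℝ) < k := by exact_mod_cast not_le.1 hc
      have := mul_lt_mul_of_pos_right this hμ
      rcases ha2 with h | h <;> linarith
    omega
  rcases hk01 with rfl | rfl
  · have hvp : 0 < ⟪D.rho, v⁻¹ (D.α i)⟫ := by
      rcases ha1 with h | h
      · simp at h
      · exact h.2
    have htr' : D.tr (D.emb (sref (D.α i)) * g) = D.tr g := by
      apply Subtype.ext
      rw [htr, ← sref_dualRoot D.kind (ne_zero hα), sref_apply, hk]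
      simp
    rw [htr', B.T_mul_simple (inv_mem hvm) hvp, mul_inv_rev, ← mul_assoc, ← mul_assoc,
      B.comm i _ (by rw [hk]; simp), mul_assoc (B.Y _), mul_inv_cancel, mul_one]
  · have hvp : 0 < ⟪D.rho, (v⁻¹ * sref (D.α i)) (D.α i)⟫ := by
      rw [isom_mul_apply, sref_self (D.based.simple_ne_zero i), map_neg, inner_neg_right]
      rcases ha2 with h | h
      · simp at h
      · exact h.2
    have h3 := B.T_mul_simple (mul_mem (inv_mem hvm) hs) hvp
    rw [mul_assoc, sref_mul_self, mul_one] at h3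
    rw [← B.cross i (D.tr g) _ (by rw [hk]; simp) htr, h3]
    group

theorem P_simple_mul {u : Z ≃ₗᵢ[ℝ] Z} (hu : u ∈ weyl D.R₀) {w : D.W} {i : Fin n}
    (h1 : Good u w) (h2 : Good (sref (D.α i) * u) w) :
    B.P (D.emb u) w = B.P (D.emb (sref (D.α i) * u)) w := by
  have hs := D.based.simple_mem_weyl i
  by_cases hpos : 0 < ⟪D.rho, u⁻¹ (D.α i)⟫
  · exact B.P_simple_mul_aux hu hpos h1 h2
  · have hss : sref (D.α i) * (sref (D.α i) * u) = u := by
      rw [← mul_assoc, sref_mul_self, one_mul]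
    have := B.P_simple_mul_aux (u := sref (D.α i) * u) (mul_mem hs hu) (w := w) (i := i) ?_ h2
      (by rwa [hss])
    · rw [this, hss]
    · rw [mul_inv_rev, sref_inv, isom_mul_apply, sref_self (D.based.simple_ne_zero i), map_neg,
        inner_neg_right]
      have := D.based.ht_neg (weyl_mem (inv_mem hu) (D.isBasis.mem i)) hpos
      linarith

/-- `P_u(w)` does not depend on the choice of a good `u`: the good chambers form a convex set, so
two of them are connected by a gallery of good chambers. -/
theorem P_eq_of_good {u u' : Z ≃ₗᵢ[ℝ] Z} (hu : u ∈ weyl D.R₀) (hu' : u' ∈ weyl D.R₀) {w : D.W}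
    (h : Good u w) (h' : Good u' w) : B.P (D.emb u) w = B.P (D.emb u') w := by
  have key : ∀ z ∈ weyl D.R₀, ∀ u ∈ weyl D.R₀, Good u w → Good (z * u) w →
      B.P (D.emb u) w = B.P (D.emb (z * u)) w := by
    intro z hz
    refine D.based.weyl_induction (P := fun z => ∀ u ∈ weyl D.R₀, Good u w → Good (z * u) w →
      B.P (D.emb u) w = B.P (D.emb (z * u)) w) ?_ ?_ hz
    · intro u _ _ _
      rw [one_mul]
    · intro v hv i hi ih u hu h1 h2
      have h3 := good_simple_mul hu hi h1 h2
      have e : v * sref (D.α i) * (sref (D.α i) * u) = v * u := by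
        rw [mul_assoc, ← mul_assoc (sref _) (sref _), sref_mul_self, one_mul]
      have h4 := ih _ (mul_mem (D.based.simple_mem_weyl i) hu) h3 (by rwa [e])
      rw [B.P_simple_mul hu h1 h3, h4, e]
  have := key (u' * u⁻¹) (mul_mem hu' (inv_mem hu)) u hu h (by rwa [inv_mul_cancel_right])
  rwa [inv_mul_cancel_right] at this

/-- The image of `T_w`. -/
def Tval (w : D.W) : G := B.P (D.emb (exists_good w).choose) w

theorem Tval_eq {u : Z ≃ₗᵢ[ℝ] Z} (hu : u ∈ weyl D.R₀) {w : D.W} (h : Good u w) :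
    B.Tval w = B.P (D.emb u) w :=
  B.P_eq_of_good (exists_good w).choose_spec.1 hu (exists_good w).choose_spec.2 h

/-- A chamber which is good for a product `v w` with `l(v w) = l(v) + l(w)` is good for `v`, and
its translate by `v` is good for `w`. -/
theorem Tval_mul {v w : D.W} (h : D.length (v * w) = D.length v + D.length w) :
    B.Tval (v * w) = B.Tval v * B.Tval w := by
  rw [length_mul_iff] at h
  obtain ⟨u, hu, hg⟩ := exists_good (v * w)
  have key : ∀ x ∈ D.Rb, D.APos x → ¬ D.APos ((w⁻¹).1 x) → D.APos (v.1 x) := by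
    intro x hx hp hn
    have hm := W_mem_Rb w⁻¹ hx
    have h1 := h _ (neg_mem_Rb hm) ((apos_neg_iff hm).2 hn)
    rw [map_neg, W_apply_inv_apply, apos_neg_iff hx, map_neg, apos_neg_iff (W_mem_Rb v hx)] at h1
    exact not_not.1 (h1 (not_not.2 hp))
  have hgv : Good u v := by
    intro x hx hp hn
    refine hg x hx hp fun hc => ?_
    have hm := W_mem_Rb v⁻¹ hx
    rw [mul_inv_rev, W_mul_apply] at hc
    have h1 := key _ (neg_mem_Rb hm) ((apos_neg_iff hm).2 hn) (by
      rw [map_neg, apos_neg_iff (W_mem_Rb _ hm)]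
      exact not_not.2 hc)
    rw [map_neg, W_apply_inv_apply, apos_neg_iff hx] at h1
    exact h1 hp
  have hgw : Good (u * D.lin v) w := by
    intro x hx hp hn
    have h1 := hg _ (W_mem_Rb v hx) (key x hx hp hn) (by
      rwa [mul_inv_rev, W_mul_apply, W_inv_apply_apply])
    rwa [D.apply_eq v] at h1
  rw [B.Tval_eq hu hg, B.Tval_eq hu hgv, B.Tval_eq (mul_mem hu (D.lin_mem v)) hgw, B.P_mul]
  congr 1
  rw [B.P_eq_lin, lin_mul, (lin_tr_emb hu).1]

/-- The Bernstein presentation: elements satisfying the Bernstein relations define a homomorphism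
from the extended affine braid group. -/
def lift : D.Braid →* G :=
  PresentedGroup.toGroup (f := B.Tval) (by
    rintro _ ⟨v, w, h, rfl⟩
    rw [map_mul, map_mul, map_inv, FreeGroup.lift_apply_of, FreeGroup.lift_apply_of,
      FreeGroup.lift_apply_of, B.Tval_mul h, mul_inv_cancel])

theorem lift_Tw {u : Z ≃ₗᵢ[ℝ] Z} (hu : u ∈ weyl D.R₀) {w : D.W} (h : Good u w) :
    B.lift (D.Tw w) = B.P (D.emb u) w := by
  rw [← B.Tval_eq hu h]
  exact PresentedGroup.toGroup.of _

theorem lift_Tw_one {w : D.W} (h : Good (1 : Z ≃ₗᵢ[ℝ] Z) w) : B.lift (D.Tw w) = B.E w := by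
  rw [B.lift_Tw (one_mem _) h, P, emb_one, one_mul, B.E_one, inv_one, one_mul]

end BernsteinData

/-- For `v` in the finite Weyl group the chamber of `v⁻¹` is good. -/
theorem good_emb {v : Z ≃ₗᵢ[ℝ] Z} (hv : v ∈ weyl D.R₀) : Good v⁻¹ (D.emb v) := by
  intro x hx hp hn
  rw [← emb_inv hv, emb_apply (inv_mem hv)] at hn
  have hm := weyl_mem (inv_mem hv) (Rb_fst hx)
  refine D.based.ht_neg hm fun hc => hn ?_
  rcases hp with hp | hp
  · exact Or.inl hp
  · exact Or.inr ⟨hp.1, hc⟩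

theorem domLE_zero_iff {b : Z} (hb : b ∈ D.R₀) : D.DomLE 0 b ↔ 0 < ⟪D.rho, b⟫ := by
  rw [DomLE, sub_zero]
  constructor
  · rintro ⟨c, hc⟩
    refine lt_of_le_of_ne ?_ (D.based.ht_ne_zero hb).symm
    rw [hc]
    exact D.based.ht_natsum_nonneg c
  · exact fun h => D.based.exists_nat_coef hb h

theorem isDominant_iff (ξ : D.LamD) :
    D.IsDominant ξ ↔ ∀ b ∈ D.R₀, 0 < ⟪D.rho, b⟫ → 0 ≤ ⟪b, (ξ : Z)⟫ := by
  refine forall₂_congr fun b hb => ?_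
  rw [domLE_zero_iff hb, real_inner_comm (ξ : Z) b, inner_eq_mu_mul D.kind (ne_zero hb) (ξ : Z),
    mul_nonneg_iff_of_pos_left (mu_pos _ (ne_zero hb))]

theorem isDominant_iff_isDom (ξ : D.LamD) : D.IsDominant ξ ↔ IsDom D.α (ξ : Z) := by
  rw [isDominant_iff]
  constructor
  · intro h i
    rw [real_inner_comm]
    exact h _ (D.isBasis.mem i) (by rw [D.based.ht]; exact one_pos)
  · intro h b hb hp
    rw [real_inner_comm]
    exact D.based.dom_inner_nonneg h hb hp

/-- For dominant `ξ` the fundamental chamber is good for `τ(ξ)`. -/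
theorem good_tau {ξ : D.LamD} (h : D.IsDominant ξ) : Good (1 : Z ≃ₗᵢ[ℝ] Z) (D.tau ξ) := by
  intro x hx hp hn
  change ⟪D.rho, x.1⟫ < 0
  rw [inv_apply_eq, (lin_tr_tau ξ).1, (lin_tr_tau ξ).2] at hn
  by_contra hc
  have hpos : 0 < ⟪D.rho, x.1⟫ :=
    lt_of_le_of_ne (not_lt.1 hc) (D.based.ht_ne_zero (Rb_fst hx)).symm
  have h1 := (isDominant_iff ξ).1 h _ (Rb_fst hx) hpos
  have h2 : 0 ≤ x.2 := by
    rcases hp with h | h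
    · exact h.le
    · exact h.1.ge
  rcases lt_or_eq_of_le (add_nonneg h2 h1) with h3 | h3
  · exact hn (Or.inl h3)
  · exact hn (Or.inr ⟨h3.symm, hpos⟩)

end InitialData

/-! ### Lengths and products in the affine braid group -/

namespace InitialData

variable {Z : Type*} [NormedAddCommGroup Z] [InnerProductSpace ℝ Z] [FiniteDimensional ℝ Z] {n : ℕ}
  {D : InitialData Z n}

/-- The relation `T_{v w} = T_v T_w` under the condition on inversions which is equivalent to the
additivity of lengths. -/
theorem Tw_mul {v w : D.W} (h : ∀ x ∈ D.Rb, D.APos x → ¬ D.APos (w.1 x) → ¬ D.APos (v.1 (w.1 x))) :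
    D.Tw (v * w) = D.Tw v * D.Tw w := by
  have h1 := (length_mul_iff v w).2 h
  have h2 : PresentedGroup.mk D.braidRels
      (FreeGroup.of v * FreeGroup.of w * (FreeGroup.of (v * w))⁻¹) = 1 :=
    PresentedGroup.one_of_mem ⟨v, w, h1, rfl⟩
  rw [map_mul, map_inv, mul_inv_eq_one, map_mul] at h2
  exact h2.symm

theorem tau_apply (ξ : D.LamD) (x : Z × ℝ) : (D.tau ξ).1 x = (x.1, x.2 - ⟪x.1, (ξ : Z)⟫) := rfl

theorem APos.snd_nonneg {x : Z × ℝ} (h : D.APos x) : 0 ≤ x.2 := by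
  rcases h with h | h
  · exact h.le
  · exact h.1.ge

theorem snd_nonpos_of_not_apos {x : Z × ℝ} (h : ¬ D.APos x) : x.2 ≤ 0 :=
  not_lt.1 fun hc => h (Or.inl hc)

/-! ### Dominant elements of the translation lattice -/

variable (D)

/-- There is a strictly dominant `ξ ∈ Λ^d` with `(ξ, αᵢ) = (αᵢ^d, αᵢ)` for all `i`: the sum of the
`b^d` over the positive roots `b`. -/
theorem exists_sum_pos : ∃ ξ : D.LamD, ∀ i, ⟪(ξ : Z), D.α i⟫ = ⟪dualRoot D.kind (D.α i), D.α i⟫ := by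
  classical
  set F : Finset Z := D.isRootSystem.finite.toFinset.filter fun b => 0 < ⟪D.rho, b⟫ with hF
  have hmem : ∀ b, b ∈ F ↔ b ∈ D.R₀ ∧ 0 < ⟪D.rho, b⟫ := by
    intro b
    rw [hF, Finset.mem_filter, Set.Finite.mem_toFinset]
  refine ⟨⟨∑ b ∈ F, dualRoot D.kind b, sum_mem fun b hb => D.dualRoot_mem b ((hmem b).1 hb).1⟩,
    fun i => ?_⟩
  have hi : D.α i ∈ F := (hmem _).2 ⟨D.isBasis.mem i, by rw [D.based.ht]; exact one_pos⟩
  dsimp only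
  rw [sum_inner, ← Finset.add_sum_erase F _ hi]
  simp only [add_eq_left]
  have hs : ∀ b, ⟪dualRoot D.kind (sref (D.α i) b), D.α i⟫ = -⟪dualRoot D.kind b, D.α i⟫ := by
    intro b
    rw [dualRoot_map, ← (sref (D.α i)).inner_map_map, sref_sref,
      sref_self (D.based.simple_ne_zero i), inner_neg_right]
  refine Finset.sum_involution (fun b _ => sref (D.α i) b) ?_ ?_ ?_ ?_
  · intro b _
    rw [hs, add_neg_cancel]
  · intro b _ hne he
    have := hs b
    rw [he] at this
    exact hne (by linarith)
  · intro b hb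
    obtain ⟨hne, hb⟩ := Finset.mem_erase.1 hb
    obtain ⟨hm, hp⟩ := (hmem b).1 hb
    refine Finset.mem_erase.2 ⟨fun he => ?_, (hmem _).2
      ⟨sref_mem D.isRootSystem (D.isBasis.mem i) hm, D.based.sref_pos hm hp hne⟩⟩
    have h1 : b = -D.α i := by
      rw [← sref_sref (D.α i) b, he, sref_self (D.based.simple_ne_zero i)]
    rw [h1, inner_neg_right, D.based.ht] at hp
    linarith
  · intro b _
    exact sref_sref _ b

theorem inner_dualRoot_self_pos (i : Fin n) : 0 < ⟪dualRoot D.kind (D.α i), D.α i⟫ := by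
  have h := D.based.simple_ne_zero i
  rw [inner_dualRoot_pos' _ h]
  exact real_inner_self_pos.2 h

theorem exists_sum_pos_sub (i : Fin n) : ∃ ζ : D.LamD, ⟪(ζ : Z), D.α i⟫ = 0 ∧
    ∀ j, j ≠ i → 0 < ⟪(ζ : Z), D.α j⟫ := by
  obtain ⟨ξ, hξ⟩ := D.exists_sum_pos
  refine ⟨ξ - ⟨_, D.dualRoot_mem _ (D.isBasis.mem i)⟩, ?_, fun j hj => ?_⟩
  · simp [inner_sub_left, hξ]
  · have h1 : ⟪dualRoot D.kind (D.α i), D.α j⟫ ≤ 0 := by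
      have h := D.based.simple_ne_zero i
      have := D.based.inner_simple_nonpos hj.symm
      by_contra hc
      linarith [(inner_dualRoot_pos' D.kind (x := D.α j) h).1 (not_le.1 hc)]
    have h2 := D.inner_dualRoot_self_pos j
    simp only [AddSubgroupClass.coe_sub, inner_sub_left, hξ]
    linarith

theorem exists_nsmul_add (ξ ζ : D.LamD) : ∃ N : ℕ, ∀ j, 0 < ⟪(ζ : Z), D.α j⟫ →
    0 < ⟪((ξ + N • ζ : D.LamD) : Z), D.α j⟫ := by
  have h : ∀ j, ∃ N : ℕ, 0 < ⟪(ζ : Z), D.α j⟫ → -⟪(ξ : Z), D.α j⟫ < N * ⟪(ζ : Z), D.α j⟫ := by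
    intro j
    obtain ⟨N, hN⟩ := exists_nat_gt (-⟪(ξ : Z), D.α j⟫ / ⟪(ζ : Z), D.α j⟫)
    exact ⟨N, fun hp => (div_lt_iff₀ hp).1 hN⟩
  choose N hN using h
  refine ⟨∑ j, N j, fun j hj => ?_⟩
  have h1 : (N j : ℝ) ≤ ((∑ j, N j : ℕ) : ℝ) := by
    exact_mod_cast Finset.single_le_sum (f := N) (fun i _ => Nat.zero_le _) (Finset.mem_univ j)
  have h2 := mul_le_mul_of_nonneg_right h1 hj.le
  have h3 := hN j hj
  have e : ((ξ + (∑ j, N j) • ζ : D.LamD) : Z) = (ξ : Z) + ((∑ j, N j : ℕ) : ℝ) • (ζ : Z) := by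
    rw [Nat.cast_smul_eq_nsmul]
    rfl
  rw [e, inner_add_left, real_inner_smul_left]
  linarith

/-- `ξ` lies in the open dominant chamber. -/
def StrictDom (ξ : D.LamD) : Prop := ∀ i, 0 < ⟪(ξ : Z), D.α i⟫

variable {D}

theorem StrictDom.isDominant {ξ : D.LamD} (h : D.StrictDom ξ) : D.IsDominant ξ :=
  (isDominant_iff_isDom ξ).2 fun i => (h i).le

theorem StrictDom.inner_pos {ξ : D.LamD} (h : D.StrictDom ξ) {b : Z} (hb : b ∈ D.R₀)
    (hp : 0 < ⟪D.rho, b⟫) : 0 < ⟪b, (ξ : Z)⟫ := by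
  obtain ⟨c, rfl, hc⟩ := D.based.exists_coef hb hp
  rw [D.based.ht_sum] at hp
  obtain ⟨i, -, hi⟩ := Finset.exists_lt_of_sum_lt (s := Finset.univ) (f := fun _ => (0 : ℝ))
    (by simpa using hp)
  rw [sum_inner]
  refine Finset.sum_pos' (fun j _ => ?_) ⟨i, Finset.mem_univ i, ?_⟩
  · rw [real_inner_smul_left, real_inner_comm]
    exact mul_nonneg (hc j) (h j).le
  · rw [real_inner_smul_left, real_inner_comm]
    exact mul_pos hi (h i)

variable (D)

/-- Every `ξ ∈ Λ^d` is moved into the open dominant chamber by a strictly dominant translation. -/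
theorem exists_strictDom (ξ : D.LamD) : ∃ ζ : D.LamD, D.StrictDom ζ ∧ D.StrictDom (ζ + ξ) := by
  obtain ⟨ζ, hζ⟩ := D.exists_sum_pos
  have hp : ∀ i, 0 < ⟪(ζ : Z), D.α i⟫ := fun i => by
    rw [hζ]
    exact D.inner_dualRoot_self_pos i
  obtain ⟨N, hN⟩ := D.exists_nsmul_add ξ ζ
  obtain ⟨M, hM⟩ := D.exists_nsmul_add 0 ζ
  refine ⟨(N + M) • ζ, fun i => ?_, fun i => ?_⟩
  all_goals
    have h1 := hN i (hp i)
    have h2 := hM i (hp i)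
    have h3 : 0 ≤ (N : ℝ) * ⟪(ζ : Z), D.α i⟫ := mul_nonneg (Nat.cast_nonneg _) (hp i).le
    have h4 : 0 ≤ (M : ℝ) * ⟪(ζ : Z), D.α i⟫ := mul_nonneg (Nat.cast_nonneg _) (hp i).le
    have e : ∀ N : ℕ, ((N • ζ : D.LamD) : Z) = (N : ℝ) • (ζ : Z) := fun N => by
      rw [Nat.cast_smul_eq_nsmul]
      rfl
    simp only [zero_add, add_smul, Submodule.coe_add, inner_add_left, e,
      real_inner_smul_left] at h1 h2 ⊢
    linarith

variable {D}

/-! ### The lattice part of the affine braid group -/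

theorem Tw_tau_add {ξ η : D.LamD} (hξ : D.IsDominant ξ) (hη : D.IsDominant η) :
    D.Tw (D.tau (ξ + η)) = D.Tw (D.tau ξ) * D.Tw (D.tau η) := by
  rw [tau_add]
  refine Tw_mul fun x hx hp hn => ?_
  rw [isDominant_iff] at hξ hη
  have h2 := hp.snd_nonneg
  have h3 := snd_nonpos_of_not_apos hn
  rw [tau_apply] at hn h3 ⊢
  rw [tau_apply]
  dsimp only at h3 ⊢
  have hb : 0 < ⟪x.1, (η : Z)⟫ := by
    refine lt_of_le_of_ne (by linarith) fun h0 => hn ?_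
    rw [← h0, sub_zero]
    exact hp
  have hpos : 0 < ⟪D.rho, x.1⟫ := by
    by_contra hc
    have := hη _ (D.neg_mem (Rb_fst hx)) (by
      rw [inner_neg_right]; linarith [D.based.ht_neg (Rb_fst hx) hc])
    rw [inner_neg_left] at this
    linarith
  have h4 := hξ _ (Rb_fst hx) hpos
  rcases lt_or_eq_of_le h4 with h5 | h5
  · intro hc
    have := hc.snd_nonneg
    dsimp only at this
    linarith
  · rw [← h5, sub_zero]
    exact hn

theorem isDominant_add {ξ η : D.LamD} (hξ : D.IsDominant ξ) (hη : D.IsDominant η) :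
    D.IsDominant (ξ + η) := by
  rw [isDominant_iff] at hξ hη ⊢
  intro b hb hp
  rw [Submodule.coe_add, inner_add_right]
  exact add_nonneg (hξ b hb hp) (hη b hb hp)

theorem exists_Yhom (D : InitialData Z n) : ∃ f : Multiplicative D.LamD →* D.Braid,
    ∀ v : D.LamD, D.IsDominant v → f (Multiplicative.ofAdd v) = D.Tw (D.tau v) := by
  have hex : ∀ ξ : D.LamD, ∃ ζ : D.LamD, D.IsDominant ζ ∧ D.IsDominant (ξ + ζ) := by
    intro ξ
    obtain ⟨ζ, h1, h2⟩ := D.exists_strictDom ξ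
    exact ⟨ζ, h1.isDominant, by rw [add_comm]; exact h2.isDominant⟩
  choose c hc1 hc2 using hex
  set t : D.LamD → D.Braid := fun ξ => D.Tw (D.tau ξ) with ht
  have tadd : ∀ {ξ η}, D.IsDominant ξ → D.IsDominant η → t (ξ + η) = t ξ * t η :=
    fun h h' => Tw_tau_add h h'
  have tcomm : ∀ {ξ η}, D.IsDominant ξ → D.IsDominant η → t ξ * t η = t η * t ξ := by
    intro ξ η h h'
    rw [← tadd h h', ← tadd h' h, add_comm]
  set f : D.LamD → D.Braid := fun ξ => t (ξ + c ξ) * (t (c ξ))⁻¹ with hf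
  have key : ∀ ξ ζ, D.IsDominant ζ → D.IsDominant (ξ + ζ) → f ξ * t ζ = t (ξ + ζ) := by
    intro ξ ζ h1 h2
    have h3 : t (ξ + c ξ) * t ζ = t (ξ + ζ) * t (c ξ) := by
      rw [← tadd (hc2 ξ) h1, ← tadd h2 (hc1 ξ)]
      congr 1
      abel
    rw [hf]
    dsimp only
    rw [mul_assoc, ← mul_left_inj (t (c ξ)), mul_assoc, mul_assoc, tcomm h1 (hc1 ξ),
      inv_mul_cancel_left, h3]
  have fadd : ∀ ξ η, f (ξ + η) = f ξ * f η := by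
    intro ξ η
    have h1 := isDominant_add (hc1 ξ) (hc1 η)
    have h2 := isDominant_add (hc2 ξ) (hc2 η)
    have h3 := key (ξ + η) (c ξ + c η) h1
      (by convert h2 using 1; abel)
    have h4 : t (ξ + η + (c ξ + c η)) = t (ξ + c ξ) * t (η + c η) := by
      rw [← tadd (hc2 ξ) (hc2 η)]
      congr 1
      abel
    rw [h4, tadd (hc1 ξ) (hc1 η), ← key ξ _ (hc1 ξ) (hc2 ξ)] at h3
    have h5 : t (c ξ) * t (η + c η) = t (η + c η) * t (c ξ) := tcomm (hc1 ξ) (hc2 η)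
    rw [mul_assoc (f ξ), h5, ← key η _ (hc1 η) (hc2 η), tcomm (hc1 ξ) (hc1 η), mul_assoc (f η),
      ← mul_assoc (f ξ)] at h3
    exact mul_right_cancel h3
  have f0 : f 0 = 1 := by
    have := fadd 0 0
    rw [add_zero] at this
    exact left_eq_mul.1 this
  refine ⟨{ toFun := fun ξ => f ξ.toAdd, map_one' := f0, map_mul' := fun ξ η => fadd _ _ }, ?_⟩
  intro v hv
  change f v = t v
  rw [← mul_left_inj (t (c v)), key v _ (hc1 v) (hc2 v), tadd hv (hc1 v)]

/-- `Y^ξ` as an element of the extended affine braid group. -/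
def bY (ξ : D.LamD) : D.Braid := D.Yhom (Multiplicative.ofAdd ξ)

theorem bY_of_dominant {ξ : D.LamD} (h : D.IsDominant ξ) : bY ξ = D.Tw (D.tau ξ) :=
  Classical.epsilon_spec (p := fun f : Multiplicative D.LamD →* D.Braid =>
    ∀ v : D.LamD, D.IsDominant v → f (Multiplicative.ofAdd v) = D.Tw (D.tau v)) D.exists_Yhom ξ h

theorem bY_add (ξ η : D.LamD) : bY (ξ + η) = bY ξ * bY η := by
  rw [bY, bY, bY, ofAdd_add, map_mul]

theorem bY_zero : bY (0 : D.LamD) = 1 := by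
  rw [bY, ofAdd_zero, map_one]

/-! ### Bernstein relations in the affine braid group -/

theorem emb_simple_apply (i : Fin n) (x : Z × ℝ) :
    (D.emb (sref (D.α i))).1 x = (sref (D.α i) x.1, x.2) :=
  emb_apply (D.based.simple_mem_weyl i) x

theorem emb_simple_mul_tau (i : Fin n) (ξ η : D.LamD) (h : (η : Z) = sref (D.α i) ξ) :
    D.emb (sref (D.α i)) * D.tau ξ = D.tau η * D.emb (sref (D.α i)) := by
  have hs := lin_tr_emb (D.based.simple_mem_weyl i)
  apply W_ext
  · rw [lin_mul, lin_mul, (lin_tr_tau _).1, (lin_tr_tau _).1, one_mul, mul_one]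
  · rw [tr_mul, tr_mul, (lin_tr_tau _).1, (lin_tr_tau _).2, (lin_tr_tau _).2, hs.1, hs.2, h]
    simp

/-- If `(ξ, αᵢ) = 0`, then lengths add for the product `sᵢ τ(ξ)`. -/
theorem Tw_simple_mul_tau {i : Fin n} {ξ : D.LamD} (h0 : ⟪(ξ : Z), D.α i⟫ = 0) :
    D.Tw (D.emb (sref (D.α i)) * D.tau ξ) = D.Tw (D.emb (sref (D.α i))) * D.Tw (D.tau ξ) := by
  refine Tw_mul fun x hx hp hn hc => ?_
  have hm := W_mem_Rb (D.tau ξ) hx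
  rw [← s_succ] at hc
  have h1 := eq_a_of_s_neg (i := i.succ) (neg_mem_Rb hm) ((apos_neg_iff hm).2 hn) (by
    rw [map_neg, apos_neg_iff (W_mem_Rb _ hm)]
    exact not_not.2 hc)
  rw [neg_eq_iff_eq_neg] at h1
  apply hn
  have e1 : x.1 = -D.α i := congrArg Prod.fst h1
  rw [tau_apply, e1, inner_neg_left, real_inner_comm, h0, neg_zero, sub_zero, ← e1]
  exact hp

theorem Tw_tau_mul_simple {i : Fin n} {ξ : D.LamD} (h0 : ⟪(ξ : Z), D.α i⟫ = 0) :
    D.Tw (D.tau ξ * D.emb (sref (D.α i))) = D.Tw (D.tau ξ) * D.Tw (D.emb (sref (D.α i))) := by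
  refine Tw_mul fun x hx hp hn => ?_
  rw [← s_succ] at hn ⊢
  have h1 := eq_a_of_s_neg hx hp hn
  rw [h1, s_a, a_succ, tau_apply]
  simp only [Prod.fst_neg, Prod.snd_neg, inner_neg_left, real_inner_comm, h0, APos,
    inner_neg_right, D.based.ht]
  norm_num

/-- If `(ξ, αᵢ) ≥ 0`, then `ξ` is the difference of two dominant elements `ξ + ζ` and `ζ` with
`(ζ, αᵢ) = 0`. -/
theorem exists_dominant_add {i : Fin n} {ξ : D.LamD} (h0 : 0 ≤ ⟪(ξ : Z), D.α i⟫) :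
    ∃ ζ : D.LamD, D.IsDominant ζ ∧ ⟪(ζ : Z), D.α i⟫ = 0 ∧ D.IsDominant (ξ + ζ) := by
  obtain ⟨ζ, hζ0, hζ⟩ := D.exists_sum_pos_sub i
  obtain ⟨N, hN⟩ := D.exists_nsmul_add ξ ζ
  have e : ((N • ζ : D.LamD) : Z) = (N : ℝ) • (ζ : Z) := by
    rw [Nat.cast_smul_eq_nsmul]
    rfl
  refine ⟨N • ζ, (isDominant_iff_isDom _).2 fun j => ?_, ?_,
    (isDominant_iff_isDom _).2 fun j => ?_⟩
  · rw [e, real_inner_smul_left]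
    refine mul_nonneg (Nat.cast_nonneg _) ?_
    rcases eq_or_ne j i with rfl | hj
    · exact hζ0.ge
    · exact (hζ j hj).le
  · rw [e, real_inner_smul_left, hζ0, mul_zero]
  · rcases eq_or_ne j i with rfl | hj
    · rw [Submodule.coe_add, inner_add_left, e, real_inner_smul_left, hζ0, mul_zero, add_zero]
      exact h0
    · exact (hN j (hζ j hj)).le

/-- `Tᵢ` and `Y^ξ` commute if `(ξ, αᵢ) = 0`. For dominant `ξ` this follows from `sᵢ τ(ξ) = τ(ξ)
sᵢ`, where lengths add on both sides. -/
theorem simple_comm_bY (i : Fin n) (ξ : D.LamD) (h : ⟪(ξ : Z), D.α i⟫ = 0) :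
    D.Tw (D.emb (sref (D.α i))) * bY ξ = bY ξ * D.Tw (D.emb (sref (D.α i))) := by
  have hdom : ∀ η : D.LamD, D.IsDominant η → ⟪(η : Z), D.α i⟫ = 0 →
      D.Tw (D.emb (sref (D.α i))) * bY η = bY η * D.Tw (D.emb (sref (D.α i))) := by
    intro η hη h0
    rw [bY_of_dominant hη, ← Tw_simple_mul_tau h0, ← Tw_tau_mul_simple h0,
      emb_simple_mul_tau i η η]
    rw [sref_apply, (inner_coroot_eq_zero (D.based.simple_ne_zero i)).2 h0]
    simp
  obtain ⟨ζ, h1, h2, h3⟩ := exists_dominant_add h.ge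
  have h4 := hdom _ h3 (by rw [Submodule.coe_add, inner_add_left, h, h2, add_zero])
  have h5 := hdom _ h1 h2
  rw [bY_add, ← mul_assoc] at h4
  rw [mul_assoc (bY ξ), ← h5, ← mul_assoc] at h4
  exact mul_right_cancel h4

/-- `Tᵢ Y^{sᵢ ξ} Tᵢ = Y^ξ` if `(ξ, (αᵢ^d)^∨) = 1`. -/
theorem simple_cross_bY (i : Fin n) (ξ η : D.LamD)
    (h : ⟪(ξ : Z), coroot (dualRoot D.kind (D.α i))⟫ = 1) (hη : (η : Z) = sref (D.α i) ξ) :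
    D.Tw (D.emb (sref (D.α i))) * bY η * D.Tw (D.emb (sref (D.α i))) = bY ξ := by
  have hα0 := D.based.simple_ne_zero i
  have hμ := mu_pos D.kind hα0
  have hs : ∀ ξ : D.LamD, ⟪(ξ : Z), coroot (dualRoot D.kind (D.α i))⟫ = 1 →
      sref (D.α i) (ξ : Z) = ξ - dualRoot D.kind (D.α i) := by
    intro ξ h
    rw [← sref_dualRoot D.kind hα0, sref_apply, h, one_smul]
  have hdom : ∀ ξ η : D.LamD, ⟪(ξ : Z), coroot (dualRoot D.kind (D.α i))⟫ = 1 →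
      (η : Z) = sref (D.α i) ξ → D.IsDominant ξ →
      D.Tw (D.emb (sref (D.α i))) * bY η * D.Tw (D.emb (sref (D.α i))) = bY ξ := by
    intro ξ η h hη hd
    have hin : ⟪(ξ : Z), D.α i⟫ = mu D.kind (D.α i) := by
      rw [inner_eq_mu_mul D.kind hα0, h, mul_one]
    have hin' : ⟪D.α i, (ξ : Z)⟫ = mu D.kind (D.α i) := by rw [real_inner_comm, hin]
    have hsα : ⟪sref (D.α i) (ξ : Z), D.α i⟫ = -mu D.kind (D.α i) := by
      rw [← (sref (D.α i)).inner_map_map, sref_sref, sref_self hα0, inner_neg_right, hin]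
    have hsum0 : ⟪((η + ξ : D.LamD) : Z), D.α i⟫ = 0 := by
      rw [Submodule.coe_add, inner_add_left, hη, hsα, hin, neg_add_cancel]
    have hsum : D.IsDominant (η + ξ) := by
      rw [isDominant_iff_isDom] at hd ⊢
      intro j
      rcases eq_or_ne j i with rfl | hj
      · exact hsum0.ge
      · rw [Submodule.coe_add, hη, hs ξ h, inner_add_left, inner_sub_left]
        have h1 := hd j
        have h2 : ¬ 0 < ⟪dualRoot D.kind (D.α i), D.α j⟫ := by
          rw [inner_dualRoot_pos' _ hα0, not_lt]
          exact D.based.inner_simple_nonpos hj.symm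
        linarith
    -- `sᵢ τ(η + ξ) = (τ(ξ) sᵢ) τ(ξ)` and `τ(ξ) = (τ(ξ) sᵢ) sᵢ`, with lengths adding
    have e1 : D.Tw (D.emb (sref (D.α i))) * (bY η * bY ξ) =
        D.Tw (D.tau ξ * D.emb (sref (D.α i)) * D.tau ξ) := by
      have hξη : (ξ : Z) = sref (D.α i) η := by rw [hη, sref_sref]
      rw [← bY_add, bY_of_dominant hsum, ← Tw_simple_mul_tau hsum0, tau_add, ← mul_assoc,
        emb_simple_mul_tau i η ξ hξη]
    have e2 : D.Tw (D.tau ξ * D.emb (sref (D.α i)) * D.tau ξ) =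
        D.Tw (D.tau ξ * D.emb (sref (D.α i))) * D.Tw (D.tau ξ) := by
      refine Tw_mul fun x hx hp hn => ?_
      have h2 := hp.snd_nonneg
      have h3 := snd_nonpos_of_not_apos hn
      rw [tau_apply] at h3 hn
      rw [tau_apply, W_mul_apply, emb_simple_apply, tau_apply]
      dsimp only at h3 ⊢
      have hd' := (isDominant_iff ξ).1 hd
      have hb : 0 < ⟪x.1, (ξ : Z)⟫ := by
        refine lt_of_le_of_ne (by linarith) fun h0 => hn ?_
        rw [← h0, sub_zero]
        exact hp
      have hpos : 0 < ⟪D.rho, x.1⟫ := by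
        by_contra hc
        have := hd' _ (D.neg_mem (Rb_fst hx)) (by
          rw [inner_neg_right]; linarith [D.based.ht_neg (Rb_fst hx) hc])
        rw [inner_neg_left] at this
        linarith
      have h3' : x.2 - ⟪x.1, (ξ : Z)⟫ < 0 := by
        refine lt_of_le_of_ne h3 fun h0 => hn (Or.inr ⟨h0, hpos⟩)
      intro hc
      have hc2 := hc.snd_nonneg
      dsimp only at hc2
      by_cases hxi : x.1 = D.α i
      · obtain ⟨m, hm⟩ := Rb_snd hx
        rw [hxi] at hm h3' hc hc2
        rw [sref_self hα0, inner_neg_left, hin'] at hc hc2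
        rw [hin'] at h3'
        have h0 : x.2 = 0 := by
          have hm0 : m = 0 := by
            have h5 : (m : ℝ) * mu D.kind (D.α i) < 1 * mu D.kind (D.α i) := by
              rw [← hm]; linarith
            have h6 : (m : ℝ) < 1 := lt_of_mul_lt_mul_right h5 hμ.le
            have h7 : (0 : ℝ) ≤ m := nonneg_of_mul_nonneg_left (hm ▸ h2) hμ
            have h8 : m < 1 := by exact_mod_cast h6
            have h9 : 0 ≤ m := by exact_mod_cast h7
            omega
          rw [hm, hm0]
          simp
        rw [h0] at hc
        rcases hc with hc | hc
        · dsimp only at hc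
          linarith
        · have := hc.2
          dsimp only at this
          rw [inner_neg_right, D.based.ht] at this
          linarith
      · have h5 := hd' _ (sref_mem D.isRootSystem (D.isBasis.mem i) (Rb_fst hx))
          (D.based.sref_pos (Rb_fst hx) hpos hxi)
        linarith
    have e3 : D.Tw (D.tau ξ) =
        D.Tw (D.tau ξ * D.emb (sref (D.α i))) * D.Tw (D.emb (sref (D.α i))) := by
      rw [← Tw_mul, mul_assoc, ← emb_mul (D.based.simple_mem_weyl i) (D.based.simple_mem_weyl i),
        sref_mul_self, emb_one, mul_one]
      intro x hx hp hn
      rw [← s_succ] at hn ⊢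
      have h1 := eq_a_of_s_neg hx hp hn
      rw [h1, s_a, W_mul_apply, map_neg, s_a, neg_neg, a_succ, tau_apply]
      dsimp only
      rw [hin']
      intro hc
      have := hc.snd_nonneg
      dsimp only at this
      linarith
    rw [← bY_of_dominant hd] at e2 e3
    rw [e2, ← mul_assoc] at e1
    rw [mul_right_cancel e1, ← e3]
  obtain ⟨ζ, h1, h2, h3⟩ := exists_dominant_add (i := i) (ξ := ξ) (by
    rw [inner_eq_mu_mul D.kind hα0, h, mul_one]
    exact hμ.le)
  have h2' : ⟪(ζ : Z), coroot (dualRoot D.kind (D.α i))⟫ = 0 := by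
    rw [inner_eq_mu_mul D.kind hα0] at h2
    exact (mul_eq_zero.1 h2).resolve_left hμ.ne'
  have hζ : sref (D.α i) (ζ : Z) = ζ := by
    rw [← sref_dualRoot D.kind hα0, sref_apply, h2', zero_smul, sub_zero]
  have h4 := hdom (ξ + ζ) (η + ζ)
    (by rw [Submodule.coe_add, inner_add_left, h, h2', add_zero])
    (by rw [Submodule.coe_add, Submodule.coe_add, map_add, hη, hζ]) h3
  have h5 := simple_comm_bY i ζ h2
  rw [bY_add, bY_add, ← mul_assoc, mul_assoc _ (bY ζ), ← h5, ← mul_assoc] at h4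
  exact mul_right_cancel h4

/-- The Bernstein relations hold in the extended affine braid group. -/
def braidData (D : InitialData Z n) : BernsteinData D D.Braid where
  T v := D.Tw (D.emb v)
  Y := bY
  T_mul := by
    intro v hv w hw h
    rw [emb_mul hv hw]
    refine Tw_mul fun x hx hp hn => ?_
    rw [emb_apply hw] at hn ⊢
    rw [emb_apply hv]
    have h0 := snd_nonpos_of_not_apos hn
    have h1 : x.2 = 0 := le_antisymm h0 hp.snd_nonneg
    have h2 : 0 < ⟪D.rho, x.1⟫ := by
      rcases hp with hp | hp
      · linarith
      · exact hp.2
    have h3 : ⟪D.rho, w x.1⟫ < 0 :=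
      D.based.ht_neg (weyl_mem hw (Rb_fst hx)) fun hc => hn (Or.inr ⟨h1, hc⟩)
    have h4 := h x.1 (Rb_fst hx) h2 h3
    rintro (hc | hc)
    · dsimp only at hc
      linarith
    · have := hc.2
      dsimp only at this
      linarith
  Y_add := bY_add
  comm i ξ h := simple_comm_bY i ξ (by
    rw [inner_eq_mu_mul D.kind (D.based.simple_ne_zero i), h, mul_zero])
  cross := simple_cross_bY

/-- `T_w = E(w)` if the translation part of `w` is strictly dominant: then lengths add for the
product of `w` and the inverse of its finite part. -/
theorem Tw_eq_E {g : D.W} (h : D.StrictDom (D.tr g)) : D.Tw g = D.braidData.E g := by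
  have hv := D.lin_mem g
  have e : D.tau (D.tr g) = g * D.emb (D.lin g)⁻¹ := by
    rw [emb_inv hv, eq_mul_inv_iff_mul_eq, tau_mul_emb]
  have h1 : D.Tw (g * D.emb (D.lin g)⁻¹) = D.Tw g * D.Tw (D.emb (D.lin g)⁻¹) := by
    refine Tw_mul fun x hx hp hn => ?_
    rw [emb_apply (inv_mem hv)] at hn
    rw [← W_mul_apply, ← e, tau_apply]
    have h0 := snd_nonpos_of_not_apos hn
    have h1 : x.2 = 0 := le_antisymm h0 hp.snd_nonneg
    have h2 : 0 < ⟪D.rho, x.1⟫ := by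
      rcases hp with hp | hp
      · linarith
      · exact hp.2
    have h3 := h.inner_pos (Rb_fst hx) h2
    intro hc
    have := hc.snd_nonneg
    dsimp only at this
    linarith
  rw [BernsteinData.E, eq_mul_inv_iff_mul_eq]
  change _ * D.Tw (D.emb (D.lin g)⁻¹) = bY (D.tr g)
  rw [bY_of_dominant h.isDominant, e, h1]

/-- `T_w = E(u)⁻¹ E(u w)` in the affine braid group, for every good `u`. -/
theorem Tw_eq_P {u : Z ≃ₗᵢ[ℝ] Z} (hu : u ∈ weyl D.R₀) {w : D.W} (h : Good u w) :
    D.Tw w = D.braidData.P (D.emb u) w := by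
  obtain ⟨ζ, h1, h2⟩ := D.exists_strictDom (D.tr (D.emb u * w))
  have htr : ∀ g : D.W, D.tr (D.tau ζ * g) = ζ + D.tr g := by
    intro g
    apply Subtype.ext
    rw [tr_mul, (lin_tr_tau ζ).1, (lin_tr_tau ζ).2]
    rfl
  have e1 := Tw_eq_E (g := D.tau ζ * D.emb u) (by
    rw [htr, (lin_tr_emb hu).2, add_zero]
    exact h1)
  have e2 := Tw_eq_E (g := D.tau ζ * (D.emb u * w)) (by
    rw [htr]
    exact h2)
  have e3 : D.Tw (D.tau ζ * D.emb u * w) = D.Tw (D.tau ζ * D.emb u) * D.Tw w := by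
    refine Tw_mul fun x hx hp hn => ?_
    have hm := W_mem_Rb w hx
    have h3 := h _ (neg_mem_Rb hm) ((apos_neg_iff hm).2 hn) (by
      rw [map_neg, W_inv_apply_apply, apos_neg_iff hx]
      exact not_not.2 hp)
    rw [Prod.fst_neg, map_neg, inner_neg_right] at h3
    have h4 := h1.inner_pos (weyl_mem hu (Rb_fst hm)) (by linarith)
    rw [W_mul_apply, emb_apply hu, tau_apply]
    intro hc
    have h5 := hc.snd_nonneg
    have h6 := snd_nonpos_of_not_apos hn
    dsimp only at h5
    linarith
  -- both factors lie deep in the dominant chamber, where `T` and `E` agree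
  rw [mul_assoc, e1, e2] at e3
  rw [← D.braidData.P_tau_mul ζ, BernsteinData.P, mul_assoc, e3, inv_mul_cancel_left]

theorem Tw_eq_E_of_good_one {w : D.W} (h : Good (1 : Z ≃ₗᵢ[ℝ] Z) w) : D.Tw w = D.braidData.E w := by
  rw [Tw_eq_P (one_mem _) h, BernsteinData.P, emb_one, one_mul, BernsteinData.E_one, inv_one,
    one_mul]

/-- The affine braid group is generated by the `Y^ξ` and the `Tᵢ` with `1 ≤ i ≤ n`. -/
theorem braid_closure (D : InitialData Z n) :
    Subgroup.closure (Set.range (bY : D.LamD → D.Braid) ∪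
      Set.range fun i : Fin n => D.Tw (D.s i.succ)) = ⊤ := by
  set K := Subgroup.closure (Set.range (bY : D.LamD → D.Braid) ∪
      Set.range fun i : Fin n => D.Tw (D.s i.succ)) with hK
  have hY : ∀ ξ, bY ξ ∈ K := fun ξ => Subgroup.subset_closure (Or.inl ⟨ξ, rfl⟩)
  have hT : ∀ i : Fin n, D.Tw (D.emb (sref (D.α i))) ∈ K := fun i => by
    rw [← s_succ]
    exact Subgroup.subset_closure (Or.inr ⟨i, rfl⟩)
  have hTv : ∀ v ∈ weyl D.R₀, D.braidData.T v ∈ K := by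
    intro v hv
    refine D.based.weyl_induction (P := fun v => D.braidData.T v ∈ K) ?_ ?_ hv
    · rw [BernsteinData.T_one]
      exact one_mem _
    · intro v hv i hi ih
      have hs := D.based.simple_mem_weyl i
      have h1 := D.braidData.T_mul_simple (mul_mem hv hs) (i := i) (by
        rw [isom_mul_apply, sref_self (D.based.simple_ne_zero i), map_neg, inner_neg_right]
        linarith)
      rw [mul_assoc, sref_mul_self, mul_one] at h1
      rw [h1]
      exact mul_mem ih (hT i)
  have hE : ∀ w, D.braidData.E w ∈ K := fun w =>
    mul_mem (hY _) (inv_mem (hTv _ (inv_mem (D.lin_mem w))))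
  rw [eq_top_iff, ← PresentedGroup.closure_range_of, Subgroup.closure_le]
  rintro _ ⟨w, rfl⟩
  obtain ⟨u, hu, hg⟩ := exists_good w
  have := Tw_eq_P hu hg
  change D.Tw w ∈ K
  rw [this]
  exact mul_mem (inv_mem (hE _)) (hE _)

theorem inv_simple {i : Fin (n + 1)} {x : Z × ℝ} (hx : x ∈ D.Rb) (hp : D.APos x)
    (hn : ¬ D.APos (((D.s i)⁻¹).1 x)) : x = D.a i := by
  rw [s_inv] at hn
  exact eq_a_of_s_neg hx hp hn

/-- A simple crossing is positive if the chamber of `g` is on the negative side of the wall. -/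
theorem P_s_of_neg {g : D.W} {i : Fin (n + 1)} (h : ⟪D.rho, D.lin g (D.a i).1⟫ < 0) :
    D.braidData.P g (D.s i) = D.Tw (D.s i) := by
  rw [BernsteinData.P_eq_lin, ← Tw_eq_P (D.lin_mem g)]
  intro x hx hp hn
  rw [inv_simple hx hp hn]
  exact h

theorem P_s_of_pos {g : D.W} {i : Fin (n + 1)} (h : 0 < ⟪D.rho, D.lin g (D.a i).1⟫) :
    D.braidData.P g (D.s i) = (D.Tw (D.s i))⁻¹ := by
  rw [← P_s_of_neg (g := g * D.s i) (i := i)]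
  · rw [eq_inv_iff_mul_eq_one, ← BernsteinData.P_mul, s_mul_self, BernsteinData.P, mul_one,
      inv_mul_cancel]
  · rw [lin_mul, isom_mul_apply, lin_s,
      sref_self (D.isRootSystem.ne_zero _ (D.a_fst_mem i)), map_neg, inner_neg_right]
    linarith

theorem P_length_zero {w : D.W} (h : D.length w = 0) (g : D.W) : D.braidData.P g w = D.Tw w := by
  rw [BernsteinData.P_eq_lin, ← Tw_eq_P (D.lin_mem g)]
  intro x hx hp hn
  have hm := W_mem_Rb w⁻¹ hx
  have := (length_eq_zero_iff w).1 h _ (neg_mem_Rb hm) ((apos_neg_iff hm).2 hn)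
  rw [map_neg, W_apply_inv_apply, apos_neg_iff hx] at this
  exact absurd hp this

end InitialData

/-! ### Relations in the double affine braid group -/

namespace InitialData

variable {Z : Type*} [NormedAddCommGroup Z] [InnerProductSpace ℝ Z] [FiniteDimensional ℝ Z] {n : ℕ}
  {D : InitialData Z n}

/-- The canonical map from the affine to the double affine braid group. -/
def toDA (D : InitialData Z n) : D.Braid →* D.DABraid :=
  (QuotientGroup.mk' _).comp Monoid.Coprod.inl

theorem toDA_Tw_s (i : Fin (n + 1)) : D.toDA (D.Tw (D.s i)) = D.T i := rfl

theorem toDA_bY (ξ : D.LamD) : D.toDA (bY ξ) = D.Y ξ := rfl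

theorem Xhat_add (x y : D.LamHat) : D.Xhat (x + y) = D.Xhat x * D.Xhat y := by
  rw [Xhat, fX, ofAdd_add, map_mul, QuotientGroup.mk_mul]
  rfl

theorem Xhat_zero : D.Xhat 0 = 1 := by
  have := Xhat_add (D := D) 0 0
  rw [add_zero] at this
  exact left_eq_mul.1 this

theorem Xhat_neg (x : D.LamHat) : D.Xhat (-x) = (D.Xhat x)⁻¹ := by
  rw [eq_inv_iff_mul_eq_one, ← Xhat_add, neg_add_cancel, Xhat_zero]

theorem Xhat_comm (x y : D.LamHat) : D.Xhat x * D.Xhat y = D.Xhat y * D.Xhat x := by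
  rw [← Xhat_add, ← Xhat_add, add_comm]

theorem mk_eq_one {r : D.FreeProd} (h : D.DARel r) : (QuotientGroup.mk r : D.DABraid) = 1 :=
  (QuotientGroup.eq_one_iff r).2 (Subgroup.subset_normalClosure h)

theorem rel_comm (i : Fin (n + 1)) (x : D.LamHat) (h : ⟪(x : Z × ℝ).1, coroot (D.a i).1⟫ = 0) :
    D.T i * D.Xhat x = D.Xhat x * D.T i := by
  have := mk_eq_one (DARel.comm i x h)
  rw [QuotientGroup.mk_mul, QuotientGroup.mk_inv, mul_inv_eq_one] at this
  exact this

theorem rel_cross (i : Fin (n + 1)) (x : D.LamHat) (h : ⟪(x : Z × ℝ).1, coroot (D.a i).1⟫ = 1) :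
    D.T i * D.Xhat x * D.T i = D.Xhat (D.act (D.s i) x) := by
  have := mk_eq_one (DARel.cross i x h)
  rw [QuotientGroup.mk_mul, QuotientGroup.mk_inv, mul_inv_eq_one] at this
  exact this

theorem rel_omega (w : D.W) (h : D.length w = 0) (x : D.LamHat) :
    D.toDA (D.Tw w) * D.Xhat x = D.Xhat (D.act w x) * D.toDA (D.Tw w) := by
  have := mk_eq_one (DARel.omega w h x)
  rw [QuotientGroup.mk_mul, QuotientGroup.mk_inv, mul_inv_eq_one] at this
  exact this

theorem act_mul (v w : D.W) (x : D.LamHat) : D.act (v * w) x = D.act v (D.act w x) := rfl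

theorem coe_act (w : D.W) (x : D.LamHat) : (D.act w x : Z × ℝ) = w.1 x := rfl

/-! ### Moving lattice elements through galleries -/

/-- The orientations given by `g` and `g'` agree at the wall of `a` if `(y, a^∨) = 0`, and are
opposite to each other, in the way prescribed by the sign, if `(y, a^∨) = ±1`. -/
def Compat (g g' : D.W) (y a : Z × ℝ) : Prop :=
  (⟪y.1, coroot a.1⟫ = 0 ∧ (0 < ⟪D.rho, D.lin g a.1⟫ ↔ 0 < ⟪D.rho, D.lin g' a.1⟫)) ∨
  (⟪y.1, coroot a.1⟫ = 1 ∧ 0 < ⟪D.rho, D.lin g a.1⟫ ∧ ⟪D.rho, D.lin g' a.1⟫ < 0) ∨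
  (⟪y.1, coroot a.1⟫ = -1 ∧ ⟪D.rho, D.lin g a.1⟫ < 0 ∧ 0 < ⟪D.rho, D.lin g' a.1⟫)

theorem apply_fst (w : D.W) (x : Z × ℝ) : (w.1 x).1 = D.lin w x.1 := by
  rw [D.apply_eq w]

theorem Compat.of_mul {g g' w : D.W} {y a : Z × ℝ} (h : Compat g g' (w.1 y) (w.1 a)) :
    Compat (g * w) (g' * w) y a := by
  unfold Compat at h ⊢
  simp only [apply_fst, coroot_map, LinearIsometryEquiv.inner_map_map] at h
  simpa only [lin_mul, isom_mul_apply] using h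

theorem act_s_of_zero {i : Fin (n + 1)} {x : D.LamHat}
    (h : ⟪(x : Z × ℝ).1, coroot (D.a i).1⟫ = 0) : D.act (D.s i) x = x := by
  apply Subtype.ext
  rw [coe_act, s_apply, real_inner_comm, h, zero_smul, sub_zero]

/-- The case of one simple crossing. These are the defining relations of the double affine braid
group, rewritten: `Tᵢ X^x = X^x Tᵢ` and `Tᵢ⁻¹ X^{sᵢ x} = X^x Tᵢ`. -/
theorem P_s_mul_Xhat {g g' : D.W} {i : Fin (n + 1)} {x : D.LamHat}
    (h : Compat g g' ((D.s i).1 x) (D.a i)) :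
    D.toDA (D.braidData.P g (D.s i)) * D.Xhat x =
      D.Xhat (D.act (D.s i) x) * D.toDA (D.braidData.P g' (D.s i)) := by
  have hai := D.isRootSystem.ne_zero _ (D.a_fst_mem i)
  have hin : ⟪((D.s i).1 x).1, coroot (D.a i).1⟫ = -⟪(x : Z × ℝ).1, coroot (D.a i).1⟫ := by
    rw [apply_fst, lin_s, sref_apply, inner_sub_left, real_inner_smul_left, inner_coroot_self hai]
    ring
  have hss : D.act (D.s i) (D.act (D.s i) x) = x := by
    rw [← act_mul, s_mul_self]
    rfl
  have hmem : ∀ g : D.W, D.lin g (D.a i).1 ∈ D.R₀ := fun g => weyl_mem (D.lin_mem g) (D.a_fst_mem i)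
  rcases h with ⟨h0, h⟩ | ⟨h1, h, h'⟩ | ⟨h1, h, h'⟩
  · rw [hin, neg_eq_zero] at h0
    rw [act_s_of_zero h0]
    have hc := rel_comm i x h0
    by_cases hp : 0 < ⟪D.rho, D.lin g (D.a i).1⟫
    · rw [P_s_of_pos hp, P_s_of_pos (h.1 hp), map_inv, toDA_Tw_s, inv_mul_eq_iff_eq_mul,
        ← mul_assoc, hc, mul_inv_cancel_right]
    · rw [P_s_of_neg (D.based.ht_neg (hmem g) hp),
        P_s_of_neg (D.based.ht_neg (hmem g') fun h2 => hp (h.2 h2)), toDA_Tw_s, hc]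
  · rw [P_s_of_pos h, P_s_of_neg h', map_inv, toDA_Tw_s, inv_mul_eq_iff_eq_mul, ← mul_assoc,
      rel_cross i _ h1, hss]
  · rw [hin, neg_inj] at h1
    rw [P_s_of_neg h, P_s_of_pos h', map_inv, toDA_Tw_s, ← rel_cross i x h1, mul_inv_cancel_right]

/-- Moving `X^x` through the gallery of `w` changes its orientation from that of `g` to that of
`g'`, provided that these are compatible at all walls crossed by the gallery. -/
theorem P_mul_Xhat (w : D.W) {g g' : D.W} {x : D.LamHat}
    (h : ∀ a ∈ D.Rb, D.APos a → ¬ D.APos ((w⁻¹).1 a) → Compat g g' (w.1 x) a) :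
    D.toDA (D.braidData.P g w) * D.Xhat x =
      D.Xhat (D.act w x) * D.toDA (D.braidData.P g' w) := by
  revert g g' x
  refine W_induction (P := fun w => ∀ {g g' : D.W} {x : D.LamHat},
    (∀ a ∈ D.Rb, D.APos a → ¬ D.APos ((w⁻¹).1 a) → Compat g g' (w.1 x) a) →
    D.toDA (D.braidData.P g w) * D.Xhat x =
      D.Xhat (D.act w x) * D.toDA (D.braidData.P g' w)) ?_ ?_ w
  · intro w hw g g' x _
    rw [P_length_zero hw, P_length_zero hw, rel_omega w hw]
  · intro w i hi ih g g' x h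
    have hinv : ∀ a, ((D.s i * w)⁻¹).1 ((D.s i).1 a) = (w⁻¹).1 a := by
      intro a
      rw [mul_inv_rev, W_mul_apply, W_inv_apply_apply]
    have h1 : Compat g g' ((D.s i).1 (D.act w x)) (D.a i) := by
      refine h _ (D.a_mem_Rb i) (a_apos i) ?_
      have := hinv (-D.a i)
      rw [map_neg, s_a, neg_neg] at this
      rw [this, map_neg, apos_neg_iff (W_mem_Rb _ (D.a_mem_Rb i))]
      exact not_not.2 hi
    have h2 : ∀ a ∈ D.Rb, D.APos a → ¬ D.APos ((w⁻¹).1 a) →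
        Compat (g * D.s i) (g' * D.s i) (w.1 x) a := by
      intro a ha hp hn
      refine Compat.of_mul (h _ (W_mem_Rb _ ha) (s_apos ha hp ?_) (by rwa [hinv]))
      rintro rfl
      exact hn hi
    rw [BernsteinData.P_mul, BernsteinData.P_mul, map_mul, map_mul, mul_assoc, ih h2, ← mul_assoc,
      P_s_mul_Xhat h1, act_mul, mul_assoc]

/-! ### The central elements -/

theorem Xhat_eq (x : D.LamHat) :
    D.Xhat x = D.X ⟨(x : Z × ℝ).1, D.mem_LamHat.1 x.2⟩ * D.Xc (x : Z × ℝ).2 := by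
  rw [X, Xc, ← Xhat_add]
  congr 1
  apply Subtype.ext
  ext <;> simp

theorem Xc_add (r r' : ℝ) : D.Xc (r + r') = D.Xc r * D.Xc r' := by
  rw [Xc, Xc, Xc, ← Xhat_add]
  congr 1
  apply Subtype.ext
  ext <;> simp

theorem Xc_zero : D.Xc 0 = 1 := by
  have := Xc_add (D := D) 0 0
  rw [add_zero] at this
  exact left_eq_mul.1 this

theorem X_add (l m : D.Lam) : D.X (l + m) = D.X l * D.X m := by
  rw [X, X, X, ← Xhat_add]
  congr 1
  apply Subtype.ext
  ext <;> simp

theorem X_neg (l : D.Lam) : D.X (-l) = (D.X l)⁻¹ := by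
  rw [X, X, ← Xhat_neg]
  congr 1
  apply Subtype.ext
  ext <;> simp

theorem Y_add (ξ η : D.LamD) : D.Y (ξ + η) = D.Y ξ * D.Y η := by
  rw [← toDA_bY, bY_add, map_mul]
  rfl

theorem Y_zero : D.Y 0 = 1 := by
  rw [← toDA_bY, bY_zero, map_one]

theorem Y_neg (ξ : D.LamD) : D.Y (-ξ) = (D.Y ξ)⁻¹ := by
  rw [eq_inv_iff_mul_eq_one, ← Y_add, neg_add_cancel, Y_zero]

theorem toDA_mul_Xc (b : D.Braid) (r : ℝ) : D.toDA b * D.Xc r = D.Xc r * D.toDA b := by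
  have hw : ∀ w : D.W, D.toDA (D.Tw w) * D.Xc r = D.Xc r * D.toDA (D.Tw w) := by
    intro w
    obtain ⟨u, hu, hg⟩ := exists_good w
    rw [Tw_eq_P hu hg, Xc, P_mul_Xhat w (g' := D.emb u)]
    · congr 2
      apply Subtype.ext
      rw [coe_act, D.apply_eq w]
      simp
    · intro a _ _ _
      refine Or.inl ⟨?_, Iff.rfl⟩
      rw [D.apply_eq w]
      simp
  have hb : b ∈ Subgroup.closure (Set.range (PresentedGroup.of (rels := D.braidRels))) := by
    rw [PresentedGroup.closure_range_of]
    trivial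
  induction hb using Subgroup.closure_induction with
  | mem x hx =>
    obtain ⟨w, rfl⟩ := hx
    exact hw w
  | one => rw [map_one, one_mul, mul_one]
  | mul x y _ _ hx hy => rw [map_mul, mul_assoc, hy, ← mul_assoc, hx, mul_assoc]
  | inv x _ hx =>
    rw [map_inv, inv_mul_eq_iff_eq_mul, ← mul_assoc, hx, mul_inv_cancel_right]

theorem Y_mul_Xc (ξ : D.LamD) (r : ℝ) : D.Y ξ * D.Xc r = D.Xc r * D.Y ξ := toDA_mul_Xc _ r

theorem Xhat_mul_Xc (x : D.LamHat) (r : ℝ) : D.Xhat x * D.Xc r = D.Xc r * D.Xhat x :=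
  Xhat_comm _ _

/-- The double affine braid group is generated by the `X^λ`, `X^{rc}`, `Y^ξ` and `Tᵢ` with
`1 ≤ i ≤ n`. -/
theorem DABraid_hom_ext {G : Type*} [Group G] {f g : D.DABraid →* G} (hc : ∀ r, f (D.Xc r) = g (D.Xc r))
    (hX : ∀ l, f (D.X l) = g (D.X l)) (hY : ∀ ξ, f (D.Y ξ) = g (D.Y ξ))
    (hT : ∀ i : Fin n, f (D.T i.succ) = g (D.T i.succ)) : f = g := by
  have h1 : f.comp D.toDA = g.comp D.toDA := by
    refine MonoidHom.eq_of_eqOn_dense (braid_closure D) ?_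
    rintro _ (⟨ξ, rfl⟩ | ⟨i, rfl⟩)
    · exact hY ξ
    · exact hT i
  refine QuotientGroup.monoidHom_ext _ (Monoid.Coprod.hom_ext h1 ?_)
  ext x
  change f (D.Xhat x) = g (D.Xhat x)
  rw [Xhat_eq, map_mul, map_mul, hc, hX]

end InitialData

namespace InitialData

variable {Z : Type*} [NormedAddCommGroup Z] [InnerProductSpace ℝ Z] [FiniteDimensional ℝ Z] {n : ℕ}
  {D : InitialData Z n}

/-! ### The elements playing the role of `T₀` and of `Ω` in the dual double affine braid group -/

/-- The element `E(u) X^x`, where `E(u) = T_{u⁻¹}⁻¹`. -/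
def EX (u : Z ≃ₗᵢ[ℝ] Z) (x : D.Lam) : D.DABraid := D.toDA (D.braidData.E (D.emb u)) * D.X x

theorem emb_mul_tau {u : Z ≃ₗᵢ[ℝ] Z} (hu : u ∈ weyl D.R₀) (ξ η : D.LamD) (h : (η : Z) = u ξ) :
    D.emb u * D.tau ξ = D.tau η * D.emb u := by
  have h1 := lin_tr_emb hu
  apply W_ext
  · simp only [lin_mul, h1.1, (lin_tr_tau _).1, mul_one, one_mul]
  · simp only [tr_mul, h1.1, h1.2, (lin_tr_tau _).1, (lin_tr_tau _).2, h]
    simp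

/-- For the orientation given by `u`, the translation by `ξ` gives a conjugate of `Y^{u ξ}`. -/
theorem P_emb_tau {u : Z ≃ₗᵢ[ℝ] Z} (hu : u ∈ weyl D.R₀) (ξ η : D.LamD) (h : (η : Z) = u ξ) :
    D.braidData.P (D.emb u) (D.tau ξ) =
      (D.braidData.E (D.emb u))⁻¹ * bY η * D.braidData.E (D.emb u) := by
  rw [BernsteinData.P, emb_mul_tau hu ξ η h, BernsteinData.E_tau_mul, mul_assoc]
  rfl

theorem P_one_tau (ξ : D.LamD) : D.braidData.P 1 (D.tau ξ) = bY ξ := by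
  rw [BernsteinData.P, BernsteinData.E_one, one_mul, BernsteinData.E_tau, inv_one, one_mul]
  rfl

/-- Relations between `Y^ξ` and `E(u) X^x`: the lattice element `X^x` is moved through the gallery
of `τ(ξ)`, which turns the orientation given by `u` into that given by `1`. -/
theorem Y_mul_EX {u : Z ≃ₗᵢ[ℝ] Z} (hu : u ∈ weyl D.R₀) (x : D.Lam) (ξ η : D.LamD)
    (hη : (η : Z) = u ξ)
    (h : ∀ a ∈ D.Rb, D.APos a → ¬ D.APos (a.1, a.2 + ⟪a.1, (ξ : Z)⟫) →
      Compat (D.emb u) 1 ((x : Z), 0) a) :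
    D.Y η * EX u x = EX u x * D.Xc (-⟪(x : Z), (ξ : Z)⟫) * D.Y ξ := by
  have key := P_mul_Xhat (D.tau ξ) (g := D.emb u) (g' := 1)
    (x := ⟨((x : Z), 0), D.mem_LamHat.2 x.2⟩) (by
      intro a ha hp hn
      have h1 : ((D.tau ξ)⁻¹).1 a = (a.1, a.2 + ⟪a.1, (ξ : Z)⟫) := by
        rw [inv_apply_eq, (lin_tr_tau ξ).1, (lin_tr_tau ξ).2, inv_one]
        rfl
      rw [h1] at hn
      have := h a ha hp hn
      unfold Compat at this ⊢
      rwa [tau_apply])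
  have hx : D.Xhat (D.act (D.tau ξ) ⟨((x : Z), 0), D.mem_LamHat.2 x.2⟩) =
      D.X x * D.Xc (-⟪(x : Z), (ξ : Z)⟫) := by
    rw [Xhat_eq]
    congr 2
    change 0 - ⟪(x : Z), (ξ : Z)⟫ = _
    rw [zero_sub]
  rw [hx, P_emb_tau hu ξ η hη, P_one_tau, map_mul, map_mul, map_inv, toDA_bY, toDA_bY, mul_assoc,
    mul_assoc, inv_mul_eq_iff_eq_mul] at key
  rw [EX]
  simp only [mul_assoc] at key ⊢
  exact key

/-- For a dominant short root `γ` the orientations given by `s_γ` and `1` are compatible with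
moving `X^{-γ}` through walls which are not parallel to that of `γ`. -/
theorem compat_short {γ : Z} (hd : IsDom D.α γ) (hs : D.IsShort γ) {a : Z × ℝ} (ha : a.1 ∈ D.R₀)
    (h1 : γ ≠ a.1) (h2 : γ ≠ -a.1) {y : Z × ℝ} (hy : y.1 = -γ) :
    Compat (D.emb (sref γ)) 1 y a := by
  have hsm := sref_mem_weyl hs.1
  have ha0 := ne_zero ha
  have hγ : ⟪γ, sref γ a.1⟫ = -⟪γ, a.1⟫ := by
    rw [← (sref γ).inner_map_map, sref_sref, sref_self (ne_zero hs.1), inner_neg_left]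
  have hma := weyl_mem hsm ha
  unfold Compat
  rw [(lin_tr_emb hsm).1, lin_one, hy, inner_neg_left]
  change (_ ∧ (_ ↔ 0 < ⟪D.rho, a.1⟫)) ∨ (_ ∧ _ ∧ ⟪D.rho, a.1⟫ < 0) ∨ (_ ∧ _ ∧ 0 < ⟪D.rho, a.1⟫)
  rcases D.isRootSystem.inner_coroot_short hs.1 ha h1 h2 (hs.2 _ ha) with h | h | h
  · refine Or.inl ⟨by rw [h, neg_zero], ?_⟩
    have h0 := (inner_coroot_eq_zero ha0).1 h
    have : sref γ a.1 = a.1 := by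
      rw [sref_apply, (inner_coroot_eq_zero (ne_zero hs.1)).2 (by rwa [real_inner_comm]), zero_smul,
        sub_zero]
    rw [this]
  · have h0 : 0 < ⟪γ, a.1⟫ := (inner_coroot_pos ha0).1 (by rw [h]; exact one_pos)
    exact Or.inr (Or.inr ⟨by rw [h], D.based.neg_of_dom_inner_neg hd hma (by rw [hγ]; linarith),
      D.based.pos_of_dom_inner_pos hd ha h0⟩)
  · have h0 : ⟪γ, a.1⟫ < 0 := (inner_coroot_neg ha0).1 (by rw [h]; norm_num)
    exact Or.inr (Or.inl ⟨by rw [h, neg_neg], D.based.pos_of_dom_inner_pos hd hma (by rw [hγ]; linarith),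
      D.based.neg_of_dom_inner_neg hd ha h0⟩)

variable {γ : Z}

/-- The counterpart of the relation `T₀ X^ξ = X^ξ T₀`: for `γ = β^d` the element `E(s_γ) X^{-γ}`
is the image of `T₀` under duality. -/
theorem Y_comm_EX_short (hd : IsDom D.α γ) (hs : D.IsShort γ) (x : D.Lam) (hx : (x : Z) = -γ)
    (ξ : D.LamD) (h : ⟪(ξ : Z), γ⟫ = 0) :
    D.Y ξ * EX (sref γ) x = EX (sref γ) x * D.Y ξ := by
  have hγ0 := ne_zero hs.1
  have h' : ⟪γ, (ξ : Z)⟫ = 0 := by rwa [real_inner_comm]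
  have := Y_mul_EX (sref_mem_weyl hs.1) x ξ ξ (by
    rw [sref_apply, (inner_coroot_eq_zero hγ0).2 h, zero_smul, sub_zero]) (by
    intro a ha hp hn
    by_cases h1 : γ = a.1
    · rw [← h1, h', add_zero, h1] at hn
      exact absurd hp hn
    by_cases h2 : γ = -a.1
    · rw [h2, inner_neg_left, neg_eq_zero] at h'
      rw [h', add_zero] at hn
      exact absurd hp hn
    exact compat_short hd hs (Rb_fst ha) h1 h2 hx)
  rw [this, hx, inner_neg_left, h', neg_zero, neg_zero, mul_assoc, ← Y_mul_Xc]
  congr 1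
  rw [Xc_zero, mul_one]

/-- The counterpart of the relation `T₀ X^ξ T₀ = X^{s₀ ξ}`. Here `X^{-γ}` is moved through the
gallery of `τ(ξ) s_γ`, which crosses no wall parallel to that of `γ`; the gallery of `τ(ξ)` would
cross one. -/
theorem EX_short_cross (hd : IsDom D.α γ) (hs : D.IsShort γ) (x : D.Lam) (hx : (x : Z) = -γ)
    (ξ η : D.LamD) (h : ⟪(ξ : Z), γ⟫ = mu D.kind γ) (hη : (η : Z) = sref γ ξ) :
    EX (sref γ) x * D.Y ξ * EX (sref γ) x = D.Y η * D.Xc (-mu D.kind γ) := by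
  have hγ0 := ne_zero hs.1
  have hsm := sref_mem_weyl hs.1
  have h' : ⟪γ, (ξ : Z)⟫ = mu D.kind γ := by rwa [real_inner_comm]
  have hμ := mu_pos D.kind hγ0
  have hγp : 0 < ⟪D.rho, γ⟫ := D.based.dom_pos hd hs.1
  set w := D.tau ξ * D.emb (sref γ) with hw
  have hinv : ∀ a, (w⁻¹).1 a = (sref γ a.1, a.2 + ⟪a.1, (ξ : Z)⟫) := by
    intro a
    rw [hw, mul_inv_rev, W_mul_apply, inv_apply_eq (D.tau ξ), (lin_tr_tau ξ).1, (lin_tr_tau ξ).2,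
      inv_one, ← emb_inv hsm, sref_inv, emb_apply hsm]
    rfl
  have hmem : ((γ, -mu D.kind γ) : Z × ℝ) ∈ D.LamHat := D.mem_LamHat.2 (D.root_mem _ hs.1)
  have hwx : w.1 (γ, -mu D.kind γ) = (-γ, -mu D.kind γ + mu D.kind γ) := by
    rw [hw, W_mul_apply, emb_apply hsm, tau_apply, sref_self hγ0, inner_neg_left, h', sub_neg_eq_add]
  have key := P_mul_Xhat w (g := D.emb (sref γ)) (g' := 1) (x := ⟨_, hmem⟩) (by
      intro a ha hp hn
      have ham := Rb_fst ha
      rw [hinv] at hn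
      by_cases h1 : γ = a.1
      · refine absurd (Or.inl ?_) hn
        rw [← h1, h']
        have := hp.snd_nonneg
        change 0 < a.2 + _
        linarith
      by_cases h2 : γ = -a.1
      · have ha1 : a.1 = -γ := by rw [h2, neg_neg]
        obtain ⟨m, hm⟩ := Rb_snd ha
        rw [ha1, mu_neg] at hm
        rw [ha1, map_neg, sref_self hγ0, neg_neg, inner_neg_left, h'] at hn
        have hm1 : (1 : ℝ) ≤ m := by
          rcases hp with h | ⟨_, h⟩
          · rw [hm] at h
            have : (0 : ℝ) < m := pos_of_mul_pos_left h hμ.le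
            have : 0 < m := by exact_mod_cast this
            exact_mod_cast this
          · rw [ha1, inner_neg_right] at h
            linarith
        have h3 : 0 ≤ a.2 + -mu D.kind γ := by
          rw [hm]
          nlinarith
        rcases h3.lt_or_eq with h3 | h3
        · exact absurd (Or.inl h3) hn
        · exact absurd (Or.inr ⟨h3.symm, hγp⟩) hn
      exact compat_short hd hs ham h1 h2 (by change (w.1 (γ, -mu D.kind γ)).1 = _; rw [hwx]))
  have e1 : D.Xhat ⟨_, hmem⟩ = (D.X x)⁻¹ * D.Xc (-mu D.kind γ) := by
    rw [Xhat_eq, ← X_neg]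
    congr 2
    apply Subtype.ext
    simp [hx]
  have e2 : D.Xhat (D.act w ⟨_, hmem⟩) = D.X x := by
    rw [X]
    congr 1
    apply Subtype.ext
    rw [coe_act]
    dsimp only
    rw [hwx, hx, neg_add_cancel]
  have hsη : D.emb (sref γ) * w = D.tau η := by
    rw [hw, ← mul_assoc, emb_mul_tau hsm ξ η hη, mul_assoc, ← emb_mul hsm hsm, sref_mul_self,
      emb_one, mul_one]
  have e3 : D.braidData.P (D.emb (sref γ)) w = (D.braidData.E (D.emb (sref γ)))⁻¹ * bY η := by
    rw [BernsteinData.P, hsη, BernsteinData.E_tau]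
    rfl
  have e4 : D.braidData.P 1 w = bY ξ * D.braidData.E (D.emb (sref γ)) := by
    rw [BernsteinData.P, BernsteinData.E_one, one_mul, hw, BernsteinData.E_tau_mul, inv_one, one_mul]
    rfl
  rw [e1, e2, e3, e4, map_mul, map_mul, map_inv, toDA_bY, toDA_bY, mul_assoc,
    inv_mul_eq_iff_eq_mul, ← mul_assoc (D.Y η)] at key
  have hc : D.Y η * (D.X x)⁻¹ * D.Xc (-mu D.kind γ) * D.X x = D.Y η * D.Xc (-mu D.kind γ) := by
    have : D.Xc (-mu D.kind γ) * D.X x = D.X x * D.Xc (-mu D.kind γ) := (Xhat_mul_Xc _ _).symm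
    rw [mul_assoc _ _ (D.X x), this, ← mul_assoc, inv_mul_cancel_right]
  rw [← hc, key, EX]
  simp only [mul_assoc]

end InitialData

namespace InitialData

variable {Z : Type*} [NormedAddCommGroup Z] [InnerProductSpace ℝ Z] [FiniteDimensional ℝ Z] {n : ℕ}
  {D : InitialData Z n}

/-! ### The duality antihomomorphism -/

open MulOpposite

theorem dual_rho_neg {b : Z} (hb : b ∈ D.R₀) :
    ⟪D.dual.rho, dualRoot D.kind b⟫ < 0 ↔ ⟪D.rho, b⟫ < 0 := by
  have := D.dual_rho_pos (D.neg_mem hb)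
  rwa [dualRoot_neg, inner_neg_right, inner_neg_right, neg_pos, neg_pos] at this

/-- The condition `l(v w) = l(v) + l(w)` is invariant under passing to inverses and to the dual
root system. -/
theorem FinAdd.dual {v w : Z ≃ₗᵢ[ℝ] Z} (hv : v ∈ weyl D.R₀) (hw : w ∈ weyl D.R₀)
    (h : D.FinAdd v w) : D.dual.FinAdd w⁻¹ v⁻¹ := by
  rintro _ ⟨b, hb, rfl⟩ hp hn
  change 0 < ⟪D.dual.rho, dualRoot D.kind b⟫ at hp
  rw [← dualRoot_map] at hn ⊢
  rw [← dualRoot_map]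
  have hvb := weyl_mem (inv_mem hv) hb
  have hwb := weyl_mem (inv_mem hw) hvb
  rw [dual_rho_neg hvb] at hn
  rw [dual_rho_neg hwb]
  rw [dual_rho_pos D hb] at hp
  refine D.based.ht_neg hwb fun hc => ?_
  have e1 : w (w⁻¹ (v⁻¹ b)) = v⁻¹ b := by rw [← isom_mul_apply w, mul_inv_cancel]; rfl
  have e2 : v (v⁻¹ b) = b := by rw [← isom_mul_apply v, mul_inv_cancel]; rfl
  have := h _ hwb hc (by rwa [e1])
  rw [e1, e2] at this
  linarith

/-- The identification of `Λ^d` with the first lattice of the dual data. -/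
def toLam (D : InitialData Z n) : D.LamD →+ D.dual.Lam where
  toFun ξ := ⟨ξ, ξ.2⟩
  map_zero' := rfl
  map_add' _ _ := rfl

/-- The identification of `Λ` with the second lattice of the dual data. -/
def toLamD (D : InitialData Z n) : D.Lam →+ D.dual.LamD where
  toFun l := ⟨l, l.2⟩
  map_zero' := rfl
  map_add' _ _ := rfl

theorem coe_toLam (ξ : D.LamD) : (D.toLam ξ : Z) = ξ := rfl

theorem EX_mul_Xc (u : Z ≃ₗᵢ[ℝ] Z) (x : D.Lam) (r : ℝ) :
    EX u x * D.Xc r = D.Xc r * EX u x := by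
  rw [EX, mul_assoc, X, Xhat_mul_Xc, ← mul_assoc, toDA_mul_Xc, mul_assoc]

theorem dualRoot_dual_α (i : Fin n) : dualRoot D.dual.kind (D.dual.α i) = D.α i :=
  dualRoot_dualRoot _ (D.based.simple_ne_zero i)

theorem sref_dual_α (i : Fin n) : sref (D.dual.α i) = sref (D.α i) :=
  sref_dualRoot _ (D.based.simple_ne_zero i)

theorem toDA_emb_simple (i : Fin n) : D.toDA (D.Tw (D.emb (sref (D.α i)))) = D.T i.succ := by
  rw [← s_succ, toDA_Tw_s]

/-- The Bernstein relations for `D` are satisfied by the elements `T_{v⁻¹}` and `X^{-ξ}` in the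
opposite of the double affine braid group of the dual data. -/
def dualData (D : InitialData Z n) : BernsteinData D (D.dual.DABraid)ᵐᵒᵖ where
  T v := op (D.dual.toDA (D.dual.Tw (D.dual.emb v⁻¹)))
  Y ξ := op (D.dual.X (-D.toLam ξ))
  T_mul := by
    intro v hv w hw h
    have h' := h.dual hv hw
    have hv' : v⁻¹ ∈ weyl D.dual.R₀ := by rw [D.weyl_dual]; exact inv_mem hv
    have hw' : w⁻¹ ∈ weyl D.dual.R₀ := by rw [D.weyl_dual]; exact inv_mem hw
    rw [← op_mul, mul_inv_rev, ← map_mul]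
    congr 2
    exact D.dual.braidData.T_mul _ hw' _ hv' h'
  Y_add := by
    intro ξ η
    rw [← op_mul, ← X_add, map_add, neg_add_rev]
  comm := by
    intro i ξ h
    rw [sref_inv, ← sref_dual_α, toDA_emb_simple, ← op_mul, ← op_mul]
    congr 1
    refine (rel_comm i.succ _ ?_).symm
    change ⟪((-D.toLam ξ : D.dual.Lam) : Z), coroot (D.dual.α i)⟫ = 0
    rw [Submodule.coe_neg, coe_toLam, inner_neg_left, neg_eq_zero]
    exact h
  cross := by
    intro i ξ η h hη
    rw [sref_inv, ← sref_dual_α, toDA_emb_simple, ← op_mul, ← op_mul]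
    congr 1
    have h1 : ⟪((-D.toLam η : D.dual.Lam) : Z), coroot (D.dual.α i)⟫ = 1 := by
      rw [Submodule.coe_neg, coe_toLam, inner_neg_left, hη, ← sref_dual_α, ← (sref (D.dual.α i)).inner_map_map,
        sref_sref, ← coroot_map, sref_self (D.dual.based.simple_ne_zero i)]
      have : coroot (-D.dual.α i) = - coroot (D.dual.α i) := by simp [coroot]
      rw [this, inner_neg_right, neg_neg]
      exact h
    rw [← mul_assoc]
    refine (rel_cross i.succ _ h1).trans ?_
    rw [X]
    congr 1
    apply Subtype.ext
    rw [coe_act, s_succ, emb_apply (D.dual.based.simple_mem_weyl i)]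
    change (sref (D.dual.α i) ((-D.toLam η : D.dual.Lam) : Z), (0 : ℝ)) =
      (((-D.toLam ξ : D.dual.Lam) : Z), 0)
    rw [Submodule.coe_neg, Submodule.coe_neg, coe_toLam, coe_toLam, map_neg, hη, sref_dual_α, sref_sref]

/-- Under duality `E(w)` corresponds to `E(v⁻¹) X^{-ξ}` for `w = τ(ξ) v`. -/
theorem dualData_E {w : D.W} : D.dualData.E w =
    op (EX (D := D.dual) (D.lin w)⁻¹ (-D.toLam (D.tr w))) := by
  have h : (D.lin w)⁻¹ ∈ weyl D.dual.R₀ := by rw [D.weyl_dual]; exact inv_mem (D.lin_mem w)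
  rw [EX, BernsteinData.E_emb _ h, map_inv, op_mul, op_inv]
  rfl

/-- The action of the dual antihomomorphism on the lattice part. -/
def dualX (D : InitialData Z n) : Multiplicative D.LamHat →* (D.dual.DABraid)ᵐᵒᵖ where
  toFun x := op (D.dual.Y (-D.toLamD ⟨(x.toAdd : Z × ℝ).1, D.mem_LamHat.1 x.toAdd.2⟩) *
    D.dual.Xc (x.toAdd : Z × ℝ).2)
  map_one' := by
    have : -D.toLamD ⟨((1 : Multiplicative D.LamHat).toAdd : Z × ℝ).1,
        D.mem_LamHat.1 (1 : Multiplicative D.LamHat).toAdd.2⟩ = 0 := Subtype.ext neg_zero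
    rw [this, Y_zero, one_mul]
    exact congrArg op Xc_zero
  map_mul' := by
    intro x y
    rw [← op_mul]
    congr 1
    have h1 : -D.toLamD ⟨((x * y).toAdd : Z × ℝ).1, D.mem_LamHat.1 (x * y).toAdd.2⟩ =
        -D.toLamD ⟨(y.toAdd : Z × ℝ).1, D.mem_LamHat.1 y.toAdd.2⟩ +
        -D.toLamD ⟨(x.toAdd : Z × ℝ).1, D.mem_LamHat.1 x.toAdd.2⟩ :=
      Subtype.ext (neg_add_rev _ _)
    have h2 : D.dual.Xc ((x * y).toAdd : Z × ℝ).2 =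
        D.dual.Xc (y.toAdd : Z × ℝ).2 * D.dual.Xc (x.toAdd : Z × ℝ).2 := by
      rw [← Xc_add, add_comm]
      rfl
    rw [h1, h2, Y_add, mul_assoc, mul_assoc, ← mul_assoc (D.dual.Y _) (D.dual.Xc _), Y_mul_Xc]
    simp only [mul_assoc]

theorem dualX_apply (x : D.LamHat) (l : D.dual.LamD) (h : (l : Z) = -(x : Z × ℝ).1) :
    D.dualX (Multiplicative.ofAdd x) = op (D.dual.Y l * D.dual.Xc (x : Z × ℝ).2) := by
  have : l = -D.toLamD ⟨(x : Z × ℝ).1, D.mem_LamHat.1 x.2⟩ := Subtype.ext h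
  rw [this]
  rfl

/-- The duality antihomomorphism on the free product of the affine braid group and the lattice. -/
def preDelta (D : InitialData Z n) : D.FreeProd →* (D.dual.DABraid)ᵐᵒᵖ :=
  Monoid.Coprod.lift D.dualData.lift D.dualX

theorem preDelta_fT (w : D.W) : D.preDelta (D.fT w) = D.dualData.lift (D.Tw w) :=
  Monoid.Coprod.lift_apply_inl _ _ _

theorem preDelta_fX (x : D.LamHat) (l : D.dual.LamD) (h : (l : Z) = -(x : Z × ℝ).1) :
    D.preDelta (D.fX x) = op (D.dual.Y l * D.dual.Xc (x : Z × ℝ).2) := by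
  rw [← dualX_apply x l h]
  exact Monoid.Coprod.lift_apply_inr _ _ _

theorem preDelta_s_succ (i : Fin n) : D.preDelta (D.fT (D.s i.succ)) = op (D.dual.T i.succ) := by
  have hs := D.based.simple_mem_weyl i
  rw [preDelta_fT, s_succ, BernsteinData.lift_Tw _ (inv_mem hs) (good_emb hs), BernsteinData.P,
    ← emb_mul (inv_mem hs) hs, inv_mul_cancel, emb_one, BernsteinData.E_one, mul_one,
    BernsteinData.E_emb _ (inv_mem hs), inv_inv, inv_inv, ← toDA_emb_simple, sref_dual_α]
  change op (D.dual.toDA (D.dual.Tw (D.dual.emb (sref (D.α i))⁻¹))) = _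
  rw [sref_inv]

theorem good_one_s_zero : Good (1 : Z ≃ₗᵢ[ℝ] Z) (D.s 0) := by
  intro x hx hp hn
  rw [inv_simple hx hp hn]
  change ⟪D.rho, (D.a 0).1⟫ < 0
  rw [a_zero, inner_neg_right]
  linarith [D.beta_pos]

/-- The image of `T₀` is `E(s) X^{-β^d}` with `s = s_β`, because `s₀ = τ(β^d) s_β` and the
fundamental chamber is good for `s₀`. -/
theorem preDelta_s_zero (x : D.dual.Lam) (hx : (x : Z) = -dualRoot D.kind (D.beta : Z)) :
    D.preDelta (D.fT (D.s 0)) = op (EX (D := D.dual) (sref (dualRoot D.kind (D.beta : Z))) x) := by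
  have hb := ne_zero D.beta.2
  rw [preDelta_fT, BernsteinData.lift_Tw_one _ good_one_s_zero, dualData_E]
  have h1 : (D.lin (D.s 0))⁻¹ = sref (dualRoot D.kind (D.beta : Z)) := by
    rw [lin_s, a_zero, sref_neg, sref_inv, sref_dualRoot _ hb]
  have h2 : -D.toLam (D.tr (D.s 0)) = x := by
    apply Subtype.ext
    rw [Submodule.coe_neg, coe_toLam, s_zero, tr_mul, (lin_tr_tau _).1, (lin_tr_tau _).2,
      (lin_tr_emb (sref_mem_weyl D.beta.2)).2, hx]
    simp
  rw [h1, h2]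

/-- The image of `ω = τ(ξ) v ∈ Ω` is `E(v⁻¹) X^{-ξ}`, since every chamber is good for `ω`. -/
theorem preDelta_length_zero {w : D.W} (h : D.length w = 0) :
    D.preDelta (D.fT w) = op (EX (D := D.dual) (D.lin w)⁻¹ (-D.toLam (D.tr w))) := by
  rw [preDelta_fT, BernsteinData.lift_Tw_one, dualData_E]
  intro x hx hp hn
  refine absurd ?_ hn
  rw [length_eq_zero_iff] at h
  by_contra hc
  have hm := W_mem_Rb w⁻¹ hx
  have := h _ (neg_mem_Rb hm) ((apos_neg_iff hm).2 hc)
  rw [map_neg, W_apply_inv_apply, apos_neg_iff hx] at this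
  exact this hp

/-- For `w = τ(ξ) v` of length zero, `X^{-ξ}` may be moved through all walls: `w` permutes the
positive affine roots, so `ξ` pairs to `0` or `±1` with every `(b^d)^∨`, and the sign is determined
by the signs of `b` and `v⁻¹ b`. -/
theorem compat_length_zero {w : D.W} (h : D.length w = 0) {b : Z} (hb : b ∈ D.R₀) {y a : Z × ℝ}
    (hy : y.1 = -(D.tr w : Z)) (ha : a.1 = dualRoot D.kind b) :
    Compat (D := D.dual) (D.dual.emb (D.lin w)⁻¹) 1 y a := by
  rw [length_eq_zero_iff] at h
  have hw : (D.lin w)⁻¹ ∈ weyl D.R₀ := inv_mem (D.lin_mem w)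
  have hw' : (D.lin w)⁻¹ ∈ weyl D.dual.R₀ := by rwa [D.weyl_dual]
  have hb0 := ne_zero hb
  have hμ := mu_pos D.kind hb0
  set c := (D.lin w)⁻¹ b with hc
  have hcm : c ∈ D.R₀ := weyl_mem hw hb
  have hwc : D.lin w c = b := by rw [hc, ← isom_mul_apply (D.lin w), mul_inv_cancel]; rfl
  have hμc : mu D.kind c = mu D.kind b := mu_map _ _ _
  obtain ⟨k, hk⟩ := D.inner_coroot_dualRoot_int _ (D.tr w).2 b hb
  have hin : ⟪b, (D.tr w : Z)⟫ = mu D.kind b * k := by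
    rw [real_inner_comm, inner_eq_mu_mul D.kind hb0, hk]
  unfold Compat
  rw [(lin_tr_emb hw').1, lin_one, hy, ha, inner_neg_left, hk, ← dualRoot_map, ← hc, D.dual_rho_pos hcm,
    dual_rho_neg hcm]
  change (_ ∧ (_ ↔ 0 < ⟪D.dual.rho, dualRoot D.kind b⟫)) ∨
    (_ ∧ _ ∧ ⟪D.dual.rho, dualRoot D.kind b⟫ < 0) ∨ (_ ∧ _ ∧ 0 < ⟪D.dual.rho, dualRoot D.kind b⟫)
  rw [D.dual_rho_pos hb, dual_rho_neg hb]
  have h0b := D.based.ht_ne_zero hb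
  rcases lt_or_gt_of_ne (D.based.ht_ne_zero hcm) with hp | hp
  · have p1 := h (-c, 0) (mk_zero_mem_Rb (D.neg_mem hcm))
      (Or.inr ⟨rfl, by rw [inner_neg_right]; linarith⟩)
    have p2 := h (c, mu D.kind c) (mk_mu_mem_Rb hcm) (Or.inl (mu_pos _ (ne_zero hcm)))
    rw [D.apply_eq w] at p1 p2
    simp only [APos, map_neg, hwc, inner_neg_left, inner_neg_right, hin, hμc] at p1 p2
    have k1 : (0 : ℤ) ≤ k := by
      by_contra hk0
      have : (k : ℝ) ≤ -1 := by exact_mod_cast (by omega : k ≤ -1)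
      have := mul_le_mul_of_nonneg_left this hμ.le
      rcases p1 with p | p <;> linarith
    have k2 : k ≤ 1 := by
      by_contra hk0
      have : (2 : ℝ) ≤ k := by exact_mod_cast (by omega : 2 ≤ k)
      have := mul_le_mul_of_nonneg_left this hμ.le
      rcases p2 with p | p <;> linarith
    obtain rfl | rfl : k = 0 ∨ k = 1 := by omega
    · have : ⟪D.rho, b⟫ < 0 := by simpa using p1
      exact Or.inl ⟨by simp, ⟨fun h => by linarith, fun h => by linarith⟩⟩
    · have : 0 < ⟪D.rho, b⟫ := by simpa using p2
      exact Or.inr (Or.inr ⟨by simp, hp, this⟩)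
  · have p1 := h (c, 0) (mk_zero_mem_Rb hcm) (Or.inr ⟨rfl, hp⟩)
    have p2 := h (-c, mu D.kind (-c)) (mk_mu_mem_Rb (D.neg_mem hcm))
      (Or.inl (mu_pos _ (ne_zero (D.neg_mem hcm))))
    rw [D.apply_eq w] at p1 p2
    simp only [APos, map_neg, hwc, inner_neg_left, inner_neg_right, hin, mu_neg, hμc] at p1 p2
    have k1 : k ≤ 0 := by
      by_contra hk0
      have : (1 : ℝ) ≤ k := by exact_mod_cast (by omega : 1 ≤ k)
      have := mul_le_mul_of_nonneg_left this hμ.le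
      rcases p1 with p | p <;> linarith
    have k2 : -1 ≤ k := by
      by_contra hk0
      have : (k : ℝ) ≤ -2 := by exact_mod_cast (by omega : k ≤ -2)
      have := mul_le_mul_of_nonneg_left this hμ.le
      rcases p2 with p | p <;> linarith
    obtain rfl | rfl : k = 0 ∨ k = -1 := by omega
    · have : 0 < ⟪D.rho, b⟫ := by simpa using p1
      exact Or.inl ⟨by simp, ⟨fun _ => this, fun _ => hp⟩⟩
    · have : ⟪D.rho, b⟫ < 0 := by simpa using p2
      exact Or.inr (Or.inl ⟨by simp, hp, this⟩)

theorem preDelta_rel_comm (i : Fin (n + 1)) (x : D.LamHat)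
    (h : ⟪(x : Z × ℝ).1, coroot (D.a i).1⟫ = 0) :
    D.preDelta (D.fT (D.s i)) * D.preDelta (D.fX x) =
      D.preDelta (D.fX x) * D.preDelta (D.fT (D.s i)) := by
  set l : D.dual.LamD := -D.toLamD ⟨(x : Z × ℝ).1, D.mem_LamHat.1 x.2⟩ with hl
  have hl' : (l : Z) = -(x : Z × ℝ).1 := rfl
  rw [preDelta_fX x l hl']
  revert h
  refine Fin.cases (fun h => ?_) (fun j h => ?_) i
  · have hb := ne_zero D.beta.2
    set y : D.dual.Lam := -D.toLam ⟨_, D.dualRoot_mem _ D.beta.2⟩ with hy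
    rw [preDelta_s_zero y rfl, ← op_mul, ← op_mul]
    congr 1
    have h1 : ⟪(l : Z), dualRoot D.kind (D.beta : Z)⟫ = 0 := by
      rw [a_zero, inner_coroot_eq_zero (neg_ne_zero.2 hb), inner_neg_right] at h
      rw [hl', dualRoot, inner_smul_right, inner_neg_left,
        (inner_coroot_eq_zero hb).2 (neg_eq_zero.1 h)]
      simp
    have h2 := Y_comm_EX_short D.dual_beta_dom D.dual_isShort_beta y rfl l h1
    rw [mul_assoc, ← EX_mul_Xc, ← mul_assoc, h2, mul_assoc]
  · rw [preDelta_s_succ, ← op_mul, ← op_mul]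
    congr 1
    have h1 := D.dual.braidData.comm j l (by
      rw [dualRoot_dual_α, hl', inner_neg_left, neg_eq_zero]
      exact h)
    have h2 := congrArg D.dual.toDA h1
    rw [map_mul, map_mul] at h2
    change D.dual.toDA (D.dual.Tw (D.dual.emb (sref (D.dual.α j)))) * D.dual.Y l =
      D.dual.Y l * D.dual.toDA (D.dual.Tw (D.dual.emb (sref (D.dual.α j)))) at h2
    rw [← toDA_emb_simple, mul_assoc, ← toDA_mul_Xc, ← mul_assoc, ← h2, mul_assoc]

theorem preDelta_rel_cross (i : Fin (n + 1)) (x : D.LamHat)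
    (h : ⟪(x : Z × ℝ).1, coroot (D.a i).1⟫ = 1) :
    D.preDelta (D.fT (D.s i)) * D.preDelta (D.fX x) * D.preDelta (D.fT (D.s i)) =
      D.preDelta (D.fX (D.act (D.s i) x)) := by
  set l : D.dual.LamD := -D.toLamD ⟨(x : Z × ℝ).1, D.mem_LamHat.1 x.2⟩ with hl
  have hl' : (l : Z) = -(x : Z × ℝ).1 := rfl
  set m : D.dual.LamD := -D.toLamD ⟨(D.act (D.s i) x : Z × ℝ).1, D.mem_LamHat.1 (D.act (D.s i) x).2⟩ with hm
  have hm' : (m : Z) = -(D.act (D.s i) x : Z × ℝ).1 := rfl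
  have hact : (D.act (D.s i) x : Z × ℝ) = (x : Z × ℝ) - D.a i := by
    rw [coe_act, s_apply, real_inner_comm, h, one_smul]
  have hml : (m : Z) = sref (D.a i).1 l := by
    rw [hm', hl', coe_act, apply_fst, lin_s, map_neg]
  rw [preDelta_fX x l hl', preDelta_fX _ m hm']
  clear_value l m
  have hact2 : (D.act (D.s i) x : Z × ℝ).2 = (x : Z × ℝ).2 - (D.a i).2 := by rw [hact]; rfl
  rw [hact2]
  clear hm hm' hact hact2
  revert h hml
  refine Fin.cases (fun h hml => ?_) (fun j h hml => ?_) i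
  · have hb := ne_zero D.beta.2
    set y : D.dual.Lam := -D.toLam ⟨_, D.dualRoot_mem _ D.beta.2⟩ with hy
    rw [preDelta_s_zero y rfl, ← op_mul, ← op_mul]
    congr 1
    have hneg : coroot (-(D.beta : Z)) = -coroot (D.beta : Z) := by simp [coroot]
    have hμ : mu D.dual.kind (dualRoot D.kind (D.beta : Z)) = mu D.kind (D.beta : Z) :=
      mu_dualRoot _ hb
    have h1 : ⟪(l : Z), dualRoot D.kind (D.beta : Z)⟫ =
        mu D.dual.kind (dualRoot D.kind (D.beta : Z)) := by
      rw [a_zero, hneg, inner_neg_right] at h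
      rw [hl', dualRoot, inner_smul_right, inner_neg_left, h, ← dualRoot, hμ, mul_one]
    have h2 := EX_short_cross D.dual_beta_dom D.dual_isShort_beta y rfl l m h1 (by
      rw [hml, a_zero, sref_neg, sref_dualRoot _ hb])
    rw [mul_assoc (D.dual.Y l), ← EX_mul_Xc, ← mul_assoc, ← mul_assoc, h2, mul_assoc, ← Xc_add, hμ, a_zero]
    congr 2
    change _ = (x : Z × ℝ).2 - mu D.kind (D.beta : Z)
    ring
  · rw [preDelta_s_succ, ← op_mul, ← op_mul]
    congr 1
    have hα := D.based.simple_ne_zero j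
    have h1 := D.dual.braidData.cross j m l (by
      rw [dualRoot_dual_α, hml, a_succ, ← (sref (D.α j)).inner_map_map, sref_sref, ← coroot_map,
        sref_self hα, hl']
      have : coroot (-D.α j) = - coroot (D.α j) := by simp [coroot]
      rw [this, inner_neg_neg]
      exact h) (by rw [hml, a_succ, sref_dual_α, sref_sref])
    have h2 := congrArg D.dual.toDA h1
    rw [map_mul, map_mul] at h2
    change D.dual.toDA (D.dual.Tw (D.dual.emb (sref (D.dual.α j)))) * D.dual.Y l *
      D.dual.toDA (D.dual.Tw (D.dual.emb (sref (D.dual.α j)))) = D.dual.Y m at h2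
    rw [← toDA_emb_simple, mul_assoc (D.dual.Y l), ← toDA_mul_Xc, ← mul_assoc, ← mul_assoc, h2, a_succ,
      sub_zero]

theorem preDelta_rel_omega (w : D.W) (hw : D.length w = 0) (x : D.LamHat) :
    D.preDelta (D.fT w) * D.preDelta (D.fX x) =
      D.preDelta (D.fX (D.act w x)) * D.preDelta (D.fT w) := by
  set l : D.dual.LamD := -D.toLamD ⟨(x : Z × ℝ).1, D.mem_LamHat.1 x.2⟩ with hl
  have hl' : (l : Z) = -(x : Z × ℝ).1 := rfl
  set m : D.dual.LamD := -D.toLamD ⟨(D.act w x : Z × ℝ).1, D.mem_LamHat.1 (D.act w x).2⟩ with hm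
  have hm' : (m : Z) = -(D.act w x : Z × ℝ).1 := rfl
  rw [preDelta_fX x l hl', preDelta_fX _ m hm', preDelta_length_zero hw, ← op_mul, ← op_mul]
  congr 1
  have hlin : (D.lin w)⁻¹ ∈ weyl D.dual.R₀ := by rw [D.weyl_dual]; exact inv_mem (D.lin_mem w)
  have hml : (m : Z) = D.lin w l := by
    rw [hm', hl', coe_act, apply_fst, map_neg]
  have h1 := Y_mul_EX (D := D.dual) hlin (-D.toLam (D.tr w)) m l (by
    rw [hml, ← isom_mul_apply, inv_mul_cancel]
    rfl) (by
    intro a ha _ _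
    obtain ⟨b, hb, hba⟩ := Rb_fst ha
    exact compat_length_zero hw hb rfl hba.symm)
  rw [mul_assoc, ← EX_mul_Xc, ← mul_assoc, h1, mul_assoc, mul_assoc, Y_mul_Xc, ← mul_assoc (D.dual.Xc _),
    ← Xc_add, ← Y_mul_Xc]
  congr 3
  change _ = (w.1 (x : Z × ℝ)).2
  rw [D.apply_eq w, Submodule.coe_neg, coe_toLam, hml, hl', map_neg, inner_neg_neg, real_inner_comm]
  ring

/-- The duality antihomomorphism. -/
def deltaHom (D : InitialData Z n) : D.DABraid →* (D.dual.DABraid)ᵐᵒᵖ :=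
  QuotientGroup.lift _ D.preDelta (Subgroup.normalClosure_le_normal (by
    rintro _ (⟨i, x, h⟩ | ⟨i, x, h⟩ | ⟨w, hw, x⟩)
    · change D.preDelta _ = 1
      rw [map_mul, map_inv, mul_inv_eq_one, map_mul, map_mul]
      exact preDelta_rel_comm i x h
    · change D.preDelta _ = 1
      rw [map_mul, map_inv, mul_inv_eq_one, map_mul, map_mul]
      exact preDelta_rel_cross i x h
    · change D.preDelta _ = 1
      rw [map_mul, map_inv, mul_inv_eq_one, map_mul, map_mul]
      exact preDelta_rel_omega w hw x))

theorem deltaHom_T (i : Fin n) : D.deltaHom (D.T i.succ) = op (D.dual.T i.succ) := preDelta_s_succ i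

theorem deltaHom_Xc (r : ℝ) : D.deltaHom (D.Xc r) = op (D.dual.Xc r) := by
  refine (preDelta_fX _ 0 neg_zero.symm).trans ?_
  rw [Y_zero, one_mul]

theorem deltaHom_X (l : D.Lam) : D.deltaHom (D.X l) = op (D.dual.Y (-D.toLamD l)) := by
  refine (preDelta_fX _ (-D.toLamD l) rfl).trans ?_
  exact congrArg op (by rw [Xc_zero, mul_one])

theorem deltaHom_Y (ξ : D.LamD) : D.deltaHom (D.Y ξ) = op (D.dual.X (-D.toLam ξ)) := by
  have hdom : ∀ ξ : D.LamD, D.IsDominant ξ → D.deltaHom (D.Y ξ) = op (D.dual.X (-D.toLam ξ)) := by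
    intro ξ h
    have h1 : D.deltaHom (D.Y ξ) = D.preDelta (Monoid.Coprod.inl (bY ξ)) := rfl
    rw [h1, bY_of_dominant h]
    refine (preDelta_fT (D.tau ξ)).trans ?_
    rw [BernsteinData.lift_Tw_one _ (good_tau h), BernsteinData.E_tau]
    rfl
  obtain ⟨ζ, h1, h2⟩ := exists_strictDom D ξ
  have h3 := hdom _ h2.isDominant
  rw [Y_add, map_mul, hdom _ h1.isDominant, map_add, neg_add_rev, X_add, op_mul] at h3
  exact mul_left_cancel h3

end InitialData

namespace InitialData

variable {Z : Type*} [NormedAddCommGroup Z] [InnerProductSpace ℝ Z] [FiniteDimensional ℝ Z] {n : ℕ}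
  {D : InitialData Z n}

open MulOpposite

/-! ### The duality antiisomorphism -/

/-- The dual of the dual data are the given data; this turns the antihomomorphism for the dual
data into an inverse of the duality antihomomorphism. -/
theorem dual_dual (D : InitialData Z n) : D.dual.dual = D := by
  have h1 : dualRoot D.kind '' (dualRoot D.kind '' D.R₀) = D.R₀ := by
    ext x
    simp only [Set.mem_image, exists_exists_and_eq_and]
    constructor
    · rintro ⟨b, hb, rfl⟩
      rwa [dualRoot_dualRoot _ (ne_zero hb)]
    · exact fun hx => ⟨x, hx, dualRoot_dualRoot _ (ne_zero hx)⟩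
  have h2 : (fun i => dualRoot D.kind (dualRoot D.kind (D.α i))) = D.α :=
    funext fun i => dualRoot_dualRoot _ (D.based.simple_ne_zero i)
  cases D
  simp only [dual, InitialData.mk.injEq] at h1 h2 ⊢
  exact ⟨h1, h2, trivial, trivial, trivial⟩

/-- The formulas characterizing the duality antihomomorphism, for data `D` and `D'` dual to each
other. -/
structure IsDelta {D D' : InitialData Z n} (f : D.DABraid →* (D'.DABraid)ᵐᵒᵖ) : Prop where
  Xc : ∀ r : ℝ, f (D.Xc r) = op (D'.Xc r)
  T : ∀ i : Fin n, f (D.T i.succ) = op (D'.T i.succ)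
  X : ∀ (l : D.Lam) (l' : D'.LamD), (l' : Z) = -l → f (D.X l) = op (D'.Y l')
  Y : ∀ (ξ : D.LamD) (ξ' : D'.Lam), (ξ' : Z) = -ξ → f (D.Y ξ) = op (D'.X ξ')

theorem isDelta_deltaHom (D : InitialData Z n) : IsDelta D.deltaHom where
  Xc := deltaHom_Xc
  T := deltaHom_T
  X l l' h := by
    rw [deltaHom_X]
    congr 2
    exact Subtype.ext h.symm
  Y ξ ξ' h := by
    rw [deltaHom_Y]
    congr 2
    exact Subtype.ext h.symm

theorem IsDelta.eq_deltaHom {f : D.DABraid →* (D.dual.DABraid)ᵐᵒᵖ} (h : IsDelta f) :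
    f = D.deltaHom := by
  refine DABraid_hom_ext (fun r => ?_) (fun l => ?_) (fun ξ => ?_) fun i => ?_
  · rw [h.Xc, deltaHom_Xc]
  · rw [deltaHom_X]
    exact h.X _ _ rfl
  · rw [deltaHom_Y]
    exact h.Y _ _ rfl
  · rw [h.T, deltaHom_T]

/-- The duality antihomomorphism, with its target replaced by data equal to the dual data. -/
theorem exists_isDelta {D D' : InitialData Z n} (h : D.dual = D') :
    ∃ f : D.DABraid →* (D'.DABraid)ᵐᵒᵖ, IsDelta f := by
  subst h
  exact ⟨_, D.isDelta_deltaHom⟩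

theorem IsDelta.unop_unop {D' : InitialData Z n} (h : ∀ l : Z, l ∈ D'.LamD ↔ l ∈ D.Lam)
    (h' : ∀ l : Z, l ∈ D'.Lam ↔ l ∈ D.LamD) {f : D.DABraid →* (D'.DABraid)ᵐᵒᵖ}
    {g : D'.DABraid →* (D.DABraid)ᵐᵒᵖ} (hf : IsDelta f) (hg : IsDelta g) (x : D.DABraid) :
    unop (g (unop (f x))) = x := by
  let F : D.DABraid →* D.DABraid :=
    { toFun := fun x => unop (g (unop (f x)))
      map_one' := by simp
      map_mul' := fun x y => by simp }
  suffices H : F = MonoidHom.id _ from DFunLike.congr_fun H x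
  refine DABraid_hom_ext (fun r => ?_) (fun l => ?_) (fun ξ => ?_) fun i => ?_
  · change unop (g (unop (f (D.Xc r)))) = _
    rw [hf.Xc, unop_op, hg.Xc, unop_op]
    rfl
  · change unop (g (unop (f (D.X l)))) = _
    rw [hf.X l ⟨-l, (h _).2 (D.Lam.neg_mem l.2)⟩ rfl, unop_op, hg.Y _ l (neg_neg _).symm, unop_op]
    rfl
  · change unop (g (unop (f (D.Y ξ)))) = _
    rw [hf.Y ξ ⟨-ξ, (h' _).2 (D.LamD.neg_mem ξ.2)⟩ rfl, unop_op, hg.X _ ξ (neg_neg _).symm, unop_op]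
    rfl
  · change unop (g (unop (f (D.T i.succ)))) = _
    rw [hf.T, unop_op, hg.T, unop_op]
    rfl

/-- The antihomomorphism for the dual data, as a map back to the double affine braid group of the
given data. -/
theorem exists_deltaInv (D : InitialData Z n) :
    ∃ g : D.dual.DABraid →* (D.DABraid)ᵐᵒᵖ, IsDelta g := exists_isDelta D.dual_dual

/-- The duality antiisomorphism. -/
def delta (D : InitialData Z n) : D.DABraid ≃* (D.dual.DABraid)ᵐᵒᵖ where
  toFun := D.deltaHom
  invFun y := unop (D.exists_deltaInv.choose (unop y))
  left_inv x := IsDelta.unop_unop (fun _ => Iff.rfl) (fun _ => Iff.rfl) D.isDelta_deltaHom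
    D.exists_deltaInv.choose_spec x
  right_inv y := unop_injective (IsDelta.unop_unop (fun _ => Iff.rfl) (fun _ => Iff.rfl)
    D.exists_deltaInv.choose_spec D.isDelta_deltaHom (unop y))
  map_mul' := map_mul _

theorem isDuality_delta (D : InitialData Z n) : IsDuality D.delta where
  Xc := deltaHom_Xc
  T := deltaHom_T
  X := deltaHom_X
  Y := deltaHom_Y

theorem IsDuality.eq_delta {δ : D.DABraid ≃* (D.dual.DABraid)ᵐᵒᵖ} (h : IsDuality δ) :
    δ = D.delta := by
  have : (δ : D.DABraid →* (D.dual.DABraid)ᵐᵒᵖ) = D.deltaHom :=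
    DABraid_hom_ext (fun r => (h.Xc r).trans (deltaHom_Xc r).symm)
      (fun l => (h.X l).trans (deltaHom_X l).symm) (fun ξ => (h.Y ξ).trans (deltaHom_Y ξ).symm)
      fun i => (h.T i).trans (deltaHom_T i).symm
  refine MulEquiv.ext fun x => ?_
  exact DFunLike.congr_fun this x

end InitialData

namespace InitialData

variable {Z : Type*} [NormedAddCommGroup Z] [InnerProductSpace ℝ Z] [FiniteDimensional ℝ Z] {n : ℕ}
  {D : InitialData Z n}

open MulOpposite

/-! ### Conjugates of `T₀` -/

/-- `U_b = Y^{b^d} T_{s_b}⁻¹` for a root `b`. -/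
def U (b : D.R₀) : D.Braid :=
  bY ⟨dualRoot D.kind (b : Z), D.dualRoot_mem _ b.2⟩ * (D.Tw (D.emb (sref (b : Z))))⁻¹

theorem Tw_s_zero : D.Tw (D.s 0) = U D.beta := by
  have h1 : (D.lin (D.s 0))⁻¹ = sref (D.beta : Z) := by
    rw [lin_s, a_zero, sref_neg, sref_inv]
  have h2 : D.tr (D.s 0) = ⟨dualRoot D.kind (D.beta : Z), D.dualRoot_mem _ D.beta.2⟩ := by
    apply Subtype.ext
    rw [s_zero, tr_mul, (lin_tr_tau _).1, (lin_tr_tau _).2,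
      (lin_tr_emb (sref_mem_weyl D.beta.2)).2]
    simp
  rw [Tw_eq_E_of_good_one good_one_s_zero, BernsteinData.E, h1, h2]
  rfl

/-- `T_{s_c} = Tᵢ T_{s_b} Tᵢ` for `c = sᵢ b`, if `b` is positive and `(b, αᵢ) < 0`. -/
theorem Tw_sref_sref {b : Z} (hb : b ∈ D.R₀) (hp : 0 < ⟪D.rho, b⟫) {i : Fin n}
    (hi : ⟪b, D.α i⟫ < 0) : D.Tw (D.emb (sref (sref (D.α i) b))) =
      D.Tw (D.emb (sref (D.α i))) * D.Tw (D.emb (sref b)) * D.Tw (D.emb (sref (D.α i))) := by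
  have hs := D.based.simple_mem_weyl i
  have hsb := sref_mem_weyl hb
  have hα := D.isBasis.mem i
  have hb0 := ne_zero hb
  have hk : ⟪D.α i, coroot b⟫ < 0 := (inner_coroot_neg hb0).2 (by rwa [real_inner_comm])
  have hpos : 0 < ⟪D.rho, sref b (D.α i)⟫ := by
    rw [sref_apply, inner_sub_right, inner_smul_right, D.based.ht]
    have := mul_neg_of_neg_of_pos hk hp
    linarith
  have hne : sref b (D.α i) ≠ D.α i := by
    rw [sref_apply]
    intro h
    rcases smul_eq_zero.1 (sub_eq_self.1 h) with h | h
    · exact hk.ne h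
    · exact hb0 h
  have h1 : D.Tw (D.emb (sref (D.α i) * sref b)) =
      D.Tw (D.emb (sref (D.α i))) * D.Tw (D.emb (sref b)) := by
    refine D.braidData.T_mul _ hs _ hsb fun c hc hcp hcn => ?_
    have hm := weyl_mem hsb hc
    have := D.based.sref_pos (i := i) (D.neg_mem hm) (by rw [inner_neg_right]; linarith) (by
      intro h
      have h2 : c = -sref b (D.α i) := by rw [← h, map_neg, sref_sref, neg_neg]
      rw [h2, inner_neg_right] at hcp
      linarith)
    rw [map_neg, inner_neg_right] at this
    linarith
  rw [sref_map, sref_inv, ← h1]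
  refine D.braidData.T_mul_simple (mul_mem hs hsb) ?_
  rw [isom_mul_apply]
  exact D.based.sref_pos (weyl_mem hsb hα) hpos hne

/-- `U_b` and `U_{s_i b}` are conjugate if `b^d` is a short root of `R₀^d` and `(b, α_i) < 0`. -/
theorem U_sref {b c : D.R₀} (hb : D.dual.IsShort (dualRoot D.kind (b : Z))) (hp : 0 < ⟪D.rho, (b : Z)⟫)
    {i : Fin n} (hi : ⟪(b : Z), D.α i⟫ < 0) (hc : (c : Z) = sref (D.α i) b) : IsConj (U b) (U c) := by
  have hα0 := D.based.simple_ne_zero i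
  have hb0 := ne_zero b.2
  have hαm : dualRoot D.kind (D.α i) ∈ D.dual.R₀ := ⟨_, D.isBasis.mem i, rfl⟩
  have hneg : ⟪dualRoot D.kind (b : Z), dualRoot D.kind (D.α i)⟫ < 0 := by
    have h1 : 0 < ⟪dualRoot D.kind (b : Z), dualRoot D.kind (-D.α i)⟫ := by
      rw [inner_dualRoot_pos _ (neg_ne_zero.2 hα0), inner_dualRoot_pos' _ hb0, inner_neg_right]
      linarith
    rw [dualRoot_neg, inner_neg_right] at h1
    linarith
  have hpair : ⟪dualRoot D.kind (b : Z), coroot (dualRoot D.kind (D.α i))⟫ = -1 := by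
    have h2 := (inner_coroot_neg (dualRoot_ne_zero D.kind hα0)).2 hneg
    rcases D.dual.isRootSystem.inner_coroot_short hb.1 hαm (by
      intro h
      rw [h] at hneg
      exact absurd hneg (not_lt.2 real_inner_self_nonneg)) (by
      intro h
      rw [← dualRoot_neg] at h
      have h3 := congrArg (dualRoot D.kind) h
      rw [dualRoot_dualRoot _ hb0, dualRoot_dualRoot _ (neg_ne_zero.2 hα0)] at h3
      rw [h3, inner_neg_right, D.based.ht] at hp
      linarith) (hb.2 _ hαm) with h | h | h
    · linarith
    · linarith
    · exact h
  have hcd : dualRoot D.kind (c : Z) = sref (D.α i) (dualRoot D.kind (b : Z)) := by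
    rw [hc, dualRoot_map]
  have hcross := D.braidData.cross i ⟨dualRoot D.kind (c : Z), D.dualRoot_mem _ c.2⟩
    ⟨dualRoot D.kind (b : Z), D.dualRoot_mem _ b.2⟩ (by
      change ⟪dualRoot D.kind (c : Z), coroot (dualRoot D.kind (D.α i))⟫ = 1
      rw [hcd, ← sref_dualRoot D.kind hα0, ← (sref _).inner_map_map, sref_sref, ← coroot_map,
        sref_self (dualRoot_ne_zero D.kind hα0)]
      have : coroot (-dualRoot D.kind (D.α i)) = -coroot (dualRoot D.kind (D.α i)) := by
        simp [coroot]
      rw [this, inner_neg_right, hpair, neg_neg]) (by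
      change dualRoot D.kind (b : Z) = sref (D.α i) (dualRoot D.kind (c : Z))
      rw [hcd, sref_sref])
  change D.Tw (D.emb (sref (D.α i))) * bY _ * D.Tw (D.emb (sref (D.α i))) = bY _ at hcross
  rw [isConj_iff]
  refine ⟨D.Tw (D.emb (sref (D.α i))), ?_⟩
  rw [U, U, ← hcross, hc, Tw_sref_sref b.2 hp hi]
  group

/-- If `α_j^d` is a short root of `R₀^d`, then `T₀` is conjugate to `Y^{α_j^d} T_j⁻¹`. -/
theorem isConj_U_Tw_s_zero {j : Fin n} (hj : D.dual.IsShort (dualRoot D.kind (D.α j))) :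
    IsConj (U ⟨D.α j, D.isBasis.mem j⟩) (D.Tw (D.s 0)) := by
  -- a conjugate `U_b` with `b` of maximal height has `b` dominant
  set A : Set D.R₀ := {b | 0 < ⟪D.rho, (b : Z)⟫ ∧ ‖(b : Z)‖ = ‖D.α j‖ ∧
    IsConj (U ⟨D.α j, D.isBasis.mem j⟩) (U b)} with hA
  have : Finite D.R₀ := D.isRootSystem.finite
  obtain ⟨b, ⟨hp, hn, hc⟩, hmax⟩ := A.toFinite.exists_maximalFor
    (fun b : D.R₀ => ⟪D.rho, (b : Z)⟫) A
    ⟨⟨D.α j, D.isBasis.mem j⟩, by rw [D.based.ht]; exact one_pos, rfl, IsConj.refl _⟩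
  have hbs : D.dual.IsShort (dualRoot D.kind (b : Z)) := by
    obtain ⟨v, hv, hvb⟩ := D.based.exists_weyl_conj (D.isBasis.mem j) b.2 hn.symm
    refine ⟨⟨_, b.2, rfl⟩, fun c hc => ?_⟩
    rw [← hvb, dualRoot_map, LinearIsometryEquiv.norm_map]
    exact hj.2 c hc
  have hdom : IsDom D.α (b : Z) := by
    intro i
    by_contra hi
    push Not at hi
    have h1 : (⟨sref (D.α i) b, weyl_mem (D.based.simple_mem_weyl i) b.2⟩ : D.R₀) ∈ A := by
      refine ⟨?_, ?_, hc.trans (U_sref hbs hp hi rfl)⟩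
      · refine D.based.sref_pos b.2 hp fun h => ?_
        rw [h] at hi
        exact absurd hi (not_lt.2 real_inner_self_nonneg)
      · rw [LinearIsometryEquiv.norm_map, hn]
    have h2 : ⟪D.rho, (b : Z)⟫ < ⟪D.rho, sref (D.α i) b⟫ := by
      have := (inner_coroot_neg (D.based.simple_ne_zero i)).2 hi
      rw [sref_apply, inner_sub_right, inner_smul_right, D.based.ht]
      linarith
    have h3 : ⟪D.rho, sref (D.α i) b⟫ ≤ ⟪D.rho, (b : Z)⟫ := hmax h1 h2.le
    linarith
  have hbb : dualRoot D.kind (b : Z) = dualRoot D.kind (D.beta : Z) :=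
    D.dual.based.dom_unique (D.dual_isDom (ne_zero b.2) hdom) ⟨_, b.2, rfl⟩ D.dual_beta_dom
      ⟨_, D.beta.2, rfl⟩ (le_antisymm (hbs.2 _ ⟨_, D.beta.2, rfl⟩)
        (D.dual_isShort_beta.2 _ ⟨_, b.2, rfl⟩))
  have hbb' : b = D.beta := by
    have := congrArg (dualRoot D.kind) hbb
    rw [dualRoot_dualRoot _ (ne_zero b.2), dualRoot_dualRoot _ (ne_zero D.beta.2)] at this
    exact Subtype.ext this
  rw [Tw_s_zero, ← hbb']
  exact hc

theorem isConj_T_zero {j : Fin n} (hj : D.dual.IsShort (dualRoot D.kind (D.α j))) :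
    IsConj (D.Y ⟨dualRoot D.kind (D.α j), D.dualRoot_mem _ (D.isBasis.mem j)⟩ * (D.T j.succ)⁻¹)
      (D.T 0) := by
  have := D.toDA.map_isConj (isConj_U_Tw_s_zero hj)
  rwa [U, map_mul, map_inv, toDA_bY, toDA_emb_simple, toDA_Tw_s] at this

/-! ### The images of `T₀` and of the `Vᵢ` under duality -/

theorem isConj_mul_comm {G : Type*} [Group G] (a b : G) : IsConj (a * b) (b * a) :=
  isConj_iff.2 ⟨b, by group⟩

theorem isConj_op {G : Type*} [Group G] {a b : G} (h : IsConj a b) : IsConj (op a) (op b) := by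
  obtain ⟨c, rfl⟩ := isConj_iff.1 h
  exact isConj_iff.2 ⟨op c⁻¹, by simp [mul_assoc]⟩

theorem V_succ (j : Fin n) :
    D.V j.succ = D.X (-⟨D.α j, D.root_mem _ (D.isBasis.mem j)⟩) * (D.T j.succ)⁻¹ := by
  rw [V, X]
  congr 2
  apply Subtype.ext
  ext
  · rfl
  · exact neg_zero

/-- Up to conjugacy, duality takes `T₀` to the `V_j` belonging to the short simple roots of the
dual root system. -/
theorem isConj_deltaHom_T_zero {j : Fin n} (hj : D.dual.IsShort (D.dual.α j)) :
    IsConj (D.deltaHom (D.T 0)) (op (D.dual.V j.succ)) := by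
  refine (D.deltaHom.map_isConj (isConj_T_zero hj).symm).trans ?_
  rw [map_mul, map_inv, deltaHom_Y, deltaHom_T, V_succ, op_mul, ← op_inv]
  exact isConj_mul_comm _ _

/-- Up to conjugacy, duality takes the `V_j` belonging to the short simple roots to `T₀`. -/
theorem isConj_deltaHom_V_succ {j : Fin n} (hj : D.IsShort (D.α j)) :
    IsConj (D.deltaHom (D.V j.succ)) (op (D.dual.T 0)) := by
  have hj' : D.dual.dual.IsShort (dualRoot D.dual.kind (D.dual.α j)) := by
    rwa [dual_dual, dualRoot_dual_α]
  refine IsConj.trans ?_ (isConj_op (isConj_T_zero hj'))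
  have h1 : -D.toLamD (-⟨D.α j, D.root_mem _ (D.isBasis.mem j)⟩) =
      ⟨dualRoot D.dual.kind (D.dual.α j), D.dual.dualRoot_mem _ (D.dual.isBasis.mem j)⟩ := by
    apply Subtype.ext
    change -(-D.α j) = dualRoot D.dual.kind (D.dual.α j)
    rw [neg_neg, dualRoot_dual_α]
  rw [V_succ, map_mul, map_inv, deltaHom_X, deltaHom_T, h1, op_mul, ← op_inv]
  exact isConj_mul_comm _ _

/-- If `β` is short then `β^d` plays the role of `β` for the dual data. -/
theorem dual_beta_of_isShort (h : D.IsShort (D.beta : Z)) :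
    (D.dual.beta : Z) = dualRoot D.kind (D.beta : Z) := by
  have h1 := D.dual.dual_isShort_beta
  have h2 := D.dual.dual_beta_dom
  rw [dual_dual] at h1 h2
  have h3 : dualRoot D.dual.kind (D.dual.beta : Z) = D.beta :=
    D.based.dom_unique h2 h1.1 D.beta_dom D.beta.2
      (le_antisymm (h1.2 _ D.beta.2) (h.2 _ h1.1))
  rw [← h3]
  exact (dualRoot_dualRoot _ (ne_zero D.dual.beta.2)).symm

theorem V_zero : D.V 0 = D.X ⟨D.beta, D.root_mem _ D.beta.2⟩ * D.Xc (-mu D.kind (D.beta : Z)) *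
    (D.T 0)⁻¹ := by
  rw [V, Xhat_eq]
  congr 3
  apply Subtype.ext
  exact neg_neg _

/-- Duality fixes `V₀` if `β` is short, which is the case if `0 ∈ S`. -/
theorem deltaHom_V_zero (h : D.IsShort (D.beta : Z)) : D.deltaHom (D.V 0) = op (D.dual.V 0) := by
  have hb := dual_beta_of_isShort h
  have hb0 := ne_zero D.beta.2
  set y : D.dual.Lam := -D.toLam ⟨_, D.dualRoot_mem _ D.beta.2⟩ with hy
  have h0 : D.deltaHom (D.T 0) = op (EX (D := D.dual) (sref (dualRoot D.kind (D.beta : Z))) y) :=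
    preDelta_s_zero y rfl
  have hsm : sref (dualRoot D.kind (D.beta : Z)) ∈ weyl D.dual.R₀ :=
    sref_mem_weyl ⟨_, D.beta.2, rfl⟩
  have h1 : D.dual.T 0 = D.dual.Y (D.toLamD ⟨D.beta, D.root_mem _ D.beta.2⟩) *
      D.dual.toDA (D.dual.braidData.E (D.dual.emb (sref (dualRoot D.kind (D.beta : Z))))) := by
    rw [← toDA_Tw_s, Tw_s_zero, U, BernsteinData.E_emb _ hsm, sref_inv, map_mul, toDA_bY]
    congr 2
    · congr 1
      change dualRoot D.dual.kind (D.dual.beta : Z) = D.beta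
      rw [hb]
      exact dualRoot_dualRoot _ hb0
    · rw [hb]
      rfl
  have h2 : D.dual.X ⟨D.dual.beta, D.dual.root_mem _ D.dual.beta.2⟩ = (D.dual.X y)⁻¹ := by
    rw [← X_neg]
    congr 1
    apply Subtype.ext
    rw [hy, neg_neg]
    exact hb
  have h3 : mu D.dual.kind (D.dual.beta : Z) = mu D.kind (D.beta : Z) := by
    rw [hb]
    exact mu_dualRoot _ hb0
  rw [V_zero, V_zero, map_mul, map_mul, map_inv, h0, deltaHom_X, deltaHom_Xc, ← op_mul, ← op_inv,
    ← op_mul, h1, h2, h3, EX, Y_neg]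
  congr 1
  simp only [mul_inv_rev, mul_assoc]
  rw [← map_inv, ← mul_assoc (D.dual.toDA _) (D.dual.Xc _), toDA_mul_Xc, mul_assoc]

end InitialData

namespace InitialData

variable {Z : Type*} [NormedAddCommGroup Z] [InnerProductSpace ℝ Z] [FiniteDimensional ℝ Z] {n : ℕ}
  {D : InitialData Z n}

/-! ### Orbits of affine roots -/

/-- The simple affine roots `a_i` and `a_j` lie in the same `W`-orbit. -/
def Conj (D : InitialData Z n) (i j : Fin (n + 1)) : Prop := ∃ w : D.W, w.1 (D.a i) = D.a j

theorem Conj.symm {i j : Fin (n + 1)} (h : D.Conj i j) : D.Conj j i := by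
  obtain ⟨w, hw⟩ := h
  exact ⟨w⁻¹, by rw [← hw, W_inv_apply_apply]⟩

theorem affRefl_eq_trans_smul (b : Z) (m : ℝ) :
    affRefl (b, m * mu D.kind b) = trans ((-m) • dualRoot D.kind b) * affRefl (b, 0) := by
  rcases eq_or_ne b 0 with rfl | hb
  · ext x : 1
    rw [LinearEquiv.mul_apply, trans_apply, affRefl_apply, affRefl_apply]
    simp [dualRoot, coroot]
  ext x : 1
  have h2 := inner_coroot_self hb
  rw [LinearEquiv.mul_apply, trans_apply, affRefl_apply, affRefl_apply]
  ext
  · simp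
  · simp only [Prod.snd_sub, Prod.smul_snd, Prod.fst_sub, Prod.smul_fst, smul_eq_mul, mul_zero,
      dualRoot, inner_smul_right, inner_sub_left, inner_smul_left, h2, RCLike.conj_to_real,
      real_inner_comm x.1 (coroot b)]
    ring

theorem Wb_le_W : D.Wb ≤ D.W := by
  refine (Subgroup.closure_le _).2 ?_
  rintro _ ⟨_, ⟨b, hb, m, rfl⟩, rfl⟩
  rw [affRefl_eq_trans_smul]
  refine mul_mem (Subgroup.subset_closure (Or.inr ⟨_, ?_, rfl⟩))
    (Subgroup.subset_closure (Or.inl ⟨b, hb, rfl⟩))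
  have := D.LamD.smul_mem (-m) (D.dualRoot_mem b hb)
  rwa [← Int.cast_smul_eq_zsmul ℝ, Int.cast_neg] at this

theorem lin_mem_Lam (w : D.W) {l : Z} (hl : l ∈ D.Lam) : D.lin w l ∈ D.Lam := by
  have := D.mem_LamHat.1 ((D.W_apply_mem w.2 (l, 0)).2 (D.mem_LamHat.2 hl))
  rwa [apply_fst] at this

/-- Membership of `i` in `S` depends on the orbit of the gradient of `a_i` under the finite Weyl
group only. -/
theorem mem_S_of_weyl {i j : Fin (n + 1)} {v : Z ≃ₗᵢ[ℝ] Z} (hv : v ∈ weyl D.R₀)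
    (h : v (D.a i).1 = (D.a j).1) (hi : i ∈ D.S) : j ∈ D.S := by
  have hmem : ∀ u ∈ weyl D.R₀, ∀ l ∈ D.Lam, u l ∈ D.Lam := by
    intro u hu l hl
    have := lin_mem_Lam (D.emb u) hl
    rwa [(lin_tr_emb hu).1] at this
  have h2 : {r : ℝ | ∃ l ∈ D.Lam, r = ⟪l, coroot (D.a j).1⟫} =
      {r : ℝ | ∃ l ∈ D.Lam, r = ⟪l, coroot (D.a i).1⟫} := by
    ext r
    constructor
    · rintro ⟨l, hl, rfl⟩
      refine ⟨v⁻¹ l, hmem _ (inv_mem hv) l hl, ?_⟩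
      rw [← h, coroot_map, ← v.inner_map_map (v⁻¹ l), ← isom_mul_apply, mul_inv_cancel]
      rfl
    · rintro ⟨l, hl, rfl⟩
      refine ⟨v l, hmem v hv l hl, ?_⟩
      rw [← h, coroot_map, LinearIsometryEquiv.inner_map_map]
  have hi' : _ = _ := hi
  rw [← h2] at hi'
  exact hi'

theorem mem_S_of_conj {i j : Fin (n + 1)} (h : D.Conj i j) (hi : i ∈ D.S) : j ∈ D.S := by
  obtain ⟨w, hw⟩ := h
  exact mem_S_of_weyl (D.lin_mem w) (by rw [← hw, apply_fst]) hi

theorem two_smul_notMem_Rb (i : Fin (n + 1)) : (2 : ℝ) • D.a i ∉ D.Rb := by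
  intro h
  rcases D.isRootSystem.reduced _ (D.a_fst_mem i) 2 (Rb_fst h) with h | h <;> norm_num at h

theorem two_smul_mem_R_iff (i : Fin (n + 1)) : (2 : ℝ) • D.a i ∈ D.R ↔ i ∈ D.S := by
  constructor
  · rintro (h | ⟨j, hj, w, hw, h⟩)
    · exact absurd h (two_smul_notMem_Rb i)
    · rw [map_smul] at h
      exact mem_S_of_conj ⟨⟨w, Wb_le_W hw⟩, (smul_right_injective _ (two_ne_zero (α := ℝ)) h).symm⟩ hj
  · exact fun h => Or.inr ⟨i, h, 1, one_mem _, rfl⟩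

theorem exists_inner_eq_one_of_notMem_S {i : Fin (n + 1)} (h : i ∉ D.S) :
    ∃ l ∈ D.Lam, ⟪l, coroot (D.a i).1⟫ = 1 := by
  have hm := D.a_fst_mem i
  have h2 := inner_coroot_self (D.isRootSystem.ne_zero _ hm)
  have hodd : ∃ l ∈ D.Lam, ∃ k : ℤ, ⟪l, coroot (D.a i).1⟫ = 2 * k + 1 := by
    by_contra hcon
    push Not at hcon
    refine h (Set.ext fun r => ⟨?_, ?_⟩)
    · rintro ⟨l, hl, rfl⟩
      obtain ⟨k, hk⟩ := D.inner_coroot_int l hl _ hm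
      rcases Int.even_or_odd' k with ⟨m, rfl | rfl⟩
      · exact ⟨m, by rw [hk]; push_cast; ring⟩
      · exact absurd (by rw [hk]; push_cast; ring) (hcon l hl m)
    · rintro ⟨k, rfl⟩
      refine ⟨k • (D.a i).1, D.Lam.smul_mem k (D.root_mem _ hm), ?_⟩
      rw [← Int.cast_smul_eq_zsmul ℝ, inner_smul_left, h2]
      simp [mul_comm]
  obtain ⟨l, hl, k, hk⟩ := hodd
  refine ⟨l - k • (D.a i).1, D.Lam.sub_mem hl (D.Lam.smul_mem k (D.root_mem _ hm)), ?_⟩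
  rw [← Int.cast_smul_eq_zsmul ℝ, inner_sub_left, inner_smul_left, h2, hk]
  simp
  ring

theorem notMem_S_of_inner_eq_one {i : Fin (n + 1)} {l : Z} (hl : l ∈ D.Lam)
    (h : ⟪l, coroot (D.a i).1⟫ = 1) : i ∉ D.S := by
  intro hi
  have hi' : _ = _ := hi
  have h1 : (1 : ℝ) ∈ {r : ℝ | ∃ l ∈ D.Lam, r = ⟪l, coroot (D.a i).1⟫} := ⟨l, hl, h.symm⟩
  rw [hi'] at h1
  obtain ⟨k, hk⟩ := h1
  have : (1 : ℤ) = 2 * k := by exact_mod_cast hk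
  omega

/-- Only short roots occur in `S`. -/
theorem isShort_of_mem_S {i : Fin (n + 1)} (h : i ∈ D.S) : D.IsShort (D.a i).1 := by
  refine ⟨D.a_fst_mem i, D.based.short_of_even (D.a_fst_mem i) fun b hb => ?_⟩
  have h' : _ = _ := h
  have h1 : ⟪b, coroot (D.a i).1⟫ ∈ {r : ℝ | ∃ l ∈ D.Lam, r = ⟪l, coroot (D.a i).1⟫} :=
    ⟨b, D.root_mem b hb, rfl⟩
  rwa [h'] at h1

theorem isShort_neg_iff {b : Z} : D.IsShort (-b) ↔ D.IsShort b := by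
  have : ∀ c, D.IsShort c → D.IsShort (-c) := fun c h => ⟨D.neg_mem h.1, by rw [norm_neg]; exact h.2⟩
  exact ⟨fun h => by rw [← neg_neg b]; exact this _ h, this b⟩

theorem isShort_beta_of_mem_S (h : (0 : Fin (n + 1)) ∈ D.S) : D.IsShort (D.beta : Z) :=
  isShort_neg_iff.1 (isShort_of_mem_S h)

theorem IsShort.norm_eq {b c : Z} (hb : D.IsShort b) (hc : D.IsShort c) : ‖b‖ = ‖c‖ :=
  le_antisymm (hb.2 c hc.1) (hc.2 b hb.1)

theorem IsShort.of_norm_eq {b c : Z} (hb : D.IsShort b) (hc : c ∈ D.R₀) (h : ‖b‖ = ‖c‖) :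
    D.IsShort c := ⟨hc, fun a ha => h ▸ hb.2 a ha⟩

theorem exists_isShort_simple (D : InitialData Z n) : ∃ j, D.IsShort (D.α j) := by
  obtain ⟨f, hf, hmin⟩ := D.isRootSystem.finite.exists_minimalFor (fun b : Z => ‖b‖) D.R₀
    D.isRootSystem.nonempty
  obtain ⟨j, v, hv, hvj⟩ := D.based.exists_conj_simple hf
  have hs : D.IsShort f := ⟨hf, fun a ha => (le_total ‖f‖ ‖a‖).elim id fun h => hmin ha h⟩
  exact ⟨j, hs.of_norm_eq (D.isBasis.mem j) (by rw [← hvj, LinearIsometryEquiv.norm_map])⟩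

theorem norm_dualRoot_eq (k : Kind) {b c : Z} (hb : b ≠ 0) (hc : c ≠ 0)
    (h : ‖dualRoot k b‖ = ‖dualRoot k c‖) : ‖b‖ = ‖c‖ := by
  cases k
  · rw [dualRoot_u, dualRoot_u, norm_coroot hb, norm_coroot hc] at h
    have h1 := norm_pos_iff.2 hb
    have h2 := norm_pos_iff.2 hc
    rw [div_eq_div_iff h1.ne' h2.ne'] at h
    linarith
  · rwa [dualRoot_t hb, dualRoot_t hc] at h

theorem norm_dualRoot_congr (k : Kind) {b c : Z} (h : ‖b‖ = ‖c‖) :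
    ‖dualRoot k b‖ = ‖dualRoot k c‖ := by
  rw [dualRoot, dualRoot, coroot, coroot, norm_smul, norm_smul, norm_smul, norm_smul,
    mu_of_norm_eq k h, h]

theorem conj_succ {i j : Fin n} (h : ‖D.α i‖ = ‖D.α j‖) : D.Conj i.succ j.succ := by
  obtain ⟨v, hv, hvj⟩ := D.based.exists_weyl_conj (D.isBasis.mem i) (D.isBasis.mem j) h
  exact ⟨D.emb v, by rw [emb_apply hv, a_succ, a_succ, hvj]⟩

theorem Conj.norm_eq {i j : Fin (n + 1)} (h : D.Conj i j) : ‖(D.a i).1‖ = ‖(D.a j).1‖ := by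
  obtain ⟨w, hw⟩ := h
  rw [← hw, apply_fst, LinearIsometryEquiv.norm_map]

/-- If `β` and `α_j` have the same length, then `a₀` and `a_j` are conjugate as soon as some `ξ ∈
Λ^d` pairs to `1` with `(α_j^d)^∨`, that is, as soon as `j ∉ S^d`. -/
theorem conj_zero_succ {j : Fin n} (h : ‖(D.beta : Z)‖ = ‖D.α j‖) {ξ : Z} (hξ : ξ ∈ D.LamD)
    (h1 : ⟪ξ, coroot (dualRoot D.kind (D.α j))⟫ = 1) : D.Conj 0 j.succ := by
  have hα := D.based.simple_ne_zero j
  obtain ⟨v, hv, hvj⟩ := D.based.exists_weyl_conj (D.neg_mem D.beta.2) (D.isBasis.mem j)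
    (by rwa [norm_neg])
  refine ⟨D.tau ⟨ξ, hξ⟩ * D.emb v, ?_⟩
  rw [W_mul_apply, a_zero, emb_apply hv, tau_apply, hvj, a_succ, real_inner_comm,
    inner_eq_mu_mul D.kind hα, h1, mu_of_norm_eq D.kind h, mul_one, sub_self]

theorem exists_inner_of_conj_zero_succ {j : Fin n} (h : D.Conj 0 j.succ) : ∃ ξ ∈ D.LamD,
    ⟪ξ, coroot (dualRoot D.kind (D.α j))⟫ = 1 := by
  have hα := D.based.simple_ne_zero j
  have hn := h.norm_eq
  rw [a_zero, a_succ, norm_neg] at hn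
  obtain ⟨w, hw⟩ := h
  refine ⟨D.tr w, (D.tr w).2, ?_⟩
  rw [D.apply_eq, a_zero, a_succ, Prod.mk.injEq] at hw
  obtain ⟨hw1, hw2⟩ := hw
  dsimp only at hw1 hw2
  rw [hw1, real_inner_comm, inner_eq_mu_mul D.kind hα, mu_of_norm_eq D.kind hn] at hw2
  have := (mu_pos D.kind hα).ne'
  refine mul_left_cancel₀ this ?_
  linarith

/-- Every root of `R^•` lies in the `W`-orbit of a simple affine root. -/
theorem exists_conj_a {x : Z × ℝ} (hx : x ∈ D.Rb) : ∃ (i : Fin (n + 1)) (w : D.W), w.1 (D.a i) = x := by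
  obtain ⟨b, hb, m, rfl⟩ := hx
  obtain ⟨i, v, hv, rfl⟩ := D.based.exists_conj_simple hb
  have hα := D.isBasis.mem i
  have hα0 := ne_zero hα
  have hμ := mu_pos D.kind hα0
  rw [mu_map]
  suffices H : ∃ (j : Fin (n + 1)) (w : D.W), w.1 (D.a j) = (D.α i, m * mu D.kind (D.α i)) by
    obtain ⟨j, w, hw⟩ := H
    exact ⟨j, D.emb v * w, by rw [W_mul_apply, hw, emb_apply hv]⟩
  have hshift : ∀ ξ ∈ D.LamD, ∀ k : ℤ, ⟪ξ, coroot (dualRoot D.kind (D.α i))⟫ = k → ∀ r : ℝ,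
      ∃ w : D.W, w.1 (D.α i, r * mu D.kind (D.α i)) = (D.α i, (r - k) * mu D.kind (D.α i)) := by
    intro ξ hξ k hk r
    refine ⟨D.tau ⟨ξ, hξ⟩, ?_⟩
    rw [tau_apply, real_inner_comm, inner_eq_mu_mul D.kind hα0, hk]
    congr 1
    ring
  have h2 := inner_coroot_self (dualRoot_ne_zero D.kind hα0)
  have hmul : ∀ ξ ∈ D.LamD, ∀ k : ℤ, ∀ c : ℝ, ⟪ξ, coroot (dualRoot D.kind (D.α i))⟫ = c →
      (k • ξ ∈ D.LamD ∧ ⟪k • ξ, coroot (dualRoot D.kind (D.α i))⟫ = k * c) := by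
    intro ξ hξ k c hc
    refine ⟨D.LamD.smul_mem k hξ, ?_⟩
    rw [← Int.cast_smul_eq_zsmul ℝ, inner_smul_left, hc]
    rfl
  by_cases hS : i.succ ∈ D.dual.S
  · rcases Int.even_or_odd' m with ⟨k, rfl | rfl⟩
    · obtain ⟨h3, h4⟩ := hmul _ (D.dualRoot_mem _ hα) (-k) 2 h2
      obtain ⟨w, hw⟩ := hshift _ h3 (-k * 2) (by rw [h4]; push_cast; ring) 0
      refine ⟨i.succ, w, ?_⟩
      rw [a_succ]
      rw [zero_mul] at hw
      rw [hw]
      congr 1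
      push_cast
      ring
    · have hs : D.dual.IsShort (dualRoot D.kind (D.α i)) := isShort_of_mem_S hS
      have hn : ‖(D.beta : Z)‖ = ‖D.α i‖ := norm_dualRoot_eq D.kind (ne_zero D.beta.2) hα0
        (D.dual_isShort_beta.norm_eq hs)
      obtain ⟨v, hv, hvj⟩ := D.based.exists_weyl_conj (D.neg_mem D.beta.2) hα (by rwa [norm_neg])
      obtain ⟨h3, h4⟩ := hmul _ (D.dualRoot_mem _ hα) (-k) 2 h2
      obtain ⟨w, hw⟩ := hshift _ h3 (-k * 2) (by rw [h4]; push_cast; ring) 1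
      refine ⟨0, w * D.emb v, ?_⟩
      rw [W_mul_apply, emb_apply hv, a_zero]
      dsimp only
      rw [hvj, mu_of_norm_eq D.kind hn]
      rw [one_mul] at hw
      rw [hw]
      congr 1
      push_cast
      ring
  · obtain ⟨ξ, hξ, h1⟩ := exists_inner_eq_one_of_notMem_S hS
    obtain ⟨h3, h4⟩ := hmul ξ hξ (-m) 1 h1
    obtain ⟨w, hw⟩ := hshift _ h3 (-m) (by rw [h4]; push_cast; ring) 0
    refine ⟨i.succ, w, ?_⟩
    rw [a_succ]
    rw [zero_mul] at hw
    rw [hw]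
    congr 1
    push_cast
    ring

/-! ### Values of multiplicity functions -/

theorem Mult.val_eq_of_conj (κ : D.Mult) {i j : Fin (n + 1)} (h : D.Conj i j) : κ.val i = κ.val j := by
  obtain ⟨w, hw⟩ := h
  exact (κ.invariant w.1 w.2 _ _ hw.symm).symm

theorem Mult.val2_of_mem (κ : D.Mult) {i : Fin (n + 1)} (h : i ∈ D.S) :
    κ.val2 i = κ.toFun ⟨(2 : ℝ) • D.a i, (two_smul_mem_R_iff i).2 h⟩ :=
  dif_pos _

theorem Mult.val2_of_notMem (κ : D.Mult) {i : Fin (n + 1)} (h : i ∉ D.S) :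
    κ.val2 i = κ.val i :=
  dif_neg (mt (two_smul_mem_R_iff i).1 h)

theorem Mult.val2_eq_of_conj (κ : D.Mult) {i j : Fin (n + 1)} (h : D.Conj i j) :
    κ.val2 i = κ.val2 j := by
  by_cases hi : i ∈ D.S
  · have hj := mem_S_of_conj h hi
    rw [κ.val2_of_mem hi, κ.val2_of_mem hj]
    obtain ⟨w, hw⟩ := h
    refine (κ.invariant w.1 w.2 _ _ ?_).symm
    dsimp only
    rw [map_smul, hw]
  · have hj := mt (mem_S_of_conj h.symm) hi
    rw [κ.val2_of_notMem hi, κ.val2_of_notMem hj, κ.val_eq_of_conj h]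

/-- A multiplicity function is determined by its values on the `a_i` and on the `2 a_i` with `i ∈
S`. -/
theorem Mult.ext_val {κ κ' : D.Mult} (h : ∀ i, κ.val i = κ'.val i)
    (h2 : ∀ i ∈ D.S, κ.val2 i = κ'.val2 i) : κ = κ' := by
  ext1
  funext x
  rcases x with ⟨x, hx | ⟨i, hi, w, hw, hxw⟩⟩
  · obtain ⟨i, w, hw⟩ := exists_conj_a hx
    rw [κ.invariant w.1 w.2 ⟨D.a i, D.a_mem_R i⟩ _ hw.symm,
      κ'.invariant w.1 w.2 ⟨D.a i, D.a_mem_R i⟩ _ hw.symm]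
    exact h i
  · rw [κ.invariant w (Wb_le_W hw) ⟨(2 : ℝ) • D.a i, (two_smul_mem_R_iff i).2 hi⟩ _ hxw,
      κ'.invariant w (Wb_le_W hw) ⟨(2 : ℝ) • D.a i, (two_smul_mem_R_iff i).2 hi⟩ _ hxw,
      ← κ.val2_of_mem hi, ← κ'.val2_of_mem hi, h2 i hi]

open Classical in
/-- A multiplicity function may be prescribed on the simple affine roots `a_i` and on the `2 a_i`
with `i ∈ S`, subject to the obvious compatibility with the action of `W`. -/
theorem exists_mult (v v2 : Fin (n + 1) → ℂˣ) (hv : ∀ i j, D.Conj i j → v i = v j)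
    (hv2 : ∀ i ∈ D.S, ∀ j ∈ D.S, D.Conj i j → v2 i = v2 j) :
    ∃ κ : D.Mult, (∀ i, κ.val i = v i) ∧ ∀ i ∈ D.S, κ.val2 i = v2 i := by
  let Q : Z × ℝ → Prop := fun x => ∃ i, ∃ w : D.W, w.1 (D.a i) = x
  let Q2 : Z × ℝ → Prop := fun x => ∃ i, i ∈ D.S ∧ ∃ w : D.W, w.1 ((2 : ℝ) • D.a i) = x
  let F : Z × ℝ → ℂˣ := fun x =>
    if h : Q x then v h.choose else if h : Q2 x then v2 h.choose else 1
  have hconj : ∀ i j (w w' : D.W) x, w.1 (D.a i) = x → w'.1 (D.a j) = x → D.Conj i j := by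
    intro i j w w' x h h'
    exact ⟨w'⁻¹ * w, by rw [W_mul_apply, h, ← h', W_inv_apply_apply]⟩
  have hF1 : ∀ i (w : D.W) x, w.1 (D.a i) = x → F x = v i := by
    intro i w x h
    have hQ : Q x := ⟨i, w, h⟩
    obtain ⟨w', hw'⟩ := hQ.choose_spec
    exact (dif_pos hQ).trans (hv _ _ (hconj _ _ w' w x hw' h))
  have hnot : ∀ i (w : D.W) x, w.1 ((2 : ℝ) • D.a i) = x → ¬ Q x := by
    rintro i w x h ⟨j, w', h'⟩
    refine two_smul_notMem_Rb (D := D) i ?_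
    have := W_mem_Rb (w⁻¹ * w') (D.a_mem_Rb j)
    rwa [W_mul_apply, h', ← h, W_inv_apply_apply] at this
  have hF2 : ∀ i ∈ D.S, ∀ (w : D.W) x, w.1 ((2 : ℝ) • D.a i) = x → F x = v2 i := by
    intro i hi w x h
    have hQ : Q2 x := ⟨i, hi, w, h⟩
    obtain ⟨hj, w', hw'⟩ := hQ.choose_spec
    refine (dif_neg (hnot i w x h)).trans ((dif_pos hQ).trans (hv2 _ hj _ hi ?_))
    rw [map_smul] at h hw'
    exact hconj _ _ w' w ((2 : ℝ)⁻¹ • x)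
      ((inv_smul_smul₀ two_ne_zero _).symm.trans (congrArg ((2 : ℝ)⁻¹ • ·) hw'))
      (by rw [← h, inv_smul_smul₀ two_ne_zero])
  refine ⟨⟨fun x => F x, ?_⟩, fun i => hF1 i 1 _ rfl, fun i hi => ?_⟩
  · rintro w hw ⟨x, hx⟩ ⟨y, hy⟩ hxy
    change F y = F x
    replace hxy : y = w x := hxy
    rcases hx with hx | ⟨i, hi, w', hw', hxw⟩
    · obtain ⟨i, w', h⟩ := exists_conj_a hx
      rw [hF1 i w' x h, hF1 i (⟨w, hw⟩ * w') y (by rw [W_mul_apply, h, hxy])]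
    · rw [hF2 i hi ⟨w', Wb_le_W hw'⟩ x hxw.symm,
        hF2 i hi (⟨w, hw⟩ * ⟨w', Wb_le_W hw'⟩) y (by rw [W_mul_apply, ← hxw, hxy])]
  · rw [Mult.val2_of_mem _ hi]
    exact hF2 i hi 1 _ rfl

/-! ### The dual multiplicity function -/

theorem dual_isShort_beta_dual (D : InitialData Z n) :
    D.IsShort (dualRoot D.kind (D.dual.beta : Z)) := by
  have h := D.dual.dual_isShort_beta
  rwa [dual_dual] at h

theorem norm_dual_beta {j : Fin n} (h : D.IsShort (D.α j)) :
    ‖(D.dual.beta : Z)‖ = ‖D.dual.α j‖ := by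
  have h1 := norm_dualRoot_congr D.kind (D.dual_isShort_beta_dual.norm_eq h)
  rwa [dualRoot_dualRoot _ (ne_zero (D := D.dual) D.dual.beta.2)] at h1

/-- If `a₀^d` and `a_j^d` are conjugate, then `α_j` is short and `j ∉ S`. This makes the values
prescribed for the dual multiplicity function consistent, since then `κ_{2 α_j} = κ_{α_j}`. -/
theorem isShort_of_conj_dual {j : Fin n} (h : D.dual.Conj 0 j.succ) :
    D.IsShort (D.α j) ∧ j.succ ∉ D.S := by
  have hα0 := D.based.simple_ne_zero j
  have hn := h.norm_eq
  rw [a_zero, a_succ, norm_neg] at hn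
  obtain ⟨ξ, hξ, h1⟩ := exists_inner_of_conj_zero_succ h
  rw [dualRoot_dual_α] at h1
  refine ⟨D.dual_isShort_beta_dual.of_norm_eq (D.isBasis.mem j) ?_,
    notMem_S_of_inner_eq_one (i := j.succ) hξ h1⟩
  have := norm_dualRoot_congr D.kind hn
  rwa [show dualRoot D.kind (D.dual.α j) = D.α j from dualRoot_dual_α j] at this

/-- The dual multiplicity function exists: the values prescribed on the `a_i^d` and `2 a_i^d`
agree on conjugate roots. -/
theorem exists_isDual (κ : D.Mult) : ∃ κ' : D.dual.Mult, κ.IsDual κ' := by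
  obtain ⟨j₀, hj₀⟩ := D.exists_isShort_simple
  have hv2 : ∀ j, D.IsShort (D.α j) → κ.val2 j₀.succ = κ.val2 j.succ := fun j hj =>
    κ.val2_eq_of_conj (conj_succ (hj₀.norm_eq hj))
  have hc0 : ∀ j : Fin n, D.dual.Conj 0 j.succ → κ.val2 j₀.succ = κ.val j.succ := by
    intro j h
    obtain ⟨h1, h2⟩ := isShort_of_conj_dual h
    rw [hv2 j h1, κ.val2_of_notMem h2]
  have hc2 : ∀ j : Fin n, (0 : Fin (n + 1)) ∈ D.dual.S → D.dual.Conj 0 j.succ →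
      κ.val2 0 = κ.val 0 := by
    intro j h0 h
    obtain ⟨h1, h2⟩ := isShort_of_conj_dual h
    refine κ.val2_of_notMem fun h3 => h2 ?_
    obtain ⟨v, hv, hvj⟩ := D.based.exists_weyl_conj (D.neg_mem D.beta.2) (D.isBasis.mem j)
      (by rw [norm_neg]; exact (isShort_beta_of_mem_S h3).norm_eq h1)
    exact mem_S_of_weyl (i := 0) (j := j.succ) hv hvj h3
  obtain ⟨κ', h1, h2⟩ := exists_mult (D := D.dual)
    (Fin.cons (κ.val2 j₀.succ) fun j => κ.val j.succ) (Fin.cons (κ.val2 0) fun _ => κ.val 0)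
    (by
      intro i j
      refine Fin.cases ?_ (fun i => ?_) i <;> refine Fin.cases ?_ (fun j => ?_) j
      · exact fun _ => rfl
      · exact fun h => hc0 j h
      · exact fun h => (hc0 i h.symm).symm
      · intro h
        refine κ.val_eq_of_conj (conj_succ ?_)
        exact norm_dualRoot_eq D.kind (D.based.simple_ne_zero i) (D.based.simple_ne_zero j) h.norm_eq)
    (by
      intro i hi j hj
      revert hi hj
      refine Fin.cases ?_ (fun i => ?_) i <;> refine Fin.cases ?_ (fun j => ?_) j
      · exact fun _ _ _ => rfl
      · exact fun h0 _ h => hc2 j h0 h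
      · exact fun _ h0 h => (hc2 i h0 h.symm).symm
      · exact fun _ _ _ => rfl)
  refine ⟨κ', ⟨fun j hj => ?_, fun i => h1 i.succ, fun h => h2 0 h, fun j _ hj => h2 j.succ hj⟩⟩
  rw [h1 0, ← hv2 j hj]
  rfl

theorem Mult.IsDual.unique {κ : D.Mult} {κ' κ'' : D.dual.Mult} (h : κ.IsDual κ') (h' : κ.IsDual κ'') :
    κ' = κ'' := by
  refine Mult.ext_val (fun i => ?_) fun i => ?_
  · refine Fin.cases ?_ (fun j => ?_) i
    · obtain ⟨j, hj⟩ := D.exists_isShort_simple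
      rw [h.zero j hj, h'.zero j hj]
    · rw [h.succ, h'.succ]
  · refine Fin.cases (fun hi => ?_) (fun j hi => ?_) i
    · rw [h.two_zero hi, h'.two_zero hi]
    · have hs : D.dual.IsShort (D.dual.α j) := isShort_of_mem_S hi
      rw [h.two_succ j hs hi, h'.two_succ j hs hi]

end InitialData

/-! ### Symmetric form of the duality of multiplicity functions -/

namespace InitialData

variable {Z : Type*} [NormedAddCommGroup Z] [InnerProductSpace ℝ Z] [FiniteDimensional ℝ Z] {n : ℕ}
  {D : InitialData Z n}

open MulOpposite

/-- A form of the duality of multiplicity functions which is symmetric in the two sets of data. -/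
structure MutuallyDual {D D' : InitialData Z n} (κ : D.Mult) (κ' : D'.Mult) : Prop where
  succ : ∀ i : Fin n, κ.val i.succ = κ'.val i.succ
  zero : ∀ j : Fin n, D'.IsShort (D'.α j) → κ.val 0 = κ'.val2 j.succ
  zero' : ∀ j : Fin n, D.IsShort (D.α j) → κ'.val 0 = κ.val2 j.succ
  two : (0 : Fin (n + 1)) ∈ D.S → κ.val2 0 = κ'.val2 0
  two' : (0 : Fin (n + 1)) ∈ D'.S → κ'.val2 0 = κ.val2 0

theorem MutuallyDual.symm {D' : InitialData Z n} {κ : D.Mult} {κ' : D'.Mult}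
    (h : MutuallyDual κ κ') : MutuallyDual κ' κ :=
  ⟨fun i => (h.succ i).symm, h.zero', h.zero, h.two', h.two⟩

/-- The conditions that are not part of the definition concern indices outside `S^d`, where they
follow from the conjugacy of `a₀` and the short `a_j`. -/
theorem Mult.IsDual.mutuallyDual {κ : D.Mult} {κ' : D.dual.Mult} (h : κ.IsDual κ') :
    MutuallyDual κ κ' where
  succ i := (h.succ i).symm
  zero' := h.zero
  two' := h.two_zero
  zero := by
    intro j hj
    by_cases hS : j.succ ∈ D.dual.S
    · exact (h.two_succ j hj hS).symm
    · obtain ⟨ξ, hξ, h1⟩ := exists_inner_eq_one_of_notMem_S hS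
      rw [κ'.val2_of_notMem hS, h.succ]
      refine κ.val_eq_of_conj (conj_zero_succ ?_ hξ h1)
      exact norm_dualRoot_eq D.kind (ne_zero D.beta.2) (D.based.simple_ne_zero j)
        (D.dual_isShort_beta.norm_eq hj)
  two := by
    intro h0
    by_cases hS : (0 : Fin (n + 1)) ∈ D.dual.S
    · exact (h.two_zero hS).symm
    · obtain ⟨j, hj⟩ := D.exists_isShort_simple
      rw [κ'.val2_of_notMem hS, h.zero j hj]
      have hs := isShort_beta_of_mem_S h0
      have hS' : j.succ ∉ D.dual.S := by
        refine fun hc => hS ?_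
        obtain ⟨v, hv, hvj⟩ := D.dual.based.exists_weyl_conj (D.dual.isBasis.mem j)
          (D.dual.neg_mem D.dual.beta.2) (by rw [norm_neg, norm_dual_beta hj])
        exact mem_S_of_weyl (i := j.succ) (j := 0) hv hvj hc
      obtain ⟨ξ, hξ, h1⟩ := exists_inner_eq_one_of_notMem_S hS'
      exact κ.val2_eq_of_conj (conj_zero_succ (hs.norm_eq hj) hξ h1)

/-! ### Quadratic relations -/

/-- The quadratic relation `(x - k) (x + k⁻¹) = 0`. -/
def Quad {A : Type*} [Ring A] [Algebra ℂ A] (k : ℂˣ) (x : A) : Prop :=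
  (x - algebraMap ℂ A k) * (x + algebraMap ℂ A ((k⁻¹ : ℂˣ) : ℂ)) = 0

theorem Quad.op {A : Type*} [Ring A] [Algebra ℂ A] {k : ℂˣ} {x : A} (h : Quad k x) :
    Quad k (MulOpposite.op x) := by
  have h1 := Algebra.commutes (k : ℂ) x
  have h2 := Algebra.commutes ((k⁻¹ : ℂˣ) : ℂ) x
  have h3 := Algebra.commutes (k : ℂ) (algebraMap ℂ A ((k⁻¹ : ℂˣ) : ℂ))
  rw [Quad, sub_mul, mul_add, mul_add] at h
  rw [Quad, MulOpposite.algebraMap_apply, MulOpposite.algebraMap_apply, ← op_add, ← op_sub, ← op_mul,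
    op_eq_zero_iff, add_mul, mul_sub, mul_sub, ← h, h1, h2, h3]
  abel

theorem Quad.of_isConj {G A : Type*} [Group G] [Ring A] [Algebra ℂ A] (f : G →* A) {k : ℂˣ} {g g' : G}
    (hc : IsConj g g') (h : Quad k (f g)) : Quad k (f g') := by
  obtain ⟨c, rfl⟩ := isConj_iff.1 hc
  have h1 : f c * f c⁻¹ = 1 := by rw [← map_mul, mul_inv_cancel, map_one]
  have h2 : f c⁻¹ * f c = 1 := by rw [← map_mul, inv_mul_cancel, map_one]
  have key : ∀ z : ℂ, algebraMap ℂ A z = f c * algebraMap ℂ A z * f c⁻¹ := by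
    intro z
    rw [← Algebra.commutes, mul_assoc, h1, mul_one]
  rw [Quad, key k, key ((k⁻¹ : ℂˣ) : ℂ), map_mul, map_mul, ← sub_mul, ← mul_sub, ← add_mul, ← mul_add]
  calc _ = f c * ((f g - algebraMap ℂ A k) * (f c⁻¹ * f c) *
        (f g + algebraMap ℂ A ((k⁻¹ : ℂˣ) : ℂ))) * f c⁻¹ := by simp only [mul_assoc]
    _ = 0 := by
      rw [h2, mul_one]
      have : _ = _ := h
      rw [this, mul_zero, zero_mul]

/-- The canonical map from the double affine braid group to the double affine Hecke algebra. -/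
def heckeHom (κ : D.Mult) (q : ℝ) : D.DABraid →* DAHecke κ q :=
  ((RingQuot.mkAlgHom ℂ (HeckeRel κ q) : _ →ₐ[ℂ] _) : _ →* _).comp (MonoidAlgebra.of ℂ D.DABraid)

theorem quad_of_rel {κ : D.Mult} {q : ℝ} {k : ℂˣ} {g : D.DABraid}
    (h : HeckeRel κ q ((gp g - D.sc k) * (gp g + D.sc ((k⁻¹ : ℂˣ) : ℂ))) 0) :
    Quad k (heckeHom κ q g) := by
  have := RingQuot.mkAlgHom_rel ℂ h
  rw [map_mul, map_sub, map_add, map_zero, sc, sc, AlgHom.commutes, AlgHom.commutes] at this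
  exact this

theorem quad_T (κ : D.Mult) (q : ℝ) (i : Fin (n + 1)) : Quad (κ.val i) (heckeHom κ q (D.T i)) :=
  quad_of_rel (HeckeRel.quadT i)

/-- If `i ∉ S` then `V_i` is conjugate to `T_i`: if `(λ, a_i^∨) = 1` then
`V_i = X^{-λ} T_i X^λ`. -/
theorem isConj_T_V {i : Fin (n + 1)} (h : i ∉ D.S) : IsConj (D.T i) (D.V i) := by
  obtain ⟨l, hl, h1⟩ := exists_inner_eq_one_of_notMem_S h
  set x : D.LamHat := ⟨(l, 0), D.mem_LamHat.2 hl⟩ with hx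
  have h2 := rel_cross i x h1
  have h3 : D.act (D.s i) x = x + -D.aHat i := by
    apply Subtype.ext
    have h1' : ⟪coroot (D.a i).1, (x : Z × ℝ).1⟫ = 1 := by rw [real_inner_comm]; exact h1
    rw [coe_act, s_apply, h1', one_smul]
    exact sub_eq_add_neg _ _
  rw [h3, Xhat_add, mul_assoc] at h2
  rw [isConj_iff]
  refine ⟨(D.Xhat x)⁻¹, ?_⟩
  rw [inv_inv, V, eq_mul_inv_iff_mul_eq, mul_assoc, mul_assoc, inv_mul_eq_iff_eq_mul]
  exact h2

/-- `V_i` satisfies its quadratic relation for all `i`, including those outside `S`. -/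
theorem quad_V (κ : D.Mult) (q : ℝ) (i : Fin (n + 1)) : Quad (κ.val2 i) (heckeHom κ q (D.V i)) := by
  by_cases h : i ∈ D.S
  · exact quad_of_rel (HeckeRel.quadV i h)
  · rw [κ.val2_of_notMem h]
    exact (quad_T κ q i).of_isConj _ (isConj_T_V h)

/-! ### Duality of double affine Hecke algebras -/

/-- The composition of an antihomomorphism of double affine braid groups with the canonical map to
the double affine Hecke algebra. -/
def opHecke {D' : InitialData Z n} (f : D.DABraid →* (D'.DABraid)ᵐᵒᵖ) (κ' : D'.Mult) (q : ℝ) :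
    D.DABraid →* (DAHecke κ' q)ᵐᵒᵖ :=
  (MonoidHom.op (heckeHom κ' q)).comp f

theorem opHecke_apply {D' : InitialData Z n} (f : D.DABraid →* (D'.DABraid)ᵐᵒᵖ) (κ' : D'.Mult) (q : ℝ)
    (g : D.DABraid) : opHecke f κ' q g = op (heckeHom κ' q (unop (f g))) := rfl

/-- Antihomomorphisms preserve quadratic relations up to conjugacy. -/
theorem quad_opHecke {D' : InitialData Z n} {f : D.DABraid →* (D'.DABraid)ᵐᵒᵖ} {κ' : D'.Mult} {q : ℝ}
    {k : ℂˣ} {g : D.DABraid} {g' : D'.DABraid} (hc : IsConj (op g') (f g))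
    (h : Quad k (heckeHom κ' q g')) : Quad k (opHecke f κ' q g) :=
  h.op.of_isConj (MonoidHom.op (heckeHom κ' q)) hc

theorem quad_opHecke_T {D' : InitialData Z n} (hD : D.dual = D') {f : D.DABraid →* (D'.DABraid)ᵐᵒᵖ}
    (hf : IsDelta f) {κ : D.Mult} {κ' : D'.Mult} (h : MutuallyDual κ κ') (q : ℝ) (i : Fin (n + 1)) :
    Quad (κ.val i) (opHecke f κ' q (D.T i)) := by
  subst hD
  rw [hf.eq_deltaHom]
  refine Fin.cases ?_ (fun j => ?_) i
  · obtain ⟨j, hj⟩ := D.dual.exists_isShort_simple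
    rw [h.zero j hj]
    exact quad_opHecke (isConj_deltaHom_T_zero hj).symm (quad_V κ' q j.succ)
  · rw [h.succ]
    exact quad_opHecke (by rw [deltaHom_T]) (quad_T κ' q j.succ)

theorem quad_opHecke_V {D' : InitialData Z n} (hD : D.dual = D') {f : D.DABraid →* (D'.DABraid)ᵐᵒᵖ}
    (hf : IsDelta f) {κ : D.Mult} {κ' : D'.Mult} (h : MutuallyDual κ κ') (q : ℝ) {i : Fin (n + 1)}
    (hi : i ∈ D.S) : Quad (κ.val2 i) (opHecke f κ' q (D.V i)) := by
  subst hD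
  rw [hf.eq_deltaHom]
  revert hi
  refine Fin.cases (fun hi => ?_) (fun j hi => ?_) i
  · rw [h.two hi]
    exact quad_opHecke (by rw [deltaHom_V_zero (isShort_beta_of_mem_S hi)]) (quad_V κ' q 0)
  · have hj : D.IsShort (D.α j) := isShort_of_mem_S hi
    rw [← h.zero' j hj]
    exact quad_opHecke (isConj_deltaHom_V_succ hj).symm (quad_T κ' q 0)

theorem heckeHom_Xc (κ : D.Mult) (q r : ℝ) :
    heckeHom κ q (D.Xc r) = algebraMap ℂ _ ((q ^ r : ℝ) : ℂ) := by
  have := RingQuot.mkAlgHom_rel ℂ (HeckeRel.central (κ := κ) (q := q) r)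
  rw [sc, AlgHom.commutes] at this
  exact this

/-- The antihomomorphism of Hecke algebras induced by the duality antihomomorphism. -/
theorem exists_heckeDelta {D' : InitialData Z n} (hD : D.dual = D') {f : D.DABraid →* (D'.DABraid)ᵐᵒᵖ}
    (hf : IsDelta f) {κ : D.Mult} {κ' : D'.Mult} (h : MutuallyDual κ κ') (q : ℝ) :
    ∃ F : DAHecke κ q →ₐ[ℂ] (DAHecke κ' q)ᵐᵒᵖ, ∀ g, F (heckeHom κ q g) = opHecke f κ' q g := by
  set F₀ := MonoidAlgebra.lift ℂ (DAHecke κ' q)ᵐᵒᵖ D.DABraid (opHecke f κ' q) with hF₀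
  have hgp : ∀ g, F₀ (gp g) = opHecke f κ' q g := fun g => by
    rw [gp, hF₀, MonoidAlgebra.lift_of]
  have hrel : ∀ ⦃x y⦄, HeckeRel κ q x y → F₀ x = F₀ y := by
    rintro _ _ (r | i | ⟨i, hi⟩)
    · rw [hgp, sc, AlgHom.commutes, opHecke_apply, hf.Xc, unop_op, heckeHom_Xc]
      rfl
    · rw [map_mul, map_sub, map_add, map_zero, sc, sc, AlgHom.commutes, AlgHom.commutes, hgp]
      exact quad_opHecke_T hD hf h q i
    · rw [map_mul, map_sub, map_add, map_zero, sc, sc, AlgHom.commutes, AlgHom.commutes, hgp]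
      exact quad_opHecke_V hD hf h q hi
  refine ⟨RingQuot.liftAlgHom ℂ ⟨F₀, hrel⟩, fun g => ?_⟩
  rw [← hgp]
  exact RingQuot.liftAlgHom_mkAlgHom_apply ℂ F₀ hrel _

theorem heckeAlgHom_ext {κ : D.Mult} {q : ℝ} {A : Type*} [Ring A] [Algebra ℂ A]
    {F F' : DAHecke κ q →ₐ[ℂ] A} (h : ∀ g, F (heckeHom κ q g) = F' (heckeHom κ q g)) : F = F' :=
  RingQuot.ringQuot_ext' ℂ _ _ (MonoidAlgebra.algHom_ext h (Subsingleton.elim _ _))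

theorem exists_heckeEquiv {κ : D.Mult} {κ' : D.dual.Mult} (h : κ.IsDual κ') (q : ℝ) :
    ∃ δH : DAHecke κ q ≃ₐ[ℂ] (DAHecke κ' q)ᵐᵒᵖ, ∀ g : D.DABraid,
      δH (toHecke κ q g) = op (toHecke κ' q (unop (D.delta g))) := by
  obtain ⟨F, hF⟩ := exists_heckeDelta rfl D.isDelta_deltaHom h.mutuallyDual q
  have hg := D.exists_deltaInv.choose_spec
  obtain ⟨F', hF'⟩ := exists_heckeDelta D.dual_dual hg h.mutuallyDual.symm q
  have h1 : (AlgHom.op F').comp F = (AlgEquiv.opOp ℂ _).toAlgHom := by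
    refine heckeAlgHom_ext fun g => ?_
    change op (F' (unop (F (heckeHom κ q g)))) = op (op (heckeHom κ q g))
    rw [hF, opHecke_apply, unop_op, hF', opHecke_apply]
    congr 3
    exact D.delta.left_inv g
  have h2 : (AlgHom.op F).comp F' = (AlgEquiv.opOp ℂ _).toAlgHom := by
    refine heckeAlgHom_ext fun g => ?_
    change op (F (unop (F' (heckeHom κ' q g)))) = op (op (heckeHom κ' q g))
    rw [hF', opHecke_apply, unop_op, hF, opHecke_apply]
    congr 3
    exact congrArg unop (D.delta.right_inv (op g))
  refine ⟨AlgEquiv.ofBijective F ⟨fun x y hxy => ?_, fun y => ⟨unop (F' (unop y)), ?_⟩⟩, hF⟩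
  · have e : ∀ x, unop (F' (unop (F x))) = x := fun x =>
      congrArg (fun z => unop (unop z)) (DFunLike.congr_fun h1 x)
    rw [← e x, hxy, e]
  · exact congrArg unop (DFunLike.congr_fun h2 (unop y))

end InitialData

end DAHA

end

theorem mainTheorem7 {Z : Type*} [NormedAddCommGroup Z] [InnerProductSpace ℝ Z]
    [FiniteDimensional ℝ Z] {n : ℕ} (D : DAHA.InitialData Z n) :
    ∃ δ : D.DABraid ≃* (D.dual.DABraid)ᵐᵒᵖ,
      DAHA.InitialData.IsDuality δ ∧
      (∀ δ' : D.DABraid ≃* (D.dual.DABraid)ᵐᵒᵖ, DAHA.InitialData.IsDuality δ' → δ' = δ) ∧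
      ∀ q : ℝ, 0 < q → q ≠ 1 → ∀ κ : D.Mult,
        ∃ κd : D.dual.Mult,
          κ.IsDual κd ∧ (∀ κ' : D.dual.Mult, κ.IsDual κ' → κ' = κd) ∧
          ∃ δH : DAHA.InitialData.DAHecke κ q ≃ₐ[ℂ] (DAHA.InitialData.DAHecke κd q)ᵐᵒᵖ,
            ∀ g : D.DABraid,
              δH (DAHA.InitialData.toHecke κ q g) =
                MulOpposite.op (DAHA.InitialData.toHecke κd q (MulOpposite.unop (δ g))) := by
  refine ⟨D.delta, D.isDuality_delta, fun δ' h => h.eq_delta, fun q _ _ κ => ?_⟩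
  obtain ⟨κd, hκ⟩ := DAHA.InitialData.exists_isDual κ
  exact ⟨κd, hκ, fun κ' h => h.unique hκ, DAHA.InitialData.exists_heckeEquiv hκ q⟩
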